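/- Let $G$ be a compact Hausdorff topological group. A $G$-$C^*$-algebra $(A,\alpha)$ is a $C^*$-algebra $A$ with a group homomorphism $\alpha\colon G\to\mathrm{Aut}(A)$ such that $g\mapsto\alpha_g(a)$ is continuous for every $a\in A$; morphisms are equivariant $*$-homomorphisms. For (strongly continuous) unitary representations $(H_\mu,\mu)$, $(H_\nu,\nu)$ of $G$ on separable Hilbert spaces, $G$ acts on $\mathcal K(H_\mu,H_\nu)\otimes A$ (a corner of the $C^*$-algebra $\mathcal K(H_\mu\oplus H_\nu)\otimes A$) by $g\cdot(T\otimes a)=\nu_gT\mu_{g^{-1}}\otimes\alpha_g(a)$; a superscript $G$ denotes fixed points. **The semigroup $\mathrm{Cu}^G(A,\alpha)$.** For positive $a\in(\mathcal K(H_\mu)\otimes A)^G$ and $b\in(\mathcal K(H_\nu)\otimes A)^G$ write $a\precsim_G b$ if there are $G$-invariant $d_n\in\mathcal K(H_\nu,H_\mu)\otimes A$ with $\|d_nbd_n^*-a\|\to0$, and $a\sim_Gb$ if $a\precsim_Gb$ and $b\precsim_Ga$. $\mathrm{Cu}^G(A,\alpha)$ is the set of $\sim_G$-classes $[a]_G$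 of all positive elements of all $(\mathcal K(H_\mu)\otimes A)^G$, with $[a]_G+[b]_G=[a\oplus b]_G$, zero element $[0]_G$, and $[a]_G\le[b]_G$ iff $a\precsim_Gb$. An equivariant $*$-homomorphism $\varphi\colon A\to B$ induces $\mathrm{Cu}^G(\varphi)([a]_G)=[(\mathrm{id}\otimes\varphi)(a)]_G$. **The semiring $\mathrm{Cu}(G)$.** $\mathrm{Cu}(G)$ is the set of unitary equivalence classes $[\nu]$ of unitary representations of $G$ on separable Hilbert spaces, with direct sum as addition, tensor product as multiplication, the zero representation as $0$, the trivial one-dimensional representation as $1$, and $[\mu]\le[\nu]$ iff $\mu$ is unitarily equivalent to a subrepresentation of $\nu$. **The categories $\mathbf{Cu}$ and $\mathbf{Cu}^G$.** In an ordered set, $s\ll t$ means: for every increasing sequence $(t_n)$ having a supremum $\ge t$ there is $k$ with $s\le t_k$. An object of $\mathbf{Cu}$ is a partially ordered abelian monoid $S$ with order-preserving addition such that every increasing sequence has a supremum; every $s\in S$ is the supremum of a sequence with $s_n\ll s_{n+1}$ for all $n$; $\sup s_n+\sup t_n=\sup(s_n+t_n)$ for increasing sequences; and $s_1\ll t_1$,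 $s_2\ll t_2$ imply $s_1+s_2\ll t_1+t_2$. Morphisms of $\mathbf{Cu}$ are order-preserving monoid maps that preserve suprema of increasing sequences and $\ll$. An object of $\mathbf{Cu}^G$ is an object $S$ of $\mathbf{Cu}$ with the structure of a semimodule over $\mathrm{Cu}(G)$ (for all $r,s\in\mathrm{Cu}(G)$, $x,y\in S$: $1x=x$, $(rs)x=r(sx)$, $(r+s)x=rx+sx$, $r(x+y)=rx+ry$, $0x=0$, $r0=0$) such that $x\le y$, $r\le s$ imply $rx\le sy$; $x\ll y$, $r\ll s$ imply $rx\ll sy$; and, whenever $(x_n)$ in $S$ and $(r_n)$ in $\mathrm{Cu}(G)$ are increasing with suprema $x$ and $r$, $\sup_n(r_nx_n)=rx$. Morphisms of $\mathbf{Cu}^G$ are the $\mathbf{Cu}$-morphisms that commute with the action of $\mathrm{Cu}(G)$. A positive element $s$ of a $C^*$-algebra is *strictly positive* if $\tau(s)>0$ for every nonzero positive linear functional $\tau$. **Theorem.** 1. For every separable unitary representation $\nu$ of $G$ there is a $G$-invariant strictly positive element $s_\nu\in\mathcal K(H_\nu)$. 2. For every $G$-$C^*$-algebra $(A,\alpha)$,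 the formula $[\nu]\cdot[a]_G=[s_\nu\otimes a]_G$, where $s_\nu\otimes a\in(\mathcal K(H_\nu\otimes H_\mu)\otimes A)^G$ for $a\in(\mathcal K(H_\mu)\otimes A)^G$ and $s_\nu\in \mathcal K(H_\nu)^G$ is strictly positive, gives a well-defined action of $\mathrm{Cu}(G)$ on $\mathrm{Cu}^G(A,\alpha)$: the right-hand side depends only on the unitary equivalence class $[\nu]$ and on $[a]_G$, and not on the choices of $\nu$, $s_\nu$ and $a$. 3. With this action, $\mathrm{Cu}^G(A,\alpha)$ is an object of $\mathbf{Cu}^G$ for every $G$-$C^*$-algebra $(A,\alpha)$. 4. $(A,\alpha)\mapsto\mathrm{Cu}^G(A,\alpha)$, $\varphi\mapsto\mathrm{Cu}^G(\varphi)$ is a functor from the category of $G$-$C^*$-algebras to $\mathbf{Cu}^G$; in particular it is a functor to $\mathbf{Cu}$. -/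

import Mathlib

open scoped TensorProduct ENNReal Topology InnerProductSpace

universe u v

noncomputable section

namespace EqCuntz

open UniformSpace Filter
open ContinuousLinearMap (adjoint adjoint_comp adjoint_adjoint adjoint_id)

section

open ContinuousLinearMap

/-! ### Hilbert space tensor products -/

section HilbertTensor

variable {H H₁ H₂ H₃ L L₁ L₂ L₃ : Type*}
  [NormedAddCommGroup H] [InnerProductSpace ℂ H]
  [NormedAddCommGroup H₁] [InnerProductSpace ℂ H₁]
  [NormedAddCommGroup H₂] [InnerProductSpace ℂ H₂]
  [NormedAddCommGroup H₃] [InnerProductSpace ℂ H₃]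
  [NormedAddCommGroup L] [InnerProductSpace ℂ L]
  [NormedAddCommGroup L₁] [InnerProductSpace ℂ L₁]
  [NormedAddCommGroup L₂] [InnerProductSpace ℂ L₂]
  [NormedAddCommGroup L₃] [InnerProductSpace ℂ L₃]

/-- The Hilbert space tensor product: the completion of the algebraic tensor product. -/
def HTensor (H L : Type*) [NormedAddCommGroup H] [InnerProductSpace ℂ H]
    [NormedAddCommGroup L] [InnerProductSpace ℂ L] : Type _ :=
  Completion (H ⊗[ℂ] L)

instance : NormedAddCommGroup (HTensor H L) :=
  inferInstanceAs (NormedAddCommGroup (Completion (H ⊗[ℂ] L)))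

instance : InnerProductSpace ℂ (HTensor H L) :=
  inferInstanceAs (InnerProductSpace ℂ (Completion (H ⊗[ℂ] L)))

instance : CompleteSpace (HTensor H L) :=
  inferInstanceAs (CompleteSpace (Completion (H ⊗[ℂ] L)))

/-- The inclusion of the algebraic tensor product. -/
def HTensor.incl (H L : Type*) [NormedAddCommGroup H] [InnerProductSpace ℂ H]
    [NormedAddCommGroup L] [InnerProductSpace ℂ L] : H ⊗[ℂ] L →ₗᵢ[ℂ] HTensor H L :=
  (Completion.toComplₗᵢ : H ⊗[ℂ] L →ₗᵢ[ℂ] Completion (H ⊗[ℂ] L))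

theorem HTensor.denseRange_incl : DenseRange (HTensor.incl H L) :=
  Completion.denseRange_coe

/-- The elementary tensor `ξ ⊗ η`. -/
def htmul (ξ : H) (η : L) : HTensor H L := HTensor.incl H L (ξ ⊗ₜ[ℂ] η)

theorem HTensor.induction {p : HTensor H L → Prop} (hcl : IsClosed {z | p z})
    (hadd : ∀ x y, p x → p y → p (x + y)) (ht : ∀ ξ η, p (htmul ξ η)) (z : HTensor H L) : p z := by
  refine HTensor.denseRange_incl.induction_on z hcl fun t => ?_
  induction t using TensorProduct.induction_on with
  | zero => simpa [htmul] using ht (0 : H) (0 : L)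
  | tmul a b => exact ht a b
  | add x y hx hy => rw [map_add]; exact hadd _ _ hx hy

theorem HTensor.ext {E : Type*} [NormedAddCommGroup E] [NormedSpace ℂ E]
    {f g : HTensor H L →L[ℂ] E} (h : ∀ ξ η, f (htmul ξ η) = g (htmul ξ η)) : f = g := by
  ext x
  induction x using HTensor.induction with
  | hcl => exact isClosed_eq f.continuous g.continuous
  | hadd x y hx hy => rw [map_add, map_add, hx, hy]
  | ht ξ η => exact h ξ η

@[simp] theorem inner_htmul (ξ ξ' : H) (η η' : L) :
    inner ℂ (htmul ξ η) (htmul ξ' η') = inner ℂ ξ ξ' * inner ℂ η η' := by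
  simp [htmul]

theorem htmul_add_left (ξ ξ' : H) (η : L) : htmul (ξ + ξ') η = htmul ξ η + htmul ξ' η := by
  simp [htmul, TensorProduct.add_tmul]

theorem htmul_add_right (ξ : H) (η η' : L) : htmul ξ (η + η') = htmul ξ η + htmul ξ η' := by
  simp [htmul, TensorProduct.tmul_add]

theorem htmul_smul_left (c : ℂ) (ξ : H) (η : L) : htmul (c • ξ) η = c • htmul ξ η := by
  simp [htmul, ← TensorProduct.smul_tmul']

theorem htmul_smul_right (c : ℂ) (ξ : H) (η : L) : htmul ξ (c • η) = c • htmul ξ η := by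
  simp [htmul]

@[simp] theorem htmul_zero_left (η : L) : htmul (0 : H) η = 0 := by simp [htmul]

@[simp] theorem htmul_zero_right (ξ : H) : htmul ξ (0 : L) = 0 := by simp [htmul]

theorem continuous_htmul_left (η : L) : Continuous fun ξ : H => htmul ξ η :=
  (HTensor.incl H L).continuous.comp (by fun_prop)

theorem continuous_htmul_right (ξ : H) : Continuous fun η : L => htmul ξ η :=
  (HTensor.incl H L).continuous.comp (by fun_prop)

/-- The bounded operator `S ⊗ T` on Hilbert space tensor products: the continuous extension of
the algebraic tensor product of `S` and `T`. -/
def htmap (S : H₁ →L[ℂ] H₂) (T : L₁ →L[ℂ] L₂) : HTensor H₁ L₁ →L[ℂ] HTensor H₂ L₂ :=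
  ((HTensor.incl H₂ L₂).toLinearMap ∘ₗ (TensorProduct.mapL S T).toLinearMap).extendOfNorm
    (HTensor.incl H₁ L₁).toLinearMap

theorem htmap_bound (S : H₁ →L[ℂ] H₂) (T : L₁ →L[ℂ] L₂) (x : H₁ ⊗[ℂ] L₁) :
    ‖((HTensor.incl H₂ L₂).toLinearMap ∘ₗ (TensorProduct.mapL S T).toLinearMap) x‖ ≤
      ‖S‖ * ‖T‖ * ‖(HTensor.incl H₁ L₁).toLinearMap x‖ :=
  calc _ = ‖TensorProduct.mapL S T x‖ := (HTensor.incl H₂ L₂).norm_map _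
    _ ≤ ‖S‖ * ‖T‖ * ‖x‖ :=
      (le_opNorm _ _).trans (by gcongr; exact TensorProduct.norm_mapL_le S T)
    _ = _ := by rw [← (HTensor.incl H₁ L₁).norm_map x]; rfl

@[simp] theorem htmap_htmul (S : H₁ →L[ℂ] H₂) (T : L₁ →L[ℂ] L₂) (ξ : H₁) (η : L₁) :
    htmap S T (htmul ξ η) = htmul (S ξ) (T η) :=
  LinearMap.extendOfNorm_eq HTensor.denseRange_incl ⟨_, htmap_bound S T⟩ (ξ ⊗ₜ[ℂ] η)

theorem norm_htmap_le (S : H₁ →L[ℂ] H₂) (T : L₁ →L[ℂ] L₂) : ‖htmap S T‖ ≤ ‖S‖ * ‖T‖ :=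
  LinearMap.opNorm_extendOfNorm_le HTensor.denseRange_incl (by positivity) (htmap_bound S T)

theorem htmap_comp (S : H₂ →L[ℂ] H₃) (T : L₂ →L[ℂ] L₃) (S' : H₁ →L[ℂ] H₂) (T' : L₁ →L[ℂ] L₂) :
    htmap S T ∘L htmap S' T' = htmap (S ∘L S') (T ∘L T') :=
  HTensor.ext fun ξ η => by simp

@[simp] theorem htmap_id : htmap (.id ℂ H) (.id ℂ L) = .id ℂ (HTensor H L) :=
  HTensor.ext fun ξ η => by simp

theorem htmap_add_left (S S' : H₁ →L[ℂ] H₂) (T : L₁ →L[ℂ] L₂) :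
    htmap (S + S') T = htmap S T + htmap S' T :=
  HTensor.ext fun ξ η => by simp [htmul_add_left]

theorem htmap_add_right (S : H₁ →L[ℂ] H₂) (T T' : L₁ →L[ℂ] L₂) :
    htmap S (T + T') = htmap S T + htmap S T' :=
  HTensor.ext fun ξ η => by simp [htmul_add_right]

theorem htmap_smul_right (c : ℂ) (S : H₁ →L[ℂ] H₂) (T : L₁ →L[ℂ] L₂) :
    htmap S (c • T) = c • htmap S T :=
  HTensor.ext fun ξ η => by simp [htmul_smul_right]

theorem adjoint_htmap [CompleteSpace H₁] [CompleteSpace H₂] [CompleteSpace L₁] [CompleteSpace L₂]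
    (S : H₁ →L[ℂ] H₂) (T : L₁ →L[ℂ] L₂) :
    adjoint (htmap S T) = htmap (adjoint S) (adjoint T) := by
  symm
  rw [eq_adjoint_iff]
  intro x y
  induction x using HTensor.induction with
  | hcl => exact isClosed_eq (by fun_prop) (by fun_prop)
  | hadd a b ha hb => simp only [map_add, inner_add_left, ha, hb]
  | ht a b =>
    induction y using HTensor.induction with
    | hcl => exact isClosed_eq (by fun_prop) (by fun_prop)
    | hadd a b ha hb => simp only [map_add, inner_add_right, ha, hb]
    | ht c d => simp [adjoint_inner_left]

/-- The map `ξ ⊗ η ↦ i ξ ⊗ j η` from an algebraic tensor product into a Hilbert space tensor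
product. -/
def algToHTensor (i : H₁ →ₗᵢ[ℂ] H₂) (j : L₁ →ₗᵢ[ℂ] L₂) : H₁ ⊗[ℂ] L₁ →ₗᵢ[ℂ] HTensor H₂ L₂ :=
  (HTensor.incl H₂ L₂).comp (TensorProduct.mapIsometry i j)

theorem algToHTensor_tmul (i : H₁ →ₗᵢ[ℂ] H₂) (j : L₁ →ₗᵢ[ℂ] L₂) (ξ : H₁) (η : L₁) :
    algToHTensor i j (ξ ⊗ₜ η) = htmul (i ξ) (j η) := by
  simp [algToHTensor, htmul]

theorem denseRange_algToHTensor {i : H₁ →ₗᵢ[ℂ] H₂} {j : L₁ →ₗᵢ[ℂ] L₂}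
    (hi : DenseRange i) (hj : DenseRange j) : DenseRange (algToHTensor i j) := by
  set R := (LinearMap.range (algToHTensor i j).toLinearMap).topologicalClosure with hR
  have hcl : IsClosed (R : Set (HTensor H₂ L₂)) := Submodule.isClosed_topologicalClosure _
  have key : ∀ z, z ∈ R := by
    intro z
    induction z using HTensor.induction with
    | hcl => exact hcl
    | hadd x y hx hy => exact R.add_mem hx hy
    | ht ξ η =>
      refine hi.induction_on (p := fun ξ => htmul ξ η ∈ R) ξ
        (hcl.preimage (continuous_htmul_left η)) fun a => ?_
      refine hj.induction_on (p := fun η => htmul (i a) η ∈ R) η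
        (hcl.preimage (continuous_htmul_right _)) fun b => ?_
      exact Submodule.le_topologicalClosure _ ⟨a ⊗ₜ b, algToHTensor_tmul i j a b⟩
  intro z
  have h := key z
  rw [hR, ← SetLike.mem_coe, Submodule.topologicalClosure_coe] at h
  exact h

/-- Associativity of the Hilbert space tensor product. -/
def htassoc (X Y Z : Type*) [NormedAddCommGroup X] [InnerProductSpace ℂ X]
    [NormedAddCommGroup Y] [InnerProductSpace ℂ Y] [NormedAddCommGroup Z] [InnerProductSpace ℂ Z] :
    HTensor (HTensor X Y) Z ≃ₗᵢ[ℂ] HTensor X (HTensor Y Z) :=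
  (TensorProduct.assocIsometry ℂ X Y Z).toLinearEquiv.extendOfIsometry
    (algToHTensor (HTensor.incl X Y) LinearIsometry.id).toLinearMap
    (algToHTensor LinearIsometry.id (HTensor.incl Y Z)).toLinearMap
    (denseRange_algToHTensor HTensor.denseRange_incl Function.surjective_id.denseRange)
    (denseRange_algToHTensor Function.surjective_id.denseRange HTensor.denseRange_incl)
    (fun x => ((algToHTensor _ _).norm_map _).trans
      (((TensorProduct.assocIsometry ℂ X Y Z).norm_map x).trans ((algToHTensor _ _).norm_map x).symm))

@[simp] theorem htassoc_htmul (ξ : H₁) (η : H₂) (ζ : H₃) :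
    htassoc H₁ H₂ H₃ (htmul (htmul ξ η) ζ) = htmul ξ (htmul η ζ) := by
  have h : htassoc H₁ H₂ H₃ (algToHTensor (HTensor.incl H₁ H₂) LinearIsometry.id
        ((ξ ⊗ₜ[ℂ] η) ⊗ₜ[ℂ] ζ)) = algToHTensor LinearIsometry.id (HTensor.incl H₂ H₃)
          (TensorProduct.assocIsometry ℂ H₁ H₂ H₃ ((ξ ⊗ₜ[ℂ] η) ⊗ₜ[ℂ] ζ)) :=
    LinearEquiv.extendOfIsometry_eq _ _ _ _ _ _ _
  rw [algToHTensor_tmul] at h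
  exact h.trans (algToHTensor_tmul _ _ _ _)

@[simp] theorem htassoc_symm_htmul (ξ : H₁) (η : H₂) (ζ : H₃) :
    (htassoc H₁ H₂ H₃).symm (htmul ξ (htmul η ζ)) = htmul (htmul ξ η) ζ := by
  rw [LinearIsometryEquiv.symm_apply_eq, htassoc_htmul]

theorem HTensor.ext₃ {E : Type*} [NormedAddCommGroup E] [NormedSpace ℂ E]
    {f g : HTensor (HTensor H₁ H₂) H₃ →L[ℂ] E}
    (h : ∀ ξ η ζ, f (htmul (htmul ξ η) ζ) = g (htmul (htmul ξ η) ζ)) : f = g := by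
  refine HTensor.ext fun x ζ => ?_
  induction x using HTensor.induction with
  | hcl =>
    exact isClosed_eq (f.continuous.comp (continuous_htmul_left ζ))
      (g.continuous.comp (continuous_htmul_left ζ))
  | hadd x y hx hy => simp only [htmul_add_left, map_add, hx, hy]
  | ht a b => exact h a b ζ

end HilbertTensor

section Compact
variable {H₁ H₂ L₁ L₂ : Type*}
  [NormedAddCommGroup H₁] [InnerProductSpace ℂ H₁]
  [NormedAddCommGroup H₂] [InnerProductSpace ℂ H₂]
  [NormedAddCommGroup L₁] [InnerProductSpace ℂ L₁]
  [NormedAddCommGroup L₂] [InnerProductSpace ℂ L₂]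

/-- A compact operator into a Hilbert space is approximated by its compressions to
finite-dimensional subspaces. -/
theorem exists_finiteDim_approx {T : H₁ →L[ℂ] H₂} (hT : IsCompactOperator T) {ε : ℝ} (hε : 0 < ε) :
    ∃ (E : Submodule ℂ H₂) (_ : FiniteDimensional ℂ E), ‖T - E.starProjection ∘L T‖ ≤ ε := by
  have hK : TotallyBounded (T '' Metric.closedBall 0 1) :=
    (hT.isCompact_closure_image_closedBall (𝕜₁ := ℂ) (f := T.toLinearMap) 1).totallyBounded.subset
      subset_closure
  obtain ⟨t, ht, hcov⟩ := Metric.totallyBounded_iff.1 hK ε hε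
  refine ⟨Submodule.span ℂ t, FiniteDimensional.span_of_finite ℂ ht, ?_⟩
  have := FiniteDimensional.span_of_finite ℂ ht
  refine ContinuousLinearMap.opNorm_le_of_unit_norm hε.le fun x hx => ?_
  have hx' : T x ∈ T '' Metric.closedBall 0 1 := ⟨x, by simp [hx], rfl⟩
  obtain ⟨y, hy, hxy⟩ := Set.mem_iUnion₂.1 (hcov hx')
  have h1 : ‖T x - (Submodule.span ℂ t).starProjection (T x)‖ ≤ ‖T x - y‖ := by
    rw [Submodule.starProjection_minimal]
    exact ciInf_le ⟨0, by rintro _ ⟨z, rfl⟩; positivity⟩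
      (⟨y, Submodule.subset_span hy⟩ : Submodule.span ℂ t)
  have h2 : ‖T x - y‖ < ε := by simpa [dist_eq_norm] using hxy
  exact h1.trans h2.le

theorem isCompactOperator_of_finiteDim_range {T : H₁ →L[ℂ] H₂} {E : Submodule ℂ H₂}
    [FiniteDimensional ℂ E] (h : ∀ x, T x ∈ E) : IsCompactOperator T := by
  have := FiniteDimensional.proper ℂ E
  have : IsCompactOperator (E.subtypeL ∘L T.codRestrict E h) :=
    (isCompactOperator_of_locallyCompactSpace_dom (T.codRestrict E h)).clm_comp E.subtypeL
  exact this

theorem htmap_mem_range {S : H₁ →L[ℂ] H₂} {T : L₁ →L[ℂ] L₂} {E : Submodule ℂ H₂}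
    {F : Submodule ℂ L₂} [FiniteDimensional ℂ E] [FiniteDimensional ℂ F]
    (hS : ∀ x, S x ∈ E) (hT : ∀ x, T x ∈ F) (x : HTensor H₁ L₁) :
    htmap S T x ∈ LinearMap.range (algToHTensor E.subtypeₗᵢ F.subtypeₗᵢ).toLinearMap := by
  induction x using HTensor.induction with
  | hcl => exact (Submodule.closed_of_finiteDimensional _).preimage (htmap S T).continuous
  | hadd x y hx hy => rw [map_add]; exact Submodule.add_mem _ hx hy
  | ht a b =>
    refine ⟨⟨S a, hS a⟩ ⊗ₜ ⟨T b, hT b⟩, ?_⟩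
    exact (algToHTensor_tmul _ _ _ _).trans (htmap_htmul S T a b).symm

theorem isCompactOperator_htmap {S : H₁ →L[ℂ] H₂} {T : L₁ →L[ℂ] L₂}
    (hS : IsCompactOperator S) (hT : IsCompactOperator T) : IsCompactOperator (htmap S T) := by
  have hcl : IsClosed {f : HTensor H₁ L₁ →L[ℂ] HTensor H₂ L₂ | IsCompactOperator f} :=
    isClosed_setOfPred_isCompactOperator
  change htmap S T ∈ {f : HTensor H₁ L₁ →L[ℂ] HTensor H₂ L₂ | IsCompactOperator f}
  rw [← hcl.closure_eq]
  refine (Metric.mem_closure_iff (α := HTensor H₁ L₁ →L[ℂ] HTensor H₂ L₂)).2 fun ε hε => ?_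
  have hd : 0 < ‖S‖ + ‖T‖ + 1 := by positivity
  set δ := ε / (2 * (‖S‖ + ‖T‖ + 1)) with hδ
  have hδ0 : 0 < δ := by positivity
  obtain ⟨E, hE, hSE⟩ := exists_finiteDim_approx hS hδ0
  obtain ⟨F, hF, hTF⟩ := exists_finiteDim_approx hT hδ0
  refine ⟨htmap (E.starProjection ∘L S) (F.starProjection ∘L T), ?_, ?_⟩
  · exact isCompactOperator_of_finiteDim_range
      (htmap_mem_range (fun x => E.starProjection_apply_mem _)
        (fun x => F.starProjection_apply_mem _))
  · have e : htmap S T - htmap (E.starProjection ∘L S) (F.starProjection ∘L T)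
        = htmap (S - E.starProjection ∘L S) T
          + htmap (E.starProjection ∘L S) (T - F.starProjection ∘L T) := by
      rw [sub_eq_iff_eq_add, add_assoc, ← htmap_add_right, sub_add_cancel, ← htmap_add_left,
        sub_add_cancel]
    have hp : ‖E.starProjection ∘L S‖ ≤ ‖S‖ := by
      refine (opNorm_comp_le _ _).trans ?_
      nlinarith [E.starProjection_norm_le, norm_nonneg S]
    refine (dist_eq_norm (htmap S T) (htmap (E.starProjection ∘L S) (F.starProjection ∘L T))).trans_lt ?_
    rw [e]
    calc _ ≤ ‖htmap (S - E.starProjection ∘L S) T‖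
          + ‖htmap (E.starProjection ∘L S) (T - F.starProjection ∘L T)‖ := norm_add_le _ _
      _ ≤ δ * ‖T‖ + ‖S‖ * δ := by
          gcongr
          · exact (norm_htmap_le _ _).trans (by gcongr)
          · exact (norm_htmap_le _ _).trans (by gcongr)
      _ < ε := by
          have : δ * (2 * (‖S‖ + ‖T‖ + 1)) = ε := by rw [hδ]; field_simp
          nlinarith [norm_nonneg S, norm_nonneg T]

end Compact

/-! ### The C*-algebras `K(H) ⊗ A` and the spaces `K(H₁, H₂) ⊗ A` -/

/-- A `*`-representation of the C*-algebra `A` on a Hilbert space. -/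
structure StarRep (A : Type u) [NonUnitalCStarAlgebra A] : Type (u + 1) where
  L : Type u
  [nacg : NormedAddCommGroup L]
  [ips : InnerProductSpace ℂ L]
  [cs : CompleteSpace L]
  π : A →⋆ₙₐ[ℂ] (L →L[ℂ] L)

attribute [instance] StarRep.nacg StarRep.ips StarRep.cs

/-- The pullback of a representation along a `*`-homomorphism. -/
abbrev StarRep.pullback {A B : Type u} [NonUnitalCStarAlgebra A] [NonUnitalCStarAlgebra B]
    (φ : A →⋆ₙₐ[ℂ] B) (r : StarRep B) : StarRep A where
  L := r.L
  π := r.π.comp φ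

/-- Bounded families of operators `H₁ ⊗ L → H₂ ⊗ L`, indexed by the representations of `A` on
Hilbert spaces `L`, with the supremum norm. For `H₁ = H₂` this is a C*-algebra. -/
abbrev OpFam (A : Type u) [NonUnitalCStarAlgebra A] (H₁ H₂ : Type)
    [NormedAddCommGroup H₁] [InnerProductSpace ℂ H₁]
    [NormedAddCommGroup H₂] [InnerProductSpace ℂ H₂] : Type (u + 1) :=
  lp (fun r : StarRep A => HTensor H₁ r.L →L[ℂ] HTensor H₂ r.L) ∞

namespace OpFam

variable {A B C : Type u} [NonUnitalCStarAlgebra A] [NonUnitalCStarAlgebra B]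
  [NonUnitalCStarAlgebra C]
variable {H₀ H₁ H₂ H₃ H₄ : Type}
  [NormedAddCommGroup H₀] [InnerProductSpace ℂ H₀]
  [NormedAddCommGroup H₁] [InnerProductSpace ℂ H₁]
  [NormedAddCommGroup H₂] [InnerProductSpace ℂ H₂]
  [NormedAddCommGroup H₃] [InnerProductSpace ℂ H₃]
  [NormedAddCommGroup H₄] [InnerProductSpace ℂ H₄]

/-- A uniformly bounded family as an element of `OpFam`. -/
def of (f : ∀ r : StarRep A, HTensor H₁ r.L →L[ℂ] HTensor H₂ r.L) (K : ℝ)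
    (h : ∀ r, ‖f r‖ ≤ K) : OpFam A H₁ H₂ :=
  ⟨f, memℓp_infty ⟨K, by rintro _ ⟨r, rfl⟩; exact h r⟩⟩

theorem norm_coord_le (x : OpFam A H₁ H₂) (r : StarRep A) : ‖x r‖ ≤ ‖x‖ :=
  lp.norm_apply_le_norm ENNReal.top_ne_zero x r

theorem ext {x y : OpFam A H₁ H₂} (h : ∀ r, x r = y r) : x = y :=
  lp.ext (funext h)

/-- The simple tensor `T ⊗ a`: in the representation `π` it is the operator `T ⊗ π(a)`. -/
def simple (T : H₁ →L[ℂ] H₂) (a : A) : OpFam A H₁ H₂ :=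
  of (fun r => htmap T (r.π a)) (‖T‖ * ‖a‖) fun r =>
    (norm_htmap_le _ _).trans (by gcongr; exact NonUnitalStarAlgHom.norm_apply_le r.π a)

/-- The multiplier `V ⊗ 1`. -/
def mult (V : H₁ →L[ℂ] H₂) : OpFam A H₁ H₂ :=
  of (fun r => htmap V (.id ℂ r.L)) ‖V‖ fun _ =>
    (norm_htmap_le _ _).trans (mul_le_of_le_one_right (norm_nonneg _) norm_id_le)

/-- Composition of families. -/
def comp (x : OpFam A H₂ H₃) (y : OpFam A H₁ H₂) : OpFam A H₁ H₃ :=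
  of (fun r => x r ∘L y r) (‖x‖ * ‖y‖) fun r =>
    (opNorm_comp_le _ _).trans (by gcongr <;> exact norm_coord_le _ _)

/-- The adjoint of a family. -/
def adj [CompleteSpace H₁] [CompleteSpace H₂] (x : OpFam A H₁ H₂) : OpFam A H₂ H₁ :=
  of (fun r => adjoint (x r)) ‖x‖ fun r => by
    rw [LinearIsometryEquiv.norm_map]; exact norm_coord_le _ _

/-- The map `id ⊗ φ` induced by a `*`-homomorphism `φ`: it sends `T ⊗ a` to `T ⊗ φ(a)`. -/
def mapHom (φ : A →⋆ₙₐ[ℂ] B) (x : OpFam A H₁ H₂) : OpFam B H₁ H₂ :=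
  of (fun r => x (r.pullback φ)) ‖x‖ fun _ => norm_coord_le x _

/-- The tensor product `S ⊗ x` of an operator and a family. -/
def tensor (S : H₁ →L[ℂ] H₂) (x : OpFam A H₃ H₄) : OpFam A (HTensor H₁ H₃) (HTensor H₂ H₄) :=
  of (fun r => ((htassoc H₂ H₄ r.L).symm : _ →L[ℂ] HTensor (HTensor H₂ H₄) r.L) ∘L
      htmap S (x r) ∘L (htassoc H₁ H₃ r.L : HTensor (HTensor H₁ H₃) r.L →L[ℂ] _)) (‖S‖ * ‖x‖)
    fun r => by
      refine ContinuousLinearMap.opNorm_le_bound _ (by positivity) fun z => ?_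
      simp only [ContinuousLinearMap.comp_apply, LinearIsometryEquiv.coe_coe'',
        LinearIsometryEquiv.norm_map]
      refine (le_opNorm _ _).trans ?_
      rw [LinearIsometryEquiv.norm_map]
      gcongr
      exact (norm_htmap_le _ _).trans (by gcongr; exact norm_coord_le _ _)

section coord
variable (r : StarRep A)
@[simp] theorem simple_coord (T : H₁ →L[ℂ] H₂) (a : A) :
  (simple T a : OpFam A H₁ H₂) r = htmap T (r.π a) := rfl
@[simp] theorem mult_coord (V : H₁ →L[ℂ] H₂) :
  (mult V : OpFam A H₁ H₂) r = htmap V (.id ℂ r.L) := rfl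
@[simp] theorem comp_coord (x : OpFam A H₂ H₃) (y : OpFam A H₁ H₂) :
  comp x y r = x r ∘L y r := rfl
@[simp] theorem adj_coord [CompleteSpace H₁] [CompleteSpace H₂] (x : OpFam A H₁ H₂) :
  adj x r = adjoint (x r) := rfl
@[simp] theorem mapHom_coord (φ : A →⋆ₙₐ[ℂ] B) (x : OpFam A H₁ H₂) (r : StarRep B) :
  mapHom φ x r = x (r.pullback φ) := rfl
theorem tensor_coord (S : H₁ →L[ℂ] H₂) (x : OpFam A H₃ H₄) :
  tensor S x r = ((htassoc H₂ H₄ r.L).symm : _ →L[ℂ] HTensor (HTensor H₂ H₄) r.L) ∘L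
      htmap S (x r) ∘L (htassoc H₁ H₃ r.L : HTensor (HTensor H₁ H₃) r.L →L[ℂ] _) := rfl
@[simp] theorem add_coord (x y : OpFam A H₁ H₂) : (x + y) r = x r + y r := rfl
@[simp] theorem sub_coord (x y : OpFam A H₁ H₂) : (x - y) r = x r - y r := rfl
@[simp] theorem smul_coord (c : ℂ) (x : OpFam A H₁ H₂) : (c • x) r = c • x r := rfl
@[simp] theorem zero_coord : (0 : OpFam A H₁ H₂) r = 0 := rfl
end coord


end OpFam

namespace OpFam

variable {A B C : Type u} [NonUnitalCStarAlgebra A] [NonUnitalCStarAlgebra B]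
  [NonUnitalCStarAlgebra C]
variable {H₀ H₁ H₂ H₃ H₄ : Type}
  [NormedAddCommGroup H₀] [InnerProductSpace ℂ H₀]
  [NormedAddCommGroup H₁] [InnerProductSpace ℂ H₁]
  [NormedAddCommGroup H₂] [InnerProductSpace ℂ H₂]
  [NormedAddCommGroup H₃] [InnerProductSpace ℂ H₃]
  [NormedAddCommGroup H₄] [InnerProductSpace ℂ H₄]

theorem norm_le {x : OpFam A H₁ H₂} {K : ℝ} (hK : 0 ≤ K) (h : ∀ r, ‖x r‖ ≤ K) : ‖x‖ ≤ K :=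
  lp.norm_le_of_forall_le hK h

theorem norm_comp_le (x : OpFam A H₂ H₃) (y : OpFam A H₁ H₂) : ‖comp x y‖ ≤ ‖x‖ * ‖y‖ :=
  norm_le (by positivity) fun _ =>
    (opNorm_comp_le _ _).trans (by gcongr <;> exact norm_coord_le _ _)

theorem norm_mult_le (V : H₁ →L[ℂ] H₂) : ‖(mult V : OpFam A H₁ H₂)‖ ≤ ‖V‖ :=
  norm_le (norm_nonneg _) fun _ =>
    (norm_htmap_le _ _).trans (mul_le_of_le_one_right (norm_nonneg _) norm_id_le)

theorem norm_adj_le [CompleteSpace H₁] [CompleteSpace H₂] (x : OpFam A H₁ H₂) : ‖adj x‖ ≤ ‖x‖ :=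
  norm_le (norm_nonneg _) fun r => by
    rw [adj_coord, LinearIsometryEquiv.norm_map]; exact norm_coord_le _ _

theorem norm_mapHom_le (φ : A →⋆ₙₐ[ℂ] B) (x : OpFam A H₁ H₂) : ‖mapHom φ x‖ ≤ ‖x‖ :=
  norm_le (norm_nonneg _) fun _ => norm_coord_le x _

theorem norm_tensor_le (S : H₁ →L[ℂ] H₂) (x : OpFam A H₃ H₄) : ‖tensor S x‖ ≤ ‖S‖ * ‖x‖ := by
  refine norm_le (by positivity) fun r => ?_
  refine ContinuousLinearMap.opNorm_le_bound _ (by positivity) fun z => ?_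
  simp only [tensor_coord, ContinuousLinearMap.comp_apply, LinearIsometryEquiv.coe_coe'',
    LinearIsometryEquiv.norm_map]
  refine (le_opNorm _ _).trans ?_
  rw [LinearIsometryEquiv.norm_map]
  gcongr
  exact (norm_htmap_le _ _).trans (by gcongr; exact norm_coord_le _ _)

theorem comp_assoc (x : OpFam A H₃ H₄) (y : OpFam A H₂ H₃) (z : OpFam A H₁ H₂) :
    comp (comp x y) z = comp x (comp y z) :=
  ext fun _ => by simp only [comp_coord, ContinuousLinearMap.comp_assoc]

theorem comp_add (x : OpFam A H₂ H₃) (y z : OpFam A H₁ H₂) :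
    comp x (y + z) = comp x y + comp x z := ext fun _ => by simp

theorem add_comp (x y : OpFam A H₂ H₃) (z : OpFam A H₁ H₂) :
    comp (x + y) z = comp x z + comp y z := ext fun _ => by simp

theorem comp_sub (x : OpFam A H₂ H₃) (y z : OpFam A H₁ H₂) :
    comp x (y - z) = comp x y - comp x z := ext fun _ => by simp

theorem sub_comp (x y : OpFam A H₂ H₃) (z : OpFam A H₁ H₂) :
    comp (x - y) z = comp x z - comp y z := ext fun _ => by simp

theorem mult_comp_mult (V : H₂ →L[ℂ] H₃) (W : H₁ →L[ℂ] H₂) :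
    comp (mult V : OpFam A H₂ H₃) (mult W) = mult (V ∘L W) :=
  ext fun _ => by simp [htmap_comp]

theorem mult_id_comp (x : OpFam A H₁ H₂) : comp (mult (.id ℂ H₂)) x = x :=
  ext fun _ => by simp

theorem comp_mult_id (x : OpFam A H₁ H₂) : comp x (mult (.id ℂ H₁)) = x :=
  ext fun _ => by simp

theorem mult_add (V W : H₁ →L[ℂ] H₂) : (mult (V + W) : OpFam A H₁ H₂) = mult V + mult W :=
  ext fun _ => by simp [htmap_add_left]

theorem mult_zero : (mult 0 : OpFam A H₁ H₂) = 0 :=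
  ext fun _ => HTensor.ext fun _ _ => by simp

theorem zero_comp (x : OpFam A H₁ H₂) : comp (0 : OpFam A H₂ H₃) x = 0 := ext fun _ => by simp

theorem comp_zero (x : OpFam A H₂ H₃) : comp x (0 : OpFam A H₁ H₂) = 0 := ext fun _ => by simp

section adj
variable [CompleteSpace H₁] [CompleteSpace H₂] [CompleteSpace H₃]

theorem adj_comp (x : OpFam A H₂ H₃) (y : OpFam A H₁ H₂) :
    adj (comp x y) = comp (adj y) (adj x) := ext fun _ => by simp [adjoint_comp]

theorem adj_adj (x : OpFam A H₁ H₂) : adj (adj x) = x := ext fun _ => by simp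

theorem adj_add (x y : OpFam A H₁ H₂) : adj (x + y) = adj x + adj y := ext fun _ => by simp

theorem adj_sub (x y : OpFam A H₁ H₂) : adj (x - y) = adj x - adj y := ext fun _ => by simp

theorem adj_mult (V : H₁ →L[ℂ] H₂) : adj (mult V : OpFam A H₁ H₂) = mult (adjoint V) :=
  ext fun r => by
    have : adjoint (ContinuousLinearMap.id ℂ r.L) = .id ℂ r.L := adjoint_id
    simp [adjoint_htmap, this]

end adj

section mapHom

theorem mapHom_comp (φ : A →⋆ₙₐ[ℂ] B) (x : OpFam A H₂ H₃) (y : OpFam A H₁ H₂) :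
    mapHom φ (comp x y) = comp (mapHom φ x) (mapHom φ y) := ext fun _ => rfl

theorem mapHom_add (φ : A →⋆ₙₐ[ℂ] B) (x y : OpFam A H₁ H₂) :
    mapHom φ (x + y) = mapHom φ x + mapHom φ y := ext fun _ => rfl

theorem mapHom_sub (φ : A →⋆ₙₐ[ℂ] B) (x y : OpFam A H₁ H₂) :
    mapHom φ (x - y) = mapHom φ x - mapHom φ y := ext fun _ => rfl

theorem mapHom_mult (φ : A →⋆ₙₐ[ℂ] B) (V : H₁ →L[ℂ] H₂) :
    mapHom φ (mult V) = mult V := ext fun _ => rfl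

theorem mapHom_adj [CompleteSpace H₁] [CompleteSpace H₂] (φ : A →⋆ₙₐ[ℂ] B) (x : OpFam A H₁ H₂) :
    mapHom φ (adj x) = adj (mapHom φ x) := ext fun _ => rfl

theorem mapHom_simple (φ : A →⋆ₙₐ[ℂ] B) (T : H₁ →L[ℂ] H₂) (a : A) :
    mapHom φ (simple T a) = simple T (φ a) := ext fun _ => rfl

theorem mapHom_mapHom (ψ : B →⋆ₙₐ[ℂ] C) (φ : A →⋆ₙₐ[ℂ] B) (x : OpFam A H₁ H₂) :
    mapHom ψ (mapHom φ x) = mapHom (ψ.comp φ) x := ext fun _ => rfl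

theorem mapHom_id (x : OpFam A H₁ H₂) : mapHom (NonUnitalStarAlgHom.id ℂ A) x = x := ext fun _ => rfl

end mapHom

theorem comp_simple (V : H₂ →L[ℂ] H₃) (T : H₁ →L[ℂ] H₂) (a : A) :
    comp (mult V) (simple T a) = simple (V ∘L T) a := ext fun _ => by simp [htmap_comp]

theorem simple_comp (V : H₁ →L[ℂ] H₂) (T : H₂ →L[ℂ] H₃) (a : A) :
    comp (simple T a) (mult V) = simple (T ∘L V) a := ext fun _ => by simp [htmap_comp]

theorem simple_comp_simple (S : H₂ →L[ℂ] H₃) (T : H₁ →L[ℂ] H₂) (a b : A) :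
    comp (simple S a) (simple T b) = simple (S ∘L T) (a * b) :=
  ext fun _ => by simp [htmap_comp, ContinuousLinearMap.mul_def]

theorem adj_simple [CompleteSpace H₁] [CompleteSpace H₂] (T : H₁ →L[ℂ] H₂) (a : A) :
    adj (simple T a) = simple (adjoint T) (star a) :=
  ext fun r => by simp [adjoint_htmap, map_star, ContinuousLinearMap.star_eq_adjoint]

theorem tensor_simple (S : H₁ →L[ℂ] H₂) (T : H₃ →L[ℂ] H₄) (a : A) :
    tensor S (simple T a) = simple (htmap S T) a :=
  ext fun r => HTensor.ext₃ fun ξ η ζ => by simp [tensor_coord]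

theorem tensor_add (S : H₁ →L[ℂ] H₂) (x y : OpFam A H₃ H₄) :
    tensor S (x + y) = tensor S x + tensor S y :=
  ext fun r => by ext z; simp [tensor_coord, htmap_add_right]

theorem tensor_sub (S : H₁ →L[ℂ] H₂) (x y : OpFam A H₃ H₄) :
    tensor S (x - y) = tensor S x - tensor S y := by
  rw [eq_sub_iff_add_eq, ← tensor_add, sub_add_cancel]

/-- The space `K(H₁, H₂) ⊗ A`: the closed linear span of the simple tensors `T ⊗ a` with `T`
compact. For `H₁ = H₂` this is the C*-algebra `K(H₁) ⊗ A`: the supremum norm over all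
representations of `A` is the (unique) C*-tensor norm, because some representation is faithful. -/
def tensorK (A : Type u) [NonUnitalCStarAlgebra A] (H₁ H₂ : Type)
    [NormedAddCommGroup H₁] [InnerProductSpace ℂ H₁]
    [NormedAddCommGroup H₂] [InnerProductSpace ℂ H₂] : Submodule ℂ (OpFam A H₁ H₂) :=
  (Submodule.span ℂ {x | ∃ T : H₁ →L[ℂ] H₂, IsCompactOperator T ∧ ∃ a : A,
    x = simple T a}).topologicalClosure

theorem isClosed_tensorK : IsClosed (tensorK A H₁ H₂ : Set (OpFam A H₁ H₂)) :=
  Submodule.isClosed_topologicalClosure _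

theorem simple_mem {T : H₁ →L[ℂ] H₂} (hT : IsCompactOperator T) (a : A) :
    simple T a ∈ tensorK A H₁ H₂ :=
  Submodule.le_topologicalClosure _ (Submodule.subset_span ⟨T, hT, a, rfl⟩)

theorem smul_simple (c : ℂ) (T : H₁ →L[ℂ] H₂) (a : A) : c • simple T a = simple T (c • a) :=
  ext fun _ => by simp [htmap_smul_right]

theorem tensorK_induction {p : OpFam A H₁ H₂ → Prop} (hcl : IsClosed {x | p x})
    (hadd : ∀ x y, p x → p y → p (x + y))
    (hs : ∀ (T : H₁ →L[ℂ] H₂) (_ : IsCompactOperator T) (a : A), p (simple T a))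
    {x : OpFam A H₁ H₂} (hx : x ∈ tensorK A H₁ H₂) : p x := by
  refine closure_minimal (fun y hy => ?_) hcl hx
  refine Submodule.closure_induction (p := fun x _ => p x) ?_ (fun x y _ _ => hadd x y) ?_
    (show y ∈ _ from hy)
  · have h := hs 0 isCompactOperator_zero (0 : A)
    rwa [← zero_smul ℂ (0 : A), ← smul_simple, zero_smul] at h
  · rintro c _ ⟨T, hT, a, rfl⟩
    rw [smul_simple]
    exact hs T hT _

theorem continuous_of_sub_bound {X Y : Type*} [NormedAddCommGroup X] [NormedAddCommGroup Y]
    {f : X → Y} (hf : ∀ x y, f (x - y) = f x - f y) (K : ℝ) (hK : ∀ x, ‖f x‖ ≤ K * ‖x‖) :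
    Continuous f := by
  refine (LipschitzWith.of_dist_le' (K := K) fun x y => ?_).continuous
  rw [dist_eq_norm, dist_eq_norm, ← hf]
  exact hK _

theorem continuous_comp_right (x : OpFam A H₂ H₃) :
    Continuous fun y : OpFam A H₁ H₂ => comp x y :=
  continuous_of_sub_bound (comp_sub x) _ (norm_comp_le x)

theorem continuous_comp_left (y : OpFam A H₁ H₂) :
    Continuous fun x : OpFam A H₂ H₃ => comp x y :=
  continuous_of_sub_bound (fun x x' => sub_comp x x' y) ‖y‖
    (fun x => (norm_comp_le x y).trans_eq (mul_comm _ _))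

theorem continuous_adj [CompleteSpace H₁] [CompleteSpace H₂] :
    Continuous (adj : OpFam A H₁ H₂ → OpFam A H₂ H₁) :=
  continuous_of_sub_bound adj_sub 1 (fun x => by simpa using norm_adj_le x)

theorem continuous_mapHom (φ : A →⋆ₙₐ[ℂ] B) :
    Continuous (mapHom φ : OpFam A H₁ H₂ → OpFam B H₁ H₂) :=
  continuous_of_sub_bound (mapHom_sub φ) 1 (fun x => by simpa using norm_mapHom_le φ x)

theorem continuous_tensor (S : H₁ →L[ℂ] H₂) :
    Continuous (tensor S : OpFam A H₃ H₄ → _) :=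
  continuous_of_sub_bound (tensor_sub S) _ (norm_tensor_le S)

theorem comp_mem {x : OpFam A H₂ H₃} {y : OpFam A H₁ H₂} (hx : x ∈ tensorK A H₂ H₃)
    (hy : y ∈ tensorK A H₁ H₂) : comp x y ∈ tensorK A H₁ H₃ := by
  refine tensorK_induction (p := fun x => comp x y ∈ tensorK A H₁ H₃) ?hcl ?hadd ?hs hx
  case hcl => exact isClosed_tensorK.preimage (continuous_comp_left y)
  case hadd => intro x x' hx hx'; rw [add_comp]; exact add_mem hx hx'
  case hs =>
    intro S hS a
    refine tensorK_induction (p := fun y => comp (simple S a) y ∈ tensorK A H₁ H₃) ?hcl ?hadd ?hs hy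
    case hcl => exact isClosed_tensorK.preimage (continuous_comp_right _)
    case hadd => intro x x' hx hx'; rw [comp_add]; exact add_mem hx hx'
    case hs => intro T hT b; rw [simple_comp_simple]; exact simple_mem (hS.comp_clm T) _

theorem mult_comp_mem (V : H₂ →L[ℂ] H₃) {y : OpFam A H₁ H₂} (hy : y ∈ tensorK A H₁ H₂) :
    comp (mult V) y ∈ tensorK A H₁ H₃ := by
  refine tensorK_induction (p := fun y => comp (mult V) y ∈ tensorK A H₁ H₃) ?hcl ?hadd ?hs hy
  case hcl => exact isClosed_tensorK.preimage (continuous_comp_right _)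
  case hadd => intro x x' hx hx'; rw [comp_add]; exact add_mem hx hx'
  case hs => intro T hT b; rw [comp_simple]; exact simple_mem (hT.clm_comp V) _

theorem comp_mult_mem {x : OpFam A H₂ H₃} (hx : x ∈ tensorK A H₂ H₃) (V : H₁ →L[ℂ] H₂) :
    comp x (mult V) ∈ tensorK A H₁ H₃ := by
  refine tensorK_induction (p := fun x => comp x (mult V) ∈ tensorK A H₁ H₃) ?hcl ?hadd ?hs hx
  case hcl => exact isClosed_tensorK.preimage (continuous_comp_left _)
  case hadd => intro x x' hx hx'; rw [add_comp]; exact add_mem hx hx'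
  case hs => intro T hT b; rw [simple_comp]; exact simple_mem (hT.comp_clm V) _

theorem mapHom_mem (φ : A →⋆ₙₐ[ℂ] B) {x : OpFam A H₁ H₂} (hx : x ∈ tensorK A H₁ H₂) :
    mapHom φ x ∈ tensorK B H₁ H₂ := by
  refine tensorK_induction (p := fun x => mapHom φ x ∈ tensorK B H₁ H₂) ?hcl ?hadd ?hs hx
  case hcl => exact isClosed_tensorK.preimage (continuous_mapHom φ)
  case hadd => intro x x' hx hx'; rw [mapHom_add]; exact add_mem hx hx'
  case hs => intro T hT b; rw [mapHom_simple]; exact simple_mem hT _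

theorem tensor_mem {S : H₁ →L[ℂ] H₂} (hS : IsCompactOperator S) {x : OpFam A H₃ H₄}
    (hx : x ∈ tensorK A H₃ H₄) : tensor S x ∈ tensorK A (HTensor H₁ H₃) (HTensor H₂ H₄) := by
  refine tensorK_induction
    (p := fun x => tensor S x ∈ tensorK A (HTensor H₁ H₃) (HTensor H₂ H₄)) ?hcl ?hadd ?hs hx
  case hcl => exact isClosed_tensorK.preimage (continuous_tensor S)
  case hadd => intro x x' hx hx'; rw [tensor_add]; exact add_mem hx hx'
  case hs => intro T hT b; rw [tensor_simple]; exact simple_mem (isCompactOperator_htmap hS hT) _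

end OpFam

theorem isCompactOperator_adjoint {H₁ H₂ : Type*}
    [NormedAddCommGroup H₁] [InnerProductSpace ℂ H₁] [CompleteSpace H₁]
    [NormedAddCommGroup H₂] [InnerProductSpace ℂ H₂] [CompleteSpace H₂]
    {T : H₁ →L[ℂ] H₂} (hT : IsCompactOperator T) : IsCompactOperator (adjoint T) := by
  have hcl : IsClosed {f : H₂ →L[ℂ] H₁ | IsCompactOperator f} :=
    isClosed_setOfPred_isCompactOperator
  change adjoint T ∈ {f : H₂ →L[ℂ] H₁ | IsCompactOperator f}
  rw [← hcl.closure_eq]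
  refine (Metric.mem_closure_iff (α := H₂ →L[ℂ] H₁)).2 fun ε hε => ?_
  obtain ⟨E, hE, hTE⟩ := exists_finiteDim_approx hT (half_pos hε)
  refine ⟨adjoint T ∘L E.starProjection, ?_, ?_⟩
  · have : IsCompactOperator E.starProjection :=
      isCompactOperator_of_finiteDim_range (E := E) fun x => E.starProjection_apply_mem x
    exact this.clm_comp (adjoint T)
  · have e : adjoint T - adjoint T ∘L E.starProjection
        = adjoint (T - E.starProjection ∘L T) := by
      rw [map_sub, adjoint_comp]
      congr 2
      exact (isSelfAdjoint_iff'.1 (isSelfAdjoint_starProjection E)).symm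
    rw [dist_eq_norm (adjoint T) (adjoint T ∘L E.starProjection), e, LinearIsometryEquiv.norm_map]
    linarith

theorem OpFam.adj_mem {A : Type u} [NonUnitalCStarAlgebra A] {H₁ H₂ : Type}
    [NormedAddCommGroup H₁] [InnerProductSpace ℂ H₁] [CompleteSpace H₁]
    [NormedAddCommGroup H₂] [InnerProductSpace ℂ H₂] [CompleteSpace H₂]
    {x : OpFam A H₁ H₂} (hx : x ∈ tensorK A H₁ H₂) : adj x ∈ tensorK A H₂ H₁ := by
  refine tensorK_induction (p := fun x => adj x ∈ tensorK A H₂ H₁) ?hcl ?hadd ?hs hx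
  case hcl => exact isClosed_tensorK.preimage continuous_adj
  case hadd => intro x x' hx hx'; rw [adj_add]; exact add_mem hx hx'
  case hs => intro T hT b; rw [adj_simple]; exact simple_mem (isCompactOperator_adjoint hT) _

section congr
variable {H H₁ H₂ L L₁ L₂ : Type*}
  [NormedAddCommGroup H] [InnerProductSpace ℂ H]
  [NormedAddCommGroup H₁] [InnerProductSpace ℂ H₁]
  [NormedAddCommGroup H₂] [InnerProductSpace ℂ H₂]
  [NormedAddCommGroup L] [InnerProductSpace ℂ L]
  [NormedAddCommGroup L₁] [InnerProductSpace ℂ L₁]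
  [NormedAddCommGroup L₂] [InnerProductSpace ℂ L₂]

/-- The unitary `U ⊗ V` for unitaries `U` and `V`. -/
def htcongr (U : H₁ ≃ₗᵢ[ℂ] H₂) (V : L₁ ≃ₗᵢ[ℂ] L₂) : HTensor H₁ L₁ ≃ₗᵢ[ℂ] HTensor H₂ L₂ :=
  (TensorProduct.congrIsometry U V).toLinearEquiv.extendOfIsometry
    (HTensor.incl H₁ L₁).toLinearMap (HTensor.incl H₂ L₂).toLinearMap
    HTensor.denseRange_incl HTensor.denseRange_incl
    (fun x => ((HTensor.incl _ _).norm_map _).trans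
      (((TensorProduct.congrIsometry U V).norm_map x).trans ((HTensor.incl _ _).norm_map x).symm))

@[simp] theorem htcongr_htmul (U : H₁ ≃ₗᵢ[ℂ] H₂) (V : L₁ ≃ₗᵢ[ℂ] L₂) (ξ : H₁) (η : L₁) :
    htcongr U V (htmul ξ η) = htmul (U ξ) (V η) := by
  have h : htcongr U V (HTensor.incl H₁ L₁ (ξ ⊗ₜ[ℂ] η))
      = HTensor.incl H₂ L₂ (TensorProduct.congrIsometry U V (ξ ⊗ₜ[ℂ] η)) :=
    LinearEquiv.extendOfIsometry_eq _ _ _ _ _ _ _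
  exact h

theorem htcongr_coe (U : H₁ ≃ₗᵢ[ℂ] H₂) (V : L₁ ≃ₗᵢ[ℂ] L₂) :
    (htcongr U V : HTensor H₁ L₁ →L[ℂ] HTensor H₂ L₂) = htmap (U : H₁ →L[ℂ] H₂) (V : L₁ →L[ℂ] L₂) :=
  HTensor.ext fun ξ η => by simp

theorem HTensor.iso_ext {E : Type*} [NormedAddCommGroup E] [NormedSpace ℂ E]
    {U V : HTensor H L ≃ₗᵢ[ℂ] E} (h : ∀ ξ η, U (htmul ξ η) = V (htmul ξ η)) (x : HTensor H L) :
    U x = V x :=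
  congrArg (fun f : HTensor H L →L[ℂ] E => f x)
    (HTensor.ext (f := (U : HTensor H L →L[ℂ] E)) (g := (V : HTensor H L →L[ℂ] E)) h)

open TopologicalSpace in
instance [SeparableSpace H] [SeparableSpace L] : SeparableSpace (HTensor H L) := by
  obtain ⟨s, hs, hsd⟩ := exists_countable_dense H
  obtain ⟨t, ht, htd⟩ := exists_countable_dense L
  have hc : (Set.image2 (fun ξ η => htmul ξ η : H → L → HTensor H L) s t).Countable :=
    hs.image2 ht _
  have h1 := (hc.isSeparable.span (R := ℂ)).closure
  rw [← isSeparable_univ_iff]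
  refine h1.mono fun z hz => ?_
  clear hz
  set R := (Submodule.span ℂ (Set.image2 (fun ξ η => htmul ξ η : H → L → HTensor H L) s t))
    with hR
  change z ∈ R.topologicalClosure
  have hcl : IsClosed (R.topologicalClosure : Set (HTensor H L)) :=
    Submodule.isClosed_topologicalClosure _
  induction z using HTensor.induction with
  | hcl => exact hcl
  | hadd x y hx hy => exact R.topologicalClosure.add_mem hx hy
  | ht ξ η =>
    refine hsd.induction (P := fun ξ => htmul ξ η ∈ R.topologicalClosure) (fun a ha => ?_)
      (hcl.preimage (continuous_htmul_left η)) ξ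
    refine htd.induction (P := fun η => htmul a η ∈ R.topologicalClosure) (fun b hb => ?_)
      (hcl.preimage (continuous_htmul_right _)) η
    exact Submodule.le_topologicalClosure _ (Submodule.subset_span ⟨a, ha, b, hb, rfl⟩)

theorem continuous_htcongr {X : Type*} [TopologicalSpace X] (U : X → (H₁ ≃ₗᵢ[ℂ] H₂))
    (V : X → (L₁ ≃ₗᵢ[ℂ] L₂)) (hU : ∀ ξ, Continuous fun g => U g ξ)
    (hV : ∀ ξ, Continuous fun g => V g ξ) (z : HTensor H₁ L₁) :
    Continuous fun g => htcongr (U g) (V g) z := by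
  have hcl : IsClosed {z : HTensor H₁ L₁ | Continuous fun g => htcongr (U g) (V g) z} := by
    rw [← isSeqClosed_iff_isClosed]
    intro z z₀ hz hlim
    have : TendstoUniformly (fun n g => htcongr (U g) (V g) (z n))
        (fun g => htcongr (U g) (V g) z₀) atTop := by
      rw [Metric.tendstoUniformly_iff]
      intro ε hε
      filter_upwards [Metric.tendsto_nhds.1 hlim ε hε] with n hn g
      rw [LinearIsometryEquiv.dist_map, dist_comm]; exact hn
    exact this.continuous (Frequently.of_forall hz)
  induction z using HTensor.induction with
  | hcl => exact hcl
  | hadd x y hx hy => simp only [map_add]; exact hx.add hy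
  | ht ξ η =>
    simp only [htcongr_htmul]
    have : Continuous fun p : H₂ × L₂ => htmul p.1 p.2 := by
      refine (HTensor.incl H₂ L₂).continuous.comp ?_
      fun_prop
    exact this.comp ((hU ξ).prodMk (hV η))

end congr

/-! ### Unitary representations and the semiring `Cu(G)` -/

/-- A (strongly continuous) unitary representation of `G` on a separable Hilbert space. Every
separable Hilbert space is isomorphic to one in `Type`. -/
structure URep (G : Type v) [Group G] [TopologicalSpace G] : Type (max 1 v) where
  H : Type
  [nacg : NormedAddCommGroup H]
  [ips : InnerProductSpace ℂ H]
  [cs : CompleteSpace H]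
  [sep : TopologicalSpace.SeparableSpace H]
  ρ : G →* (H ≃ₗᵢ[ℂ] H)
  cont : ∀ ξ : H, Continuous fun g => ρ g ξ

attribute [instance] URep.nacg URep.ips URep.cs URep.sep

namespace URep

variable {G : Type v} [Group G] [TopologicalSpace G]

/-- The unitary operator `μ_g`. -/
def op (μ : URep G) (g : G) : μ.H →L[ℂ] μ.H := (μ.ρ g : μ.H →L[ℂ] μ.H)

@[simp] theorem op_apply (μ : URep G) (g : G) (ξ : μ.H) : μ.op g ξ = μ.ρ g ξ := rfl

theorem op_one (μ : URep G) : μ.op 1 = .id ℂ μ.H := by ext; simp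

theorem op_mul (μ : URep G) (g h : G) : μ.op (g * h) = μ.op g ∘L μ.op h := by ext; simp

theorem op_inv_comp (μ : URep G) (g : G) : μ.op g⁻¹ ∘L μ.op g = .id ℂ μ.H := by
  rw [← op_mul, inv_mul_cancel, op_one]

theorem op_comp_inv (μ : URep G) (g : G) : μ.op g ∘L μ.op g⁻¹ = .id ℂ μ.H := by
  rw [← op_mul, mul_inv_cancel, op_one]

theorem adjoint_op (μ : URep G) (g : G) : adjoint (μ.op g) = μ.op g⁻¹ := by
  symm
  rw [eq_adjoint_iff]
  intro x y
  rw [← (μ.ρ g).inner_map_map (μ.op g⁻¹ x) y, ← op_apply, ← op_apply, ← comp_apply,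
    op_comp_inv, id_apply]

/-- The zero representation. -/
abbrev zero (G : Type v) [Group G] [TopologicalSpace G] : URep G where
  H := EuclideanSpace ℂ (Fin 0)
  ρ := 1
  cont _ := continuous_const

/-- The trivial one-dimensional representation. -/
abbrev triv (G : Type v) [Group G] [TopologicalSpace G] : URep G where
  H := ℂ
  ρ := 1
  cont _ := continuous_const

/-- The direct sum of two representations. -/
abbrev sum (μ ν : URep G) : URep G where
  H := WithLp 2 (μ.H × ν.H)
  sep := (WithLp.prodContinuousLinearEquiv 2 ℂ μ.H ν.H).symm.surjective.denseRange.separableSpace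
    (WithLp.prodContinuousLinearEquiv 2 ℂ μ.H ν.H).symm.continuous
  ρ :=
    { toFun := fun g => LinearIsometryEquiv.withLpProdCongr 2 (μ.ρ g) (ν.ρ g)
      map_one' := LinearIsometryEquiv.ext fun x => by rw [map_one, map_one]; rfl
      map_mul' := fun g h => by ext x : 1; simp }
  cont ξ := (WithLp.prodContinuousLinearEquiv 2 ℂ μ.H ν.H).symm.continuous.comp
    ((μ.cont ξ.fst).prodMk (ν.cont ξ.snd))

/-- The tensor product of two representations. -/
abbrev tensor (μ ν : URep G) : URep G where
  H := HTensor μ.H ν.H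
  ρ :=
    { toFun := fun g => htcongr (μ.ρ g) (ν.ρ g)
      map_one' := LinearIsometryEquiv.ext (HTensor.iso_ext fun ξ η => by simp)
      map_mul' := fun g h => LinearIsometryEquiv.ext (HTensor.iso_ext fun ξ η => by simp) }
  cont := continuous_htcongr _ _ μ.cont ν.cont

/-- Unitary equivalence of representations. -/
instance setoid (G : Type v) [Group G] [TopologicalSpace G] : Setoid (URep G) where
  r μ ν := ∃ U : μ.H ≃ₗᵢ[ℂ] ν.H, ∀ g ξ, U (μ.ρ g ξ) = ν.ρ g (U ξ)
  iseqv :=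
    { refl := fun μ => ⟨LinearIsometryEquiv.refl ℂ μ.H, fun _ _ => rfl⟩
      symm := fun ⟨U, hU⟩ => ⟨U.symm, fun g ξ => by
        rw [LinearIsometryEquiv.symm_apply_eq, hU, LinearIsometryEquiv.apply_symm_apply]⟩
      trans := fun ⟨U, hU⟩ ⟨W, hW⟩ => ⟨U.trans W, fun g ξ => by
        simp [hU, hW]⟩ }

/-- `μ` is unitarily equivalent to a subrepresentation of `ν`. -/
def Sub (μ ν : URep G) : Prop :=
  ∃ V : μ.H →ₗᵢ[ℂ] ν.H, ∀ g ξ, V (μ.ρ g ξ) = ν.ρ g (V ξ)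

theorem sub_of_equiv {μ ν : URep G} (h : μ ≈ ν) : Sub μ ν := by
  obtain ⟨U, hU⟩ := h
  exact ⟨U.toLinearIsometry, hU⟩

theorem Sub.trans {μ ν lam : URep G} (h : Sub μ ν) (h' : Sub ν lam) : Sub μ lam := by
  obtain ⟨U, hU⟩ := h
  obtain ⟨W, hW⟩ := h'
  exact ⟨W.comp U, fun g ξ => by simp [hU, hW]⟩

end URep

variable {G : Type v} [Group G] [TopologicalSpace G]

/-- The set `Cu(G)` of unitary equivalence classes of separable unitary representations. -/
def CuRep (G : Type v) [Group G] [TopologicalSpace G] : Type (max 1 v) :=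
  Quotient (URep.setoid G)

namespace CuRep

/-- The class `[μ]`. -/
def mk (μ : URep G) : CuRep G := Quotient.mk _ μ

instance : Zero (CuRep G) := ⟨mk (URep.zero G)⟩

instance : One (CuRep G) := ⟨mk (URep.triv G)⟩

instance : Add (CuRep G) where
  add := Quotient.map₂ URep.sum <| by
    rintro μ μ' ⟨U, hU⟩ ν ν' ⟨W, hW⟩
    refine ⟨LinearIsometryEquiv.withLpProdCongr 2 U W, fun g ξ => ?_⟩
    change WithLp.toLp 2 (U (μ.ρ g ξ.fst), W (ν.ρ g ξ.snd))
      = WithLp.toLp 2 (μ'.ρ g (U ξ.fst), ν'.ρ g (W ξ.snd))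
    rw [hU, hW]

instance : Mul (CuRep G) where
  mul := Quotient.map₂ URep.tensor <| by
    rintro μ μ' ⟨U, hU⟩ ν ν' ⟨W, hW⟩
    refine ⟨htcongr U W, fun g => ?_⟩
    refine HTensor.iso_ext (U := (htcongr (μ.ρ g) (ν.ρ g)).trans (htcongr U W))
      (V := (htcongr U W).trans (htcongr (μ'.ρ g) (ν'.ρ g))) fun ξ η => ?_
    simp [hU, hW]

instance : Preorder (CuRep G) where
  le := Quotient.lift₂ URep.Sub fun _ _ _ _ h h' => propext
    ⟨fun k => ((URep.sub_of_equiv (Setoid.symm h)).trans k).trans (URep.sub_of_equiv h'),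
      fun k => ((URep.sub_of_equiv h).trans k).trans (URep.sub_of_equiv (Setoid.symm h'))⟩
  le_refl := by
    rintro ⟨μ⟩
    exact ⟨LinearIsometry.id, fun _ _ => rfl⟩
  le_trans := by
    rintro ⟨μ⟩ ⟨ν⟩ ⟨lam⟩ h h'
    exact URep.Sub.trans (μ := μ) (ν := ν) (lam := lam) h h'

theorem mk_add (μ ν : URep G) : mk μ + mk ν = mk (μ.sum ν) := rfl

theorem mk_mul (μ ν : URep G) : mk μ * mk ν = mk (μ.tensor ν) := rfl

theorem mk_le_mk {μ ν : URep G} : mk μ ≤ mk ν ↔ μ.Sub ν := Iff.rfl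

end CuRep

/-! ### `G`-C*-algebras and equivariant Cuntz comparison -/

/-- A `G`-C*-algebra: a C*-algebra with a strongly continuous action of `G`. -/
structure GCStar (G : Type v) [Group G] [TopologicalSpace G] : Type (max (u + 1) v) where
  carrier : Type u
  [str : NonUnitalCStarAlgebra carrier]
  α : G →* (carrier ≃⋆ₐ[ℂ] carrier)
  cont : ∀ a : carrier, Continuous fun g => α g a

attribute [instance] GCStar.str

namespace GCStar

variable {G : Type v} [Group G] [TopologicalSpace G]

/-- The automorphism `α_g` as a `*`-homomorphism. -/
def act (X : GCStar.{u} G) (g : G) : X.carrier →⋆ₙₐ[ℂ] X.carrier :=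
  (X.α g).toNonUnitalStarAlgHom

@[simp] theorem act_apply (X : GCStar.{u} G) (g : G) (a : X.carrier) : X.act g a = X.α g a := rfl

/-- Equivariant `*`-homomorphisms. -/
@[ext] structure Hom (X Y : GCStar.{u} G) where
  toHom : X.carrier →⋆ₙₐ[ℂ] Y.carrier
  equivariant : ∀ g a, toHom (X.α g a) = Y.α g (toHom a)

instance : CategoryTheory.Category (GCStar.{u} G) where
  Hom := Hom
  id X := ⟨NonUnitalStarAlgHom.id ℂ X.carrier, fun _ _ => rfl⟩
  comp φ ψ := ⟨ψ.toHom.comp φ.toHom, fun g a => by simp [φ.equivariant, ψ.equivariant]⟩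

end GCStar

/-- `V` intertwines two representations. -/
def URep.Intertwines {G : Type v} [Group G] [TopologicalSpace G] {μ ν : URep G}
    (V : μ.H →L[ℂ] ν.H) : Prop :=
  ∀ g, V ∘L μ.op g = ν.op g ∘L V

namespace URep
variable {G : Type v} [Group G] [TopologicalSpace G] {μ ν lam : URep G}

theorem Intertwines.comp {W : ν.H →L[ℂ] lam.H} {V : μ.H →L[ℂ] ν.H} (hW : Intertwines W)
    (hV : Intertwines V) : Intertwines (W ∘L V) := fun g => by
  rw [ContinuousLinearMap.comp_assoc, hV, ← ContinuousLinearMap.comp_assoc, hW,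
    ContinuousLinearMap.comp_assoc]

theorem Intertwines.adj {V : μ.H →L[ℂ] ν.H} (hV : Intertwines V) :
    Intertwines (adjoint V) := fun g => by
  have h := congrArg adjoint (hV g⁻¹)
  rw [adjoint_comp, adjoint_comp, adjoint_op, adjoint_op, inv_inv] at h
  exact h.symm

theorem intertwines_id : Intertwines (.id ℂ μ.H) := fun _ => rfl

end URep

namespace OpFam
open URep
variable {G : Type v} [Group G] [TopologicalSpace G] {X Y : GCStar.{u} G} {μ ν lam : URep G}

/-- The action of `g` on operators from `H_μ` to `H_ν` with coefficients: on `T ⊗ a` it is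
`ν_g T μ_{g⁻¹} ⊗ α_g(a)`. -/
def act {μ ν : URep G} (g : G) (x : OpFam X.carrier μ.H ν.H) : OpFam X.carrier μ.H ν.H :=
  comp (comp (mult (ν.op g)) (mapHom (X.act g) x)) (mult (μ.op g⁻¹))

theorem act_simple (g : G) (T : μ.H →L[ℂ] ν.H) (a : X.carrier) :
    act g (simple T a) = simple (ν.op g ∘L T ∘L μ.op g⁻¹) (X.α g a) := by
  rw [act, mapHom_simple, comp_simple, simple_comp, ContinuousLinearMap.comp_assoc]; rfl

/-- The space `(K(H_μ, H_ν) ⊗ A)^G`. -/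
def invK (X : GCStar.{u} G) (μ ν : URep G) : Set (OpFam X.carrier μ.H ν.H) :=
  {x | x ∈ tensorK X.carrier μ.H ν.H ∧ ∀ g, act g x = x}

theorem act_add (g : G) (x y : OpFam X.carrier μ.H ν.H) : act g (x + y) = act g x + act g y := by
  simp only [act, mapHom_add, comp_add, add_comp]

theorem act_sub (g : G) (x y : OpFam X.carrier μ.H ν.H) : act g (x - y) = act g x - act g y := by
  simp only [act, mapHom_sub, comp_sub, sub_comp]

theorem act_zero (g : G) : act g (0 : OpFam X.carrier μ.H ν.H) = 0 := by
  have := act_sub g (0 : OpFam X.carrier μ.H ν.H) 0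
  rwa [sub_self, sub_self] at this

theorem act_smul (g : G) (c : ℂ) (x : OpFam X.carrier μ.H ν.H) : act g (c • x) = c • act g x := by
  refine ext fun r => ?_
  simp only [act, comp_coord, mult_coord, mapHom_coord, smul_coord]
  ext z
  simp

theorem act_comp (g : G) (x : OpFam X.carrier ν.H lam.H) (y : OpFam X.carrier μ.H ν.H) :
    act g (comp x y) = comp (act g x) (act g y) := by
  have h : comp (mult (ν.op g⁻¹)) (act g y) = comp (mapHom (X.act g) y) (mult (μ.op g⁻¹)) := by
    rw [act, ← comp_assoc, ← comp_assoc, mult_comp_mult, op_inv_comp, mult_id_comp]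
  rw [act, act, comp_assoc (comp _ _) _ (act g y), h, mapHom_comp]
  simp only [comp_assoc]

theorem act_mult (g : G) {V : μ.H →L[ℂ] ν.H} (hV : Intertwines V) :
    act g (mult V : OpFam X.carrier μ.H ν.H) = mult V := by
  rw [act, mapHom_mult, mult_comp_mult, mult_comp_mult, ← hV, ContinuousLinearMap.comp_assoc,
    op_comp_inv]
  rfl

theorem act_adj (g : G) (x : OpFam X.carrier μ.H ν.H) : act g (adj x) = adj (act g x) := by
  rw [act, act, adj_comp, adj_comp, adj_mult, adj_mult, adjoint_op, adjoint_op, inv_inv,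
    mapHom_adj, comp_assoc]

theorem act_mapHom (φ : X ⟶ Y) (g : G) (x : OpFam X.carrier μ.H ν.H) :
    act g (mapHom φ.toHom x) = mapHom φ.toHom (act g x) := by
  have h : (Y.act g).comp φ.toHom = φ.toHom.comp (X.act g) :=
    NonUnitalStarAlgHom.ext fun a => (φ.equivariant g a).symm
  rw [act, act, mapHom_comp, mapHom_comp, mapHom_mult, mapHom_mult, mapHom_mapHom, mapHom_mapHom, h]

theorem continuous_act (g : G) :
    Continuous (act g : OpFam X.carrier μ.H ν.H → OpFam X.carrier μ.H ν.H) :=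
  (continuous_comp_left _).comp ((continuous_comp_right _).comp (continuous_mapHom _))

theorem invK_add {x y : OpFam X.carrier μ.H ν.H} (hx : x ∈ invK X μ ν) (hy : y ∈ invK X μ ν) :
    x + y ∈ invK X μ ν :=
  ⟨add_mem hx.1 hy.1, fun g => by rw [act_add, hx.2, hy.2]⟩

theorem invK_zero : (0 : OpFam X.carrier μ.H ν.H) ∈ invK X μ ν :=
  ⟨zero_mem _, act_zero⟩

theorem invK_comp {x : OpFam X.carrier ν.H lam.H} {y : OpFam X.carrier μ.H ν.H}
    (hx : x ∈ invK X ν lam) (hy : y ∈ invK X μ ν) : comp x y ∈ invK X μ lam :=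
  ⟨comp_mem hx.1 hy.1, fun g => by rw [act_comp, hx.2, hy.2]⟩

theorem invK_mult_comp {V : ν.H →L[ℂ] lam.H} {y : OpFam X.carrier μ.H ν.H}
    (hV : Intertwines V) (hy : y ∈ invK X μ ν) : comp (mult V) y ∈ invK X μ lam :=
  ⟨mult_comp_mem V hy.1, fun g => by rw [act_comp, act_mult g hV, hy.2]⟩

theorem invK_comp_mult {x : OpFam X.carrier ν.H lam.H} {V : μ.H →L[ℂ] ν.H}
    (hx : x ∈ invK X ν lam) (hV : Intertwines V) : comp x (mult V) ∈ invK X μ lam :=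
  ⟨comp_mult_mem hx.1 V, fun g => by rw [act_comp, act_mult g hV, hx.2]⟩

theorem invK_adj {x : OpFam X.carrier μ.H ν.H} (hx : x ∈ invK X μ ν) : adj x ∈ invK X ν μ :=
  ⟨adj_mem hx.1, fun g => by rw [act_adj, hx.2]⟩

theorem invK_mapHom (φ : X ⟶ Y) {x : OpFam X.carrier μ.H ν.H} (hx : x ∈ invK X μ ν) :
    mapHom φ.toHom x ∈ invK Y μ ν :=
  ⟨mapHom_mem _ hx.1, fun g => by rw [act_mapHom, hx.2]⟩

/-- The C*-algebra `(K(H_μ) ⊗ A)^G`. -/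
def invAlg (X : GCStar.{u} G) (μ : URep G) :
    NonUnitalStarSubalgebra ℂ (OpFam X.carrier μ.H μ.H) where
  carrier := invK X μ μ
  add_mem' := invK_add
  zero_mem' := invK_zero
  mul_mem' := invK_comp
  smul_mem' c _ hx := ⟨Submodule.smul_mem _ c hx.1, fun g => by rw [act_smul, hx.2]⟩
  star_mem' := invK_adj

theorem isClosed_invAlg : IsClosed (invAlg X μ : Set (OpFam X.carrier μ.H μ.H)) := by
  have h : (invAlg X μ : Set (OpFam X.carrier μ.H μ.H))
      = (tensorK X.carrier μ.H μ.H : Set (OpFam X.carrier μ.H μ.H)) ∩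
        ⋂ g : G, {x : OpFam X.carrier μ.H μ.H | act g x = x} :=
    Set.ext fun x => and_congr_right fun _ =>
      (Set.mem_iInter (s := fun g : G => {x : OpFam X.carrier μ.H μ.H | act g x = x})).symm
  rw [h]
  exact isClosed_tensorK.inter (isClosed_iInter fun g =>
    isClosed_eq (X := OpFam X.carrier μ.H μ.H) (continuous_act g) continuous_id)

end OpFam

theorem exists_approx_unit_of_normal {B : Type*} [NonUnitalCStarAlgebra B] {S : Type*}
    [SetLike S B] [NonUnitalSubringClass S B] [SMulMemClass S ℂ B] [StarMemClass S B] {s : S}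
    (hs : IsClosed (s : Set B)) {a : B} (ha : a ∈ s) (hn : IsStarNormal a) {ε : ℝ} (hε : 0 < ε) :
    ∃ e ∈ s, ‖e * a * star e - a‖ < ε := by
  have hδ : 0 < ε / 3 := by positivity
  set f : ℂ → ℂ := fun z => ((‖z‖ / (‖z‖ + ε / 3) : ℝ) : ℂ) with hf
  have hfc : Continuous f := by
    refine Complex.continuous_ofReal.comp (continuous_norm.div₀ (by fun_prop) fun z => ?_)
    positivity
  have hf0 : f 0 = 0 := by simp [hf]
  refine ⟨cfcₙ f a, cfcₙ_mem f ha, ?_⟩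
  have e1 : cfcₙ f a * a * star (cfcₙ f a) - a = cfcₙ (fun z => f z * z * star (f z) - z) a := by
    rw [cfcₙ_sub _ _ a (by fun_prop) (by simp) (by fun_prop) (by simp), cfcₙ_mul _ _ a (by fun_prop) (by simp) (by fun_prop) (by simp [hf0]),
      cfcₙ_mul _ _ a (by fun_prop) hf0 (by fun_prop) (by simp), cfcₙ_star, cfcₙ_id' ℂ a]
  rw [e1]
  refine (norm_cfcₙ_le (c := 2 * (ε / 3)) fun z _ => ?_).trans_lt (by linarith)
  have hr : 0 ≤ ‖z‖ := norm_nonneg z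
  have hp : 0 < ‖z‖ + ε / 3 := by positivity
  have e2 : f z * z * star (f z) - z
      = (((‖z‖ / (‖z‖ + ε / 3)) ^ 2 - 1 : ℝ) : ℂ) * z := by
    simp only [hf, RCLike.star_def, Complex.conj_ofReal]; push_cast; ring
  have e3 : (‖z‖ / (‖z‖ + ε / 3)) ^ 2 - 1 ≤ 0 := by
    have : ‖z‖ / (‖z‖ + ε / 3) ≤ 1 := (div_le_one hp).2 (by linarith)
    have h0 : 0 ≤ ‖z‖ / (‖z‖ + ε / 3) := by positivity
    nlinarith
  rw [e2, norm_mul, Complex.norm_real, Real.norm_of_nonpos e3]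
  have e4 : -((‖z‖ / (‖z‖ + ε / 3)) ^ 2 - 1) * ‖z‖
      = (ε / 3) * ((2 * ‖z‖ + ε / 3) * ‖z‖ / (‖z‖ + ε / 3) ^ 2) := by
    field_simp; ring
  rw [e4, mul_comm (2 : ℝ) (ε / 3)]
  refine mul_le_mul_of_nonneg_left ?_ hδ.le
  rw [div_le_iff₀ (by positivity)]
  nlinarith

end

variable {G : Type v} [Group G] [TopologicalSpace G]

open OpFam URep

/-- A positive element of `(K(H_μ) ⊗ A)^G` for some separable unitary representation `μ`. -/
structure PosElt (X : GCStar.{u} G) : Type (max (u + 1) v) where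
  rep : URep G
  val : OpFam X.carrier rep.H rep.H
  mem : val ∈ invK X rep rep
  pos : ∀ r, (val r).IsPositive

namespace PosElt

variable {X Y Z : GCStar.{u} G}

/-- `G`-Cuntz subequivalence `a ≾ b`: there are `G`-invariant `d_n` in `K(H_ν, H_μ) ⊗ A`, where `b`
lives on `H_ν` and `a` on `H_μ`, with `d_n b d_n^* → a` in norm. -/
def Subeq (a b : PosElt X) : Prop :=
  ∃ d : ℕ → OpFam X.carrier b.rep.H a.rep.H, (∀ n, d n ∈ invK X b.rep a.rep) ∧
    Tendsto (fun n => ‖comp (comp (d n) b.val) (adj (d n)) - a.val‖) atTop (𝓝 0)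

theorem subeq_iff {a b : PosElt X} : Subeq a b ↔ ∀ ε : ℝ, 0 < ε →
    ∃ d ∈ invK X b.rep a.rep, ‖comp (comp d b.val) (adj d) - a.val‖ < ε := by
  constructor
  · rintro ⟨d, hd, hlim⟩ ε hε
    obtain ⟨n, hn⟩ := (hlim.eventually_lt_const hε).exists
    exact ⟨d n, hd n, hn⟩
  · intro h
    choose d hd hlt using fun n : ℕ => h (1 / ((n : ℝ) + 1)) (by positivity)
    exact ⟨d, hd, squeeze_zero (fun _ => norm_nonneg _) (fun n => (hlt n).le)
      tendsto_one_div_add_atTop_nhds_zero_nat⟩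

theorem norm_conj_le {H₁ H₂ : Type} [NormedAddCommGroup H₁] [InnerProductSpace ℂ H₁]
    [CompleteSpace H₁] [NormedAddCommGroup H₂] [InnerProductSpace ℂ H₂] [CompleteSpace H₂]
    (x : OpFam X.carrier H₁ H₂) (y : OpFam X.carrier H₁ H₁) :
    ‖comp (comp x y) (adj x)‖ ≤ ‖x‖ * ‖y‖ * ‖x‖ := by
  refine (norm_comp_le _ _).trans ?_
  gcongr
  · exact norm_comp_le _ _
  · exact norm_adj_le _

theorem exists_approx_unit (a : PosElt X) {ε : ℝ} (hε : 0 < ε) :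
    ∃ e ∈ invK X a.rep a.rep, ‖comp (comp e a.val) (adj e) - a.val‖ < ε := by
  have hsa : star a.val = a.val := OpFam.ext fun r => (a.pos r).isSelfAdjoint
  have hn : IsStarNormal a.val := ⟨by rw [hsa]⟩
  exact exists_approx_unit_of_normal (s := invAlg X a.rep) isClosed_invAlg a.mem hn hε

theorem Subeq.refl (a : PosElt X) : Subeq a a :=
  subeq_iff.2 fun _ hε => a.exists_approx_unit hε

theorem Subeq.trans {a b c : PosElt X} (h : Subeq a b) (h' : Subeq b c) : Subeq a c := by
  rw [subeq_iff] at *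
  intro ε hε
  obtain ⟨x, hx, hxε⟩ := h (ε / 2) (half_pos hε)
  have hp : 0 < 2 * (‖x‖ + 1) * (‖x‖ + 1) := by positivity
  obtain ⟨y, hy, hyε⟩ := h' (ε / (2 * (‖x‖ + 1) * (‖x‖ + 1))) (by positivity)
  refine ⟨comp x y, invK_comp hx hy, ?_⟩
  have e : comp (comp (comp x y) c.val) (adj (comp x y)) - a.val
      = comp (comp x (comp (comp y c.val) (adj y) - b.val)) (adj x)
        + (comp (comp x b.val) (adj x) - a.val) := by
    rw [comp_sub, sub_comp, adj_comp]
    simp only [comp_assoc]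
    abel
  rw [e]
  refine (norm_add_le _ _).trans_lt ?_
  have h1 := norm_conj_le x (comp (comp y c.val) (adj y) - b.val)
  have h2 : ‖x‖ * ‖comp (comp y c.val) (adj y) - b.val‖ * ‖x‖ ≤ ε / 2 := by
    calc _ ≤ (‖x‖ + 1) * (ε / (2 * (‖x‖ + 1) * (‖x‖ + 1))) * (‖x‖ + 1) := by
          gcongr <;> linarith
      _ = ε / 2 := by field_simp
  linarith

instance : Preorder (PosElt X) where
  le := Subeq
  le_refl := Subeq.refl
  le_trans _ _ _ := Subeq.trans

/-- The element `V a V^*` of `B(H_ν)` with coefficients. -/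
def cj {H₁ H₂ : Type} [NormedAddCommGroup H₁] [InnerProductSpace ℂ H₁]
    [CompleteSpace H₁] [NormedAddCommGroup H₂] [InnerProductSpace ℂ H₂] [CompleteSpace H₂]
    (V : H₁ →L[ℂ] H₂) (x : OpFam X.carrier H₁ H₁) : OpFam X.carrier H₂ H₂ :=
  comp (comp (mult V) x) (mult (adjoint V))

section cj
variable {H₁ H₂ H₃ : Type} [NormedAddCommGroup H₁] [InnerProductSpace ℂ H₁]
    [CompleteSpace H₁] [NormedAddCommGroup H₂] [InnerProductSpace ℂ H₂] [CompleteSpace H₂]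
    [NormedAddCommGroup H₃] [InnerProductSpace ℂ H₃] [CompleteSpace H₃]

theorem cj_add (V : H₁ →L[ℂ] H₂) (x y : OpFam X.carrier H₁ H₁) :
    cj V (x + y) = cj V x + cj V y := by
  simp only [cj, comp_add, add_comp]

theorem cj_zero (V : H₁ →L[ℂ] H₂) : cj V (0 : OpFam X.carrier H₁ H₁) = 0 := by
  simp only [cj, comp_zero, zero_comp]

theorem cj_cj (W : H₂ →L[ℂ] H₃) (V : H₁ →L[ℂ] H₂) (x : OpFam X.carrier H₁ H₁) :
    cj W (cj V x) = cj (W ∘L V) x := by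
  have h : (mult (adjoint (W ∘L V)) : OpFam X.carrier H₃ H₁)
      = comp (mult (adjoint V)) (mult (adjoint W)) := by
    rw [mult_comp_mult, adjoint_comp]
  simp only [cj, h, ← mult_comp_mult, comp_assoc]

theorem cj_pos (V : H₁ →L[ℂ] H₂) {x : OpFam X.carrier H₁ H₁} (h : ∀ r, (x r).IsPositive)
    (r : StarRep X.carrier) : (cj V x r).IsPositive := by
  have e : cj V x r = htmap V (.id ℂ r.L) ∘L x r ∘L adjoint (htmap V (.id ℂ r.L)) := by
    have : adjoint (ContinuousLinearMap.id ℂ r.L) = .id ℂ r.L := adjoint_id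
    rw [adjoint_htmap, this]
    rfl
  rw [e]
  exact (h r).conj_adjoint _

theorem mapHom_cj (φ : X ⟶ Y) (V : H₁ →L[ℂ] H₂) (x : OpFam X.carrier H₁ H₁) :
    mapHom φ.toHom (cj V x) = cj V (mapHom φ.toHom x) := by
  simp only [cj, mapHom_comp, mapHom_mult]

end cj

theorem cj_mem {μ ν : URep G} {V : μ.H →L[ℂ] ν.H} (hV : Intertwines V)
    {x : OpFam X.carrier μ.H μ.H} (hx : x ∈ invK X μ μ) : cj V x ∈ invK X ν ν :=
  invK_comp_mult (invK_mult_comp hV hx) hV.adj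

/-- The positive element `V a V^*`. -/
def conj (a : PosElt X) {ν : URep G} (V : a.rep.H →L[ℂ] ν.H) (hV : Intertwines V) : PosElt X where
  rep := ν
  val := cj V a.val
  mem := cj_mem hV a.mem
  pos := cj_pos V a.pos

theorem conj_le (a : PosElt X) {ν : URep G} (V : a.rep.H →L[ℂ] ν.H) (hV : Intertwines V) :
    a.conj V hV ≤ a := by
  refine subeq_iff.2 fun ε hε => ?_
  obtain ⟨e, he, hlt⟩ := a.exists_approx_unit (ε := ε / ((‖V‖ + 1) * (‖V‖ + 1))) (by positivity)
  refine ⟨comp (mult V) e, invK_mult_comp hV he, ?_⟩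
  have h : comp (comp (comp (mult V) e) a.val) (adj (comp (mult V) e)) - cj V a.val
      = comp (comp (mult V) (comp (comp e a.val) (adj e) - a.val)) (adj (mult V)) := by
    rw [comp_sub, sub_comp, adj_comp]
    simp only [comp_assoc, cj, adj_mult]
  change ‖comp (comp (comp (mult V) e) a.val) (adj (comp (mult V) e)) - cj V a.val‖ < ε
  rw [h]
  refine (norm_conj_le _ _).trans_lt ?_
  have hm : ‖(mult V : OpFam X.carrier a.rep.H ν.H)‖ < ‖V‖ + 1 :=
    (norm_mult_le V).trans_lt (by linarith)
  have hm0 : 0 ≤ ‖(mult V : OpFam X.carrier a.rep.H ν.H)‖ := norm_nonneg _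
  calc _ ≤ (‖V‖ + 1) * ‖comp (comp e a.val) (adj e) - a.val‖ * (‖V‖ + 1) := by gcongr
    _ < (‖V‖ + 1) * (ε / ((‖V‖ + 1) * (‖V‖ + 1))) * (‖V‖ + 1) := by gcongr
    _ = ε := by field_simp

theorem le_conj (a : PosElt X) {ν : URep G} (V : a.rep.H →L[ℂ] ν.H) (hV : Intertwines V)
    (hiso : adjoint V ∘L V = .id ℂ a.rep.H) : a ≤ a.conj V hV := by
  refine subeq_iff.2 fun ε hε => ?_
  obtain ⟨e, he, hlt⟩ := a.exists_approx_unit hε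
  refine ⟨comp e (mult (adjoint V)), invK_comp_mult he hV.adj, ?_⟩
  have hc : cj (adjoint V) (cj V a.val) = a.val := by
    rw [cj_cj, hiso]
    have : adjoint (ContinuousLinearMap.id ℂ a.rep.H) = .id ℂ a.rep.H := adjoint_id
    rw [cj, this, mult_id_comp, comp_mult_id]
  have h : comp (comp (comp e (mult (adjoint V))) (cj V a.val))
      (adj (comp e (mult (adjoint V)))) = comp (comp e a.val) (adj e) := by
    conv_rhs => rw [← hc]
    rw [adj_comp, adj_mult]
    simp only [cj, comp_assoc, adjoint_adjoint]
  change ‖comp (comp (comp e (mult (adjoint V))) (cj V a.val))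
      (adj (comp e (mult (adjoint V)))) - a.val‖ < ε
  rw [h]
  exact hlt

/-- Cuntz equivalence of elements with the same representation and value up to an equivariant
isometry. -/
theorem equiv_of_conj {a b : PosElt X} (V : a.rep.H →L[ℂ] b.rep.H) (hV : Intertwines V)
    (hiso : adjoint V ∘L V = .id ℂ a.rep.H) (h : b.val = cj V a.val) : a ≤ b ∧ b ≤ a := by
  have hle := a.le_conj V hV hiso
  have hge := a.conj_le V hV
  have hb : b = a.conj V hV := by
    cases b
    congr
  rw [hb]
  exact ⟨hle, hge⟩

end PosElt

open OpFam URep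

section sum
variable {H K : Type} [NormedAddCommGroup H] [InnerProductSpace ℂ H]
  [NormedAddCommGroup K] [InnerProductSpace ℂ K]

/-- The inclusion of the first summand of a Hilbert space direct sum. -/
def inL (H K : Type) [NormedAddCommGroup H] [InnerProductSpace ℂ H]
    [NormedAddCommGroup K] [InnerProductSpace ℂ K] : H →L[ℂ] WithLp 2 (H × K) :=
  (WithLp.prodContinuousLinearEquiv 2 ℂ H K).symm.toContinuousLinearMap.comp
    (ContinuousLinearMap.inl ℂ H K)

/-- The inclusion of the second summand of a Hilbert space direct sum. -/
def inR (H K : Type) [NormedAddCommGroup H] [InnerProductSpace ℂ H]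
    [NormedAddCommGroup K] [InnerProductSpace ℂ K] : K →L[ℂ] WithLp 2 (H × K) :=
  (WithLp.prodContinuousLinearEquiv 2 ℂ H K).symm.toContinuousLinearMap.comp
    (ContinuousLinearMap.inr ℂ H K)

theorem inL_apply (x : H) : inL H K x = WithLp.toLp 2 (x, 0) := rfl

theorem inR_apply (y : K) : inR H K y = WithLp.toLp 2 (0, y) := rfl

variable [CompleteSpace H] [CompleteSpace K]

theorem adjoint_inL_apply (z : WithLp 2 (H × K)) : adjoint (inL H K) z = z.fst := by
  refine ext_inner_left ℂ fun w => ?_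
  rw [ContinuousLinearMap.adjoint_inner_right, WithLp.prod_inner_apply, inL_apply]
  simp

theorem adjoint_inR_apply (z : WithLp 2 (H × K)) : adjoint (inR H K) z = z.snd := by
  refine ext_inner_left ℂ fun w => ?_
  rw [ContinuousLinearMap.adjoint_inner_right, WithLp.prod_inner_apply, inR_apply]
  simp

theorem adjoint_inL_inL : adjoint (inL H K) ∘L inL H K = .id ℂ H := by
  ext x; simp [adjoint_inL_apply, inL_apply]

theorem adjoint_inR_inR : adjoint (inR H K) ∘L inR H K = .id ℂ K := by
  ext x; simp [adjoint_inR_apply, inR_apply]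

theorem adjoint_inL_inR : adjoint (inL H K) ∘L inR H K = 0 := by
  ext x; simp [adjoint_inL_apply, inR_apply]

theorem adjoint_inR_inL : adjoint (inR H K) ∘L inL H K = 0 := by
  ext x; simp [adjoint_inR_apply, inL_apply]

end sum

theorem intertwines_inL (μ ν : URep G) :
    Intertwines (μ := μ) (ν := μ.sum ν) (inL μ.H ν.H) := fun g => by
  ext x
  change WithLp.toLp 2 (μ.ρ g x, (0 : ν.H)) = WithLp.toLp 2 (μ.ρ g x, ν.ρ g 0)
  rw [map_zero]

theorem intertwines_inR (μ ν : URep G) :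
    Intertwines (μ := ν) (ν := μ.sum ν) (inR μ.H ν.H) := fun g => by
  ext x
  change WithLp.toLp 2 ((0 : μ.H), ν.ρ g x) = WithLp.toLp 2 (μ.ρ g 0, ν.ρ g x)
  rw [map_zero]

theorem adjoint_linearIsometry_comp {H K : Type} [NormedAddCommGroup H] [InnerProductSpace ℂ H]
    [NormedAddCommGroup K] [InnerProductSpace ℂ K] [CompleteSpace H] [CompleteSpace K]
    (V : H →ₗᵢ[ℂ] K) : adjoint V.toContinuousLinearMap ∘L V.toContinuousLinearMap = .id ℂ H := by
  ext x
  refine ext_inner_left ℂ fun w => ?_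
  simp

namespace PosElt

variable {X Y Z : GCStar.{u} G}

/-- The direct sum `a ⊕ b`, that is, the diagonal matrix with entries `a` and `b`. -/
def sum (a b : PosElt X) : PosElt X where
  rep := a.rep.sum b.rep
  val := cj (inL a.rep.H b.rep.H) a.val + cj (inR a.rep.H b.rep.H) b.val
  mem := invK_add (cj_mem (intertwines_inL a.rep b.rep) a.mem)
    (cj_mem (intertwines_inR a.rep b.rep) b.mem)
  pos r := (cj_pos (inL a.rep.H b.rep.H) a.pos r).add (cj_pos (inR a.rep.H b.rep.H) b.pos r)

/-- The zero element, on the zero representation. -/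
def zero (X : GCStar.{u} G) : PosElt X where
  rep := URep.zero G
  val := 0
  mem := invK_zero
  pos _ := ContinuousLinearMap.isPositive_zero

theorem norm_cj_le {H₁ H₂ : Type} [NormedAddCommGroup H₁] [InnerProductSpace ℂ H₁]
    [CompleteSpace H₁] [NormedAddCommGroup H₂] [InnerProductSpace ℂ H₂] [CompleteSpace H₂]
    {V : H₁ →L[ℂ] H₂} (hV : ‖V‖ ≤ 1) (x : OpFam X.carrier H₁ H₁) : ‖cj V x‖ ≤ ‖x‖ := by
  have h := norm_conj_le (mult V) x
  rw [adj_mult] at h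
  have hm : ‖(mult V : OpFam X.carrier H₁ H₂)‖ ≤ 1 := (norm_mult_le V).trans hV
  have hm0 := norm_nonneg (mult V : OpFam X.carrier H₁ H₂)
  have hx := norm_nonneg x
  exact h.trans (by nlinarith [mul_le_mul_of_nonneg_right hm hx])

theorem cj_sub {H₁ H₂ : Type} [NormedAddCommGroup H₁] [InnerProductSpace ℂ H₁]
    [CompleteSpace H₁] [NormedAddCommGroup H₂] [InnerProductSpace ℂ H₂] [CompleteSpace H₂]
    (V : H₁ →L[ℂ] H₂) (x y : OpFam X.carrier H₁ H₁) : cj V (x - y) = cj V x - cj V y := by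
  simp only [cj, comp_sub, sub_comp]

theorem norm_inL_le {H K : Type} [NormedAddCommGroup H] [InnerProductSpace ℂ H]
    [NormedAddCommGroup K] [InnerProductSpace ℂ K] : ‖inL H K‖ ≤ 1 :=
  ContinuousLinearMap.opNorm_le_bound _ zero_le_one fun x => by simp [inL_apply]

theorem norm_inR_le {H K : Type} [NormedAddCommGroup H] [InnerProductSpace ℂ H]
    [NormedAddCommGroup K] [InnerProductSpace ℂ K] : ‖inR H K‖ ≤ 1 :=
  ContinuousLinearMap.opNorm_le_bound _ zero_le_one fun x => by simp [inR_apply]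

theorem sum_mono_aux {H₁ H₂ H₁' H₂' : Type} [NormedAddCommGroup H₁] [InnerProductSpace ℂ H₁]
    [CompleteSpace H₁] [NormedAddCommGroup H₂] [InnerProductSpace ℂ H₂] [CompleteSpace H₂]
    [NormedAddCommGroup H₁'] [InnerProductSpace ℂ H₁'] [CompleteSpace H₁']
    [NormedAddCommGroup H₂'] [InnerProductSpace ℂ H₂'] [CompleteSpace H₂']
    (a' : OpFam X.carrier H₁' H₁') (b' : OpFam X.carrier H₂' H₂')
    (d : OpFam X.carrier H₁' H₁) (e : OpFam X.carrier H₂' H₂) :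
    comp (comp (comp (comp (mult (inL H₁ H₂)) d) (mult (adjoint (inL H₁' H₂')))
        + comp (comp (mult (inR H₁ H₂)) e) (mult (adjoint (inR H₁' H₂'))))
        (cj (inL H₁' H₂') a' + cj (inR H₁' H₂') b'))
        (adj (comp (comp (mult (inL H₁ H₂)) d) (mult (adjoint (inL H₁' H₂')))
        + comp (comp (mult (inR H₁ H₂)) e) (mult (adjoint (inR H₁' H₂')))))
      = cj (inL H₁ H₂) (comp (comp d a') (adj d)) + cj (inR H₁ H₂) (comp (comp e b') (adj e)) := by
  have key : ∀ {K₁ K₂ K₃ K₄ : Type} [NormedAddCommGroup K₁] [InnerProductSpace ℂ K₁]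
      [NormedAddCommGroup K₂] [InnerProductSpace ℂ K₂]
      [NormedAddCommGroup K₃] [InnerProductSpace ℂ K₃]
      [NormedAddCommGroup K₄] [InnerProductSpace ℂ K₄]
      (S : K₂ →L[ℂ] K₃) (T : K₁ →L[ℂ] K₂) (z : OpFam X.carrier K₄ K₁),
      comp (mult S) (comp (mult T) z) = comp (mult (S ∘L T)) z := by
    intro K₁ K₂ K₃ K₄ _ _ _ _ _ _ _ _ S T z
    rw [← comp_assoc, mult_comp_mult]
  simp only [cj, adj_add, adj_comp, adj_mult, adjoint_adjoint, comp_add, add_comp, comp_assoc, key,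
    adjoint_inL_inL, adjoint_inR_inR, adjoint_inL_inR, adjoint_inR_inL, mult_id_comp, mult_zero,
    zero_comp, comp_zero, add_zero, zero_add]

theorem sum_mono_norm {H₁ H₂ H₁' H₂' : Type} [NormedAddCommGroup H₁] [InnerProductSpace ℂ H₁]
    [CompleteSpace H₁] [NormedAddCommGroup H₂] [InnerProductSpace ℂ H₂] [CompleteSpace H₂]
    [NormedAddCommGroup H₁'] [InnerProductSpace ℂ H₁'] [CompleteSpace H₁']
    [NormedAddCommGroup H₂'] [InnerProductSpace ℂ H₂'] [CompleteSpace H₂']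
    (a : OpFam X.carrier H₁ H₁) (b : OpFam X.carrier H₂ H₂)
    (a' : OpFam X.carrier H₁' H₁') (b' : OpFam X.carrier H₂' H₂')
    (d : OpFam X.carrier H₁' H₁) (e : OpFam X.carrier H₂' H₂) {ε : ℝ}
    (hd : ‖comp (comp d a') (adj d) - a‖ < ε / 4) (he : ‖comp (comp e b') (adj e) - b‖ < ε / 4) :
    ‖comp (comp (comp (comp (mult (inL H₁ H₂)) d) (mult (adjoint (inL H₁' H₂')))
        + comp (comp (mult (inR H₁ H₂)) e) (mult (adjoint (inR H₁' H₂'))))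
        (cj (inL H₁' H₂') a' + cj (inR H₁' H₂') b'))
        (adj (comp (comp (mult (inL H₁ H₂)) d) (mult (adjoint (inL H₁' H₂')))
        + comp (comp (mult (inR H₁ H₂)) e) (mult (adjoint (inR H₁' H₂')))))
        - (cj (inL H₁ H₂) a + cj (inR H₁ H₂) b)‖ < ε := by
  rw [sum_mono_aux, add_sub_add_comm, ← cj_sub, ← cj_sub]
  refine (norm_add_le _ _).trans_lt ?_
  have h2 := norm_cj_le (norm_inL_le (H := H₁) (K := H₂)) (comp (comp d a') (adj d) - a)
  have h3 := norm_cj_le (norm_inR_le (H := H₁) (K := H₂)) (comp (comp e b') (adj e) - b)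
  have h4 : 0 ≤ ‖comp (comp d a') (adj d) - a‖ := norm_nonneg _
  linarith

section
variable {H K L : Type} [NormedAddCommGroup H] [InnerProductSpace ℂ H] [CompleteSpace H]
  [NormedAddCommGroup K] [InnerProductSpace ℂ K] [CompleteSpace K]
  [NormedAddCommGroup L] [InnerProductSpace ℂ L] [CompleteSpace L]

theorem sum_comm_aux (x : OpFam X.carrier H H) (y : OpFam X.carrier K K) :
    cj (inL K H) y + cj (inR K H) x
      = cj (LinearIsometryEquiv.withLpProdComm 2 ℂ H K : _ →L[ℂ] WithLp 2 (K × H))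
        (cj (inL H K) x + cj (inR H K) y) := by
  rw [cj_add, cj_cj, cj_cj, add_comm]
  rfl

theorem sum_assoc_aux (x : OpFam X.carrier H H) (y : OpFam X.carrier K K)
    (z : OpFam X.carrier L L) :
    cj (inL H (WithLp 2 (K × L))) x + cj (inR H (WithLp 2 (K × L))) (cj (inL K L) y + cj (inR K L) z)
      = cj (LinearIsometryEquiv.withLpProdAssoc 2 ℂ H K L : _ →L[ℂ] WithLp 2 (H × WithLp 2 (K × L)))
        (cj (inL (WithLp 2 (H × K)) L) (cj (inL H K) x + cj (inR H K) y)
          + cj (inR (WithLp 2 (H × K)) L) z) := by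
  simp only [cj_add, cj_cj]
  rw [← add_assoc]
  rfl

theorem zero_sum_aux (x : OpFam X.carrier K K) :
    cj (inL H K) 0 + cj (inR H K) x = cj (inR H K) x := by
  rw [cj_zero, zero_add]

end

theorem sum_mono {a a' b b' : PosElt X} (h : a ≤ a') (h' : b ≤ b') : sum a b ≤ sum a' b' := by
  refine subeq_iff.2 fun ε hε => ?_
  obtain ⟨d, hd, hdε⟩ := subeq_iff.1 h (ε / 4) (by positivity)
  obtain ⟨e, he, heε⟩ := subeq_iff.1 h' (ε / 4) (by positivity)
  refine ⟨comp (comp (mult (inL a.rep.H b.rep.H)) d) (mult (adjoint (inL a'.rep.H b'.rep.H)))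
      + comp (comp (mult (inR a.rep.H b.rep.H)) e) (mult (adjoint (inR a'.rep.H b'.rep.H))),
    invK_add
      (invK_comp_mult (invK_mult_comp (intertwines_inL a.rep b.rep) hd)
        (intertwines_inL a'.rep b'.rep).adj)
      (invK_comp_mult (invK_mult_comp (intertwines_inR a.rep b.rep) he)
        (intertwines_inR a'.rep b'.rep).adj), ?_⟩
  exact sum_mono_norm a.val b.val a'.val b'.val d e hdε heε

/-- Elements that differ by an equivariant unitary are equivalent. -/
theorem equiv_of_iso {a b : PosElt X} (U : a.rep.H ≃ₗᵢ[ℂ] b.rep.H)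
    (hU : ∀ g ξ, U (a.rep.ρ g ξ) = b.rep.ρ g (U ξ))
    (h : b.val = cj (U : a.rep.H →L[ℂ] b.rep.H) a.val) : a ≤ b ∧ b ≤ a :=
  equiv_of_conj (U : a.rep.H →L[ℂ] b.rep.H) (fun g => ContinuousLinearMap.ext fun ξ => hU g ξ)
    (adjoint_linearIsometry_comp U.toLinearIsometry) h

theorem sum_comm_equiv (a b : PosElt X) : sum a b ≤ sum b a ∧ sum b a ≤ sum a b := by
  refine equiv_of_iso (a := sum a b) (b := sum b a)
    (LinearIsometryEquiv.withLpProdComm 2 ℂ a.rep.H b.rep.H) (fun _ _ => rfl) ?_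
  exact sum_comm_aux a.val b.val

theorem sum_assoc_equiv (a b c : PosElt X) :
    sum (sum a b) c ≤ sum a (sum b c) ∧ sum a (sum b c) ≤ sum (sum a b) c := by
  refine equiv_of_iso (a := sum (sum a b) c) (b := sum a (sum b c))
    (LinearIsometryEquiv.withLpProdAssoc 2 ℂ a.rep.H b.rep.H c.rep.H) (fun _ _ => rfl) ?_
  exact sum_assoc_aux a.val b.val c.val

theorem zero_sum_equiv (a : PosElt X) : a ≤ sum (zero X) a ∧ sum (zero X) a ≤ a := by
  refine equiv_of_conj (a := a) (b := sum (zero X) a) (inR (URep.zero G).H a.rep.H)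
    (intertwines_inR _ _) adjoint_inR_inR ?_
  exact zero_sum_aux a.val

/-- The image of a positive element under an equivariant `*`-homomorphism. -/
def map (φ : X ⟶ Y) (a : PosElt X) : PosElt Y where
  rep := a.rep
  val := mapHom φ.toHom a.val
  mem := invK_mapHom φ a.mem
  pos r := a.pos (r.pullback φ.toHom)

theorem map_mono (φ : X ⟶ Y) {a b : PosElt X} (h : a ≤ b) : map φ a ≤ map φ b := by
  refine subeq_iff.2 fun ε hε => ?_
  obtain ⟨d, hd, hdε⟩ := subeq_iff.1 h ε hε
  refine ⟨mapHom φ.toHom d, invK_mapHom φ hd, ?_⟩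
  change ‖comp (comp (mapHom φ.toHom d) (mapHom φ.toHom b.val)) (adj (mapHom φ.toHom d))
    - mapHom φ.toHom a.val‖ < ε
  rw [← mapHom_adj, ← mapHom_comp, ← mapHom_comp, ← mapHom_sub]
  exact (norm_mapHom_le _ _).trans_lt hdε

end PosElt

open OpFam URep

/-! ### The equivariant Cuntz semigroup -/

/-- The equivariant Cuntz semigroup `Cu^G(A, α)`: the `G`-Cuntz equivalence classes of positive
elements, ordered by `G`-Cuntz subequivalence. -/
def CuG (X : GCStar.{u} G) : Type (max (u + 1) v) :=
  Antisymmetrization (PosElt X) (· ≤ ·)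

namespace CuG

variable {X Y Z : GCStar.{u} G}

instance : PartialOrder (CuG X) :=
  inferInstanceAs (PartialOrder (Antisymmetrization (PosElt X) (· ≤ ·)))

/-- The class `[a]_G`. -/
def mk (a : PosElt X) : CuG X := toAntisymmetrization (· ≤ ·) a

theorem mk_le_mk {a b : PosElt X} : mk a ≤ mk b ↔ a ≤ b := Iff.rfl

theorem mk_eq_mk {a b : PosElt X} : mk a = mk b ↔ a ≤ b ∧ b ≤ a := by
  rw [le_antisymm_iff, mk_le_mk, mk_le_mk]

theorem sound {a b : PosElt X} (h : a ≤ b ∧ b ≤ a) : mk a = mk b := mk_eq_mk.2 h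

theorem ind {p : CuG X → Prop} (h : ∀ a, p (mk a)) (x : CuG X) : p x := Quotient.ind h x

/-- Addition is given by `[a] + [b] = [a ⊕ b]`. -/
instance : Add (CuG X) where
  add := Quotient.lift₂ (fun a b => mk (PosElt.sum a b)) fun _ _ _ _ h h' =>
    sound ⟨PosElt.sum_mono h.1 h'.1, PosElt.sum_mono h.2 h'.2⟩

instance : Zero (CuG X) := ⟨mk (PosElt.zero X)⟩

theorem mk_add (a b : PosElt X) : mk a + mk b = mk (PosElt.sum a b) := rfl

instance : AddCommMonoid (CuG X) where
  add_assoc := by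
    refine ind fun a => ind fun b => ind fun c => ?_
    exact sound (PosElt.sum_assoc_equiv a b c)
  add_comm := by
    refine ind fun a => ind fun b => ?_
    exact sound (PosElt.sum_comm_equiv a b)
  zero_add := by
    refine ind fun a => ?_
    exact (sound (PosElt.zero_sum_equiv a)).symm
  add_zero := by
    refine ind fun a => ?_
    exact (sound (PosElt.sum_comm_equiv a (PosElt.zero X))).trans
      (sound (PosElt.zero_sum_equiv a)).symm
  nsmul := nsmulRec

/-- The map `Cu^G(φ)`, sending `[a]_G` to `[(id ⊗ φ)(a)]_G`. -/
def map (φ : X ⟶ Y) : CuG X → CuG Y :=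
  Quotient.lift (fun a => mk (PosElt.map φ a)) fun _ _ h =>
    sound ⟨PosElt.map_mono φ h.1, PosElt.map_mono φ h.2⟩

theorem map_mk (φ : X ⟶ Y) (a : PosElt X) : map φ (mk a) = mk (PosElt.map φ a) := rfl

end CuG

/-! ### The action of `Cu(G)` -/

open scoped ComplexOrder in
/-- A strictly positive element of the C*-algebra `K(H)` of compact operators: a positive element
at which every nonzero positive linear functional on `K(H)` is (strictly) positive. -/
def IsStrictlyPos {H : Type} [NormedAddCommGroup H] [InnerProductSpace ℂ H] [CompleteSpace H]
    (s : compactOperator (RingHom.id ℂ) H H) : Prop :=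
  s.1.IsPositive ∧ ∀ τ : compactOperator (RingHom.id ℂ) H H →ₗ[ℂ] ℂ,
    (∀ x, x.1.IsPositive → 0 ≤ τ x) → τ ≠ 0 → 0 < τ s

/-- A `G`-invariant strictly positive element of `K(H_ν)`. -/
structure StrictElt (ν : URep G) where
  val : compactOperator (RingHom.id ℂ) ν.H ν.H
  strict : IsStrictlyPos val
  inv : ∀ g, ν.op g ∘L val.1 ∘L ν.op g⁻¹ = val.1

namespace OpFam
variable {X : GCStar.{u} G}

theorem tensor_comp {A : Type u} [NonUnitalCStarAlgebra A] {H₁ H₂ H₃ K₁ K₂ K₃ : Type}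
    [NormedAddCommGroup H₁] [InnerProductSpace ℂ H₁] [NormedAddCommGroup H₂]
    [InnerProductSpace ℂ H₂] [NormedAddCommGroup H₃] [InnerProductSpace ℂ H₃]
    [NormedAddCommGroup K₁] [InnerProductSpace ℂ K₁] [NormedAddCommGroup K₂]
    [InnerProductSpace ℂ K₂] [NormedAddCommGroup K₃] [InnerProductSpace ℂ K₃]
    (S : H₂ →L[ℂ] H₃) (T : H₁ →L[ℂ] H₂) (x : OpFam A K₂ K₃) (y : OpFam A K₁ K₂) :
    comp (tensor S x) (tensor T y) = tensor (S ∘L T) (comp x y) :=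
  OpFam.ext fun r => by
    ext z
    simp only [comp_coord, tensor_coord, ← htmap_comp, ContinuousLinearMap.comp_apply,
      LinearIsometryEquiv.coe_coe'', LinearIsometryEquiv.apply_symm_apply]

theorem tensor_mult {A : Type u} [NonUnitalCStarAlgebra A] {H₁ H₂ K₁ K₂ : Type}
    [NormedAddCommGroup H₁] [InnerProductSpace ℂ H₁] [NormedAddCommGroup H₂]
    [InnerProductSpace ℂ H₂] [NormedAddCommGroup K₁] [InnerProductSpace ℂ K₁]
    [NormedAddCommGroup K₂] [InnerProductSpace ℂ K₂] (S : H₁ →L[ℂ] H₂) (T : K₁ →L[ℂ] K₂) :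
    tensor S (mult T : OpFam A K₁ K₂) = mult (htmap S T) :=
  OpFam.ext fun r => HTensor.ext₃ fun ξ η ζ => by simp [tensor_coord]

theorem mapHom_tensor {A B : Type u} [NonUnitalCStarAlgebra A] [NonUnitalCStarAlgebra B]
    {H₁ H₂ K₁ K₂ : Type}
    [NormedAddCommGroup H₁] [InnerProductSpace ℂ H₁] [NormedAddCommGroup H₂]
    [InnerProductSpace ℂ H₂] [NormedAddCommGroup K₁] [InnerProductSpace ℂ K₁]
    [NormedAddCommGroup K₂] [InnerProductSpace ℂ K₂] (φ : A →⋆ₙₐ[ℂ] B) (S : H₁ →L[ℂ] H₂)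
    (x : OpFam A K₁ K₂) : mapHom φ (tensor S x) = tensor S (mapHom φ x) :=
  OpFam.ext fun _ => rfl

theorem act_tensor (ν μ : URep G) (g : G) (s : ν.H →L[ℂ] ν.H) (x : OpFam X.carrier μ.H μ.H) :
    act (μ := ν.tensor μ) (ν := ν.tensor μ) g (tensor s x)
      = tensor (ν.op g ∘L s ∘L ν.op g⁻¹) (act g x) := by
  have h : ∀ g, (ν.tensor μ).op g = htmap (ν.op g) (μ.op g) := fun g => htcongr_coe _ _
  rw [act, act, h, h, ← tensor_mult, ← tensor_mult, mapHom_tensor]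
  exact (congrArg (fun z => comp z _) (tensor_comp _ _ _ _)).trans (tensor_comp _ _ _ _)

theorem exists_adjoint_comp {H : Type*} [NormedAddCommGroup H] [InnerProductSpace ℂ H]
    [CompleteSpace H] {T : H →L[ℂ] H} (hT : T.IsPositive) : ∃ R : H →L[ℂ] H, T = adjoint R ∘L R :=
  CStarAlgebra.nonneg_iff_eq_star_mul_self.1 ((ContinuousLinearMap.nonneg_iff_isPositive T).2 hT)

theorem isPositive_htmap {H L : Type*} [NormedAddCommGroup H] [InnerProductSpace ℂ H]
    [CompleteSpace H] [NormedAddCommGroup L] [InnerProductSpace ℂ L] [CompleteSpace L]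
    {S : H →L[ℂ] H} {T : L →L[ℂ] L} (hS : S.IsPositive) (hT : T.IsPositive) :
    (htmap S T).IsPositive := by
  obtain ⟨R, rfl⟩ := exists_adjoint_comp hS
  obtain ⟨Q, rfl⟩ := exists_adjoint_comp hT
  rw [← htmap_comp, ← adjoint_htmap]
  exact ContinuousLinearMap.isPositive_adjoint_comp_self _

theorem tensor_pos {A : Type u} [NonUnitalCStarAlgebra A] {H K : Type} [NormedAddCommGroup H]
    [InnerProductSpace ℂ H] [CompleteSpace H] [NormedAddCommGroup K] [InnerProductSpace ℂ K]
    [CompleteSpace K] {s : H →L[ℂ] H} (hs : s.IsPositive) {x : OpFam A K K}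
    (hx : ∀ r, (x r).IsPositive) (r : StarRep A) : (tensor s x r).IsPositive := by
  have h := (isPositive_htmap hs (hx r)).conj_adjoint
    ((htassoc H K r.L).symm : HTensor H (HTensor K r.L) →L[ℂ] HTensor (HTensor H K) r.L)
  rwa [LinearIsometryEquiv.adjoint_eq_symm, LinearIsometryEquiv.symm_symm] at h

end OpFam

/-- The positive element `s ⊗ a` on the representation `ν ⊗ μ`. -/
def PosElt.tensor {X : GCStar.{u} G} {ν : URep G} (s : StrictElt ν) (a : PosElt X) : PosElt X where
  rep := ν.tensor a.rep
  val := OpFam.tensor s.val.1 a.val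
  mem := ⟨tensor_mem s.val.2 a.mem.1, fun g => by rw [act_tensor, s.inv, a.mem.2]⟩
  pos := tensor_pos s.strict.1 a.pos

open Classical in
/-- The action of `Cu(G)` on `Cu^G(A, α)`, given by `[ν] • [a]_G = [s_ν ⊗ a]_G`, computed on chosen
representatives `ν` and `a` and for a chosen `G`-invariant strictly positive `s_ν`. -/
instance {X : GCStar.{u} G} : SMul (CuRep G) (CuG X) where
  smul r x := if h : Nonempty (StrictElt r.out) then
    CuG.mk (PosElt.tensor h.some (Quotient.out x)) else 0

/-! ### The categories `Cu` and `Cu^G` -/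

/-- Compact containment `s ≪ t`: every increasing sequence with a supremum above `t` has a term
above `s`. -/
def CompactlyContained {S : Type*} [Preorder S] (s t : S) : Prop :=
  ∀ u : ℕ → S, Monotone u → ∀ w, IsLUB (Set.range u) w → t ≤ w → ∃ k, s ≤ u k

/-- A rapidly increasing sequence. -/
def RapidlyIncreasing {S : Type*} [Preorder S] (u : ℕ → S) : Prop :=
  ∀ n, CompactlyContained (u n) (u (n + 1))

/-- Objects of the category `Cu`: ordered abelian monoids in which increasing sequences have suprema,
every element is the supremum of a rapidly increasing sequence, and addition is compatible with
suprema and with compact containment. -/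
structure IsCuSemigroup (S : Type*) [AddCommMonoid S] [PartialOrder S] : Prop where
  add_mono : ∀ s s' t t' : S, s ≤ s' → t ≤ t' → s + t ≤ s' + t'
  exists_sup : ∀ u : ℕ → S, Monotone u → ∃ w, IsLUB (Set.range u) w
  exists_rapid : ∀ s : S, ∃ u : ℕ → S, RapidlyIncreasing u ∧ IsLUB (Set.range u) s
  sup_add : ∀ u w : ℕ → S, Monotone u → Monotone w → ∀ s t, IsLUB (Set.range u) s →
    IsLUB (Set.range w) t → IsLUB (Set.range fun n => u n + w n) (s + t)
  add_compact : ∀ s₁ s₂ t₁ t₂ : S, CompactlyContained s₁ t₁ → CompactlyContained s₂ t₂ →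
    CompactlyContained (s₁ + s₂) (t₁ + t₂)

/-- Morphisms of the category `Cu`: ordered monoid maps preserving suprema of increasing sequences
and compact containment. -/
structure IsCuMorphism {S T : Type*} [AddCommMonoid S] [PartialOrder S] [AddCommMonoid T]
    [PartialOrder T] (φ : S → T) : Prop where
  map_zero : φ 0 = 0
  map_add : ∀ s t, φ (s + t) = φ s + φ t
  mono : Monotone φ
  map_sup : ∀ u : ℕ → S, Monotone u → ∀ s, IsLUB (Set.range u) s →
    IsLUB (Set.range fun n => φ (u n)) (φ s)
  map_compact : ∀ s t, CompactlyContained s t → CompactlyContained (φ s) (φ t)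

/-- Objects of the category `Cu^G`: partially ordered `Cu(G)`-semimodules with the compatibility
conditions between the two orders. -/
structure IsCuGSemimodule (G : Type v) [Group G] [TopologicalSpace G] (S : Type*)
    [AddCommMonoid S] [PartialOrder S] [SMul (CuRep G) S] : Prop where
  one_smul : ∀ x : S, (1 : CuRep G) • x = x
  mul_smul : ∀ (r s : CuRep G) (x : S), (r * s) • x = r • s • x
  add_smul : ∀ (r s : CuRep G) (x : S), (r + s) • x = r • x + s • x
  smul_add : ∀ (r : CuRep G) (x y : S), r • (x + y) = r • x + r • y
  zero_smul : ∀ x : S, (0 : CuRep G) • x = 0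
  smul_zero : ∀ r : CuRep G, r • (0 : S) = 0
  isCu : IsCuSemigroup S
  smul_mono : ∀ (r s : CuRep G) (x y : S), x ≤ y → r ≤ s → r • x ≤ s • y
  smul_compact : ∀ (r s : CuRep G) (x y : S), CompactlyContained x y → CompactlyContained r s →
    CompactlyContained (r • x) (s • y)
  sup_smul : ∀ (x : ℕ → S) (r : ℕ → CuRep G), Monotone x → Monotone r → ∀ x₀ r₀,
    IsLUB (Set.range x) x₀ → IsLUB (Set.range r) r₀ →
      IsLUB (Set.range fun n => r n • x n) (r₀ • x₀)

/-- Morphisms of the category `Cu^G`. -/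
structure IsCuGMorphism (G : Type v) [Group G] [TopologicalSpace G] {S T : Type*}
    [AddCommMonoid S] [PartialOrder S] [SMul (CuRep G) S]
    [AddCommMonoid T] [PartialOrder T] [SMul (CuRep G) T] (φ : S → T) : Prop where
  isCu : IsCuMorphism φ
  map_smul : ∀ (r : CuRep G) (x : S), φ (r • x) = r • φ x

/-- The category `Cu`. -/
structure CuCat : Type (u + 1) where
  carrier : Type u
  [add : AddCommMonoid carrier]
  [order : PartialOrder carrier]
  isCu : IsCuSemigroup carrier

attribute [instance] CuCat.add CuCat.order

instance : CategoryTheory.Category CuCat.{u} where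
  Hom S T := {φ : S.carrier → T.carrier // IsCuMorphism φ}
  id S := ⟨id, ⟨rfl, fun _ _ => rfl, monotone_id, fun _ _ _ h => h, fun _ _ h => h⟩⟩
  comp φ ψ := ⟨ψ.1 ∘ φ.1,
    { map_zero := by simp [φ.2.map_zero, ψ.2.map_zero]
      map_add := fun s t => by simp [φ.2.map_add, ψ.2.map_add]
      mono := ψ.2.mono.comp φ.2.mono
      map_sup := fun u hu s hs => ψ.2.map_sup _ (φ.2.mono.comp hu) _ (φ.2.map_sup u hu s hs)
      map_compact := fun s t h => ψ.2.map_compact _ _ (φ.2.map_compact s t h) }⟩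

/-- The category `Cu^G`. -/
structure CuGCat (G : Type v) [Group G] [TopologicalSpace G] : Type (max (u + 1) v) where
  carrier : Type u
  [add : AddCommMonoid carrier]
  [order : PartialOrder carrier]
  [smul : SMul (CuRep G) carrier]
  isCuG : IsCuGSemimodule G carrier

attribute [instance] CuGCat.add CuGCat.order CuGCat.smul

instance : CategoryTheory.Category (CuGCat.{u} G) where
  Hom S T := {φ : S.carrier → T.carrier // IsCuGMorphism G φ}
  id S := ⟨id, ⟨⟨rfl, fun _ _ => rfl, monotone_id, fun _ _ _ h => h, fun _ _ h => h⟩,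
    fun _ _ => rfl⟩⟩
  comp φ ψ := ⟨ψ.1 ∘ φ.1,
    { isCu :=
        { map_zero := by simp [φ.2.isCu.map_zero, ψ.2.isCu.map_zero]
          map_add := fun s t => by simp [φ.2.isCu.map_add, ψ.2.isCu.map_add]
          mono := ψ.2.isCu.mono.comp φ.2.isCu.mono
          map_sup := fun u hu s hs =>
            ψ.2.isCu.map_sup _ (φ.2.isCu.mono.comp hu) _ (φ.2.isCu.map_sup u hu s hs)
          map_compact := fun s t h => ψ.2.isCu.map_compact _ _ (φ.2.isCu.map_compact s t h) }
      map_smul := fun r x => by simp [φ.2.map_smul, ψ.2.map_smul] }⟩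

/-- The forgetful functor from `Cu^G` to `Cu`. -/
def CuGCat.forget : CategoryTheory.Functor (CuGCat.{u} G) CuCat.{u} where
  obj S := ⟨S.carrier, S.isCuG.isCu⟩
  map φ := ⟨φ.1, φ.2.isCu⟩

end EqCuntz

end

open EqCuntz CategoryTheory

/-!
The order axioms of `Cu` rest on two operations on a positive element `a`. The cut-down
`(a - ε)₊` has a *local unit* `f a f^*` (`PosElt.localUnit_cut`), and a local unit survives
perturbation: if `f a f^*` is a unit for `c` and `d b d^*` is close to `a`, then `c` factors through
`b` (`LocalUnit.exists_factor`). Hence `[c] ≪ [a]` as soon as `a` has a local unit for `c`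
(`CuG.compactlyContained_of_localUnit`), and the cut-downs of `a` form a rapidly increasing sequence
with supremum `[a]`. For suprema, an increasing sequence is replaced by cut-downs `c_n` each of which
factors through the next one; the factorizations give compatible
embeddings of the spaces of the `c_n` into their direct sum (`embed`), where the `c_n` become a sequence increasing up to
constants. A suitable weighted sum of such a sequence is a positive element `C` above all its terms
and a norm limit of elements below them (`PosElt.IsApproxSup`). Such a `C` is a supremum, and this
description is visibly compatible with direct sums, equivariant homomorphisms and tensor products.

For the action, strict positivity of a positive compact operator is reduced to injectivity
(`IsStrictlyPos.injective`, `isStrictlyPos_of_injective`), and a strictly positive invariant operator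
is obtained by averaging over the Haar measure (`nonempty_strictElt`). If `s'` is strictly positive
on `ν'`, every invariant positive compact operator that comes from `ν'` by a bounded intertwiner is a
limit of operators `e s' e^*` with compact intertwiners `e` (`StrictElt.kLe`); the `e` come from an
approximate unit generated by `s'`. Tensoring with a Cuntz comparison `a ≾ b` gives `s ⊗ a ≾ s' ⊗ b`
whenever `ν` is contained in `ν'`. This shows at once that the action is well defined and monotone,
and the algebraic semimodule laws become explicit unitary equivalences between representations.

Suprema in both variables are treated by forming the limit `lam` of an increasing sequence of
representations `ν_n`: the projections `p_n` onto `ν_n` converge strongly to the identity, so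
`p_n s p_n` converges in norm to `s` for the compact operator `s = s_lam`
(`CuG.isLUB_smul`).

Compact containment `rx ≪ ty` needs that `r ≪ [ν]` forces `r` below a finite-dimensional
subrepresentation of `ν`. Eigenspaces of an invariant strictly positive operator show that `ν` has an
increasing sequence of finite-dimensional subrepresentations with dense union, and `[ν]` is its
supremum in `Cu(G)`: if each term embeds into `lam`, the embeddings can be corrected by equivariant
isometries of `lam` so that they converge strongly. The correction is the isometric part of
`t + V W^*` for two embeddings `V`, `W` and small `t > 0`, which is invertible for all but finitely
many `t` (`URep.exists_isometry_comp_near`). On a finite-dimensional subrepresentation an invariant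
strictly positive operator is invertible, so that `s ⊗ b` has a local unit for `p ⊗ (b - ε)₊` with
`p` the projection onto it.
-/

noncomputable section
namespace EqCuntz
open Filter

/-! ### Functional calculus in closed subalgebras of C*-algebras -/

section

section CStar

variable {B : Type*} [NonUnitalCStarAlgebra B]

/-- The element `(a - ε)₊`. -/
def cut (a : B) (ε : ℝ) : B := cfcₙ (fun t : ℝ => max (t - ε) 0) a

theorem cfcₙ_real_mem {S : NonUnitalStarSubalgebra ℂ B} (hS : IsClosed (S : Set B)) (f : ℝ → ℝ)
    {a : B} (ha : a ∈ S) : cfcₙ f a ∈ S :=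
  cfcₙ_mem (hs := hS) f ha

theorem isSelfAdjoint_of_eq_star_mul_self {a : B} (ha : ∃ y, a = star y * y) : IsSelfAdjoint a := by
  obtain ⟨y, rfl⟩ := ha
  exact IsSelfAdjoint.star_mul_self y

theorem quasispectrum_nonneg_of_eq_star_mul_self {a : B} (ha : ∃ y, a = star y * y) {t : ℝ}
    (ht : t ∈ quasispectrum ℝ a) : 0 ≤ t := by
  let _ := CStarAlgebra.spectralOrder B
  have := CStarAlgebra.spectralOrderedRing B
  obtain ⟨y, rfl⟩ := ha
  exact quasispectrum_nonneg_of_nonneg _ (star_mul_self_nonneg y) t ht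

theorem exists_sqrt_mem {S : NonUnitalStarSubalgebra ℂ B} (hS : IsClosed (S : Set B)) {a : B}
    (ha : a ∈ S) (hpos : ∃ y, a = star y * y) : ∃ r ∈ S, star r = r ∧ r * r = a := by
  have hsa := isSelfAdjoint_of_eq_star_mul_self hpos
  refine ⟨cfcₙ Real.sqrt a, cfcₙ_real_mem hS _ ha, (cfcₙ_predicate Real.sqrt a).star_eq, ?_⟩
  rw [← cfcₙ_mul Real.sqrt Real.sqrt a (by fun_prop) (by simp) (by fun_prop) (by simp)]
  conv_rhs => rw [← cfcₙ_id' ℝ a]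
  exact cfcₙ_congr fun t ht =>
    Real.mul_self_sqrt (quasispectrum_nonneg_of_eq_star_mul_self hpos ht)

theorem cut_mem {S : NonUnitalStarSubalgebra ℂ B} (hS : IsClosed (S : Set B)) {a : B}
    (ha : a ∈ S) (ε : ℝ) : cut a ε ∈ S :=
  cfcₙ_real_mem hS _ ha

theorem cut_eq_star_mul_self (a : B) {ε : ℝ} (hε : 0 ≤ ε) : ∃ y, cut a ε = star y * y := by
  refine ⟨cfcₙ (fun t : ℝ => √(max (t - ε) 0)) a, ?_⟩
  have h0 : √(max (0 - ε) 0) = 0 := by rw [max_eq_right (by linarith), Real.sqrt_zero]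
  rw [(cfcₙ_predicate (fun t : ℝ => √(max (t - ε) 0)) a).star_eq,
    ← cfcₙ_mul _ _ a (by fun_prop) h0 (by fun_prop) h0]
  exact cfcₙ_congr fun t _ => (Real.mul_self_sqrt (le_max_right _ _)).symm

theorem norm_cut_sub_le {a : B} (ha : ∃ y, a = star y * y) {ε : ℝ} (hε : 0 ≤ ε) :
    ‖cut a ε - a‖ ≤ ε := by
  have hsa := isSelfAdjoint_of_eq_star_mul_self ha
  have h0 : max (0 - ε) 0 = 0 := max_eq_right (by linarith)
  have e : cut a ε - a = cfcₙ (fun t : ℝ => max (t - ε) 0 - t) a := by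
    rw [cfcₙ_sub (fun t : ℝ => max (t - ε) 0) _ a (by fun_prop) h0 (by fun_prop) rfl, cfcₙ_id' ℝ a]
    rfl
  rw [e]
  refine norm_cfcₙ_le fun t ht => ?_
  have := quasispectrum_nonneg_of_eq_star_mul_self ha ht
  rw [Real.norm_eq_abs, abs_le]
  rcases le_total t ε with h | h
  · rw [max_eq_right (by linarith)]; constructor <;> linarith
  · rw [max_eq_left (by linarith)]; constructor <;> linarith

theorem cut_cut {a : B} (ha : IsSelfAdjoint a) {δ ε : ℝ} (hδ : 0 ≤ δ) (hε : 0 ≤ ε) :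
    cut (cut a δ) ε = cut a (δ + ε) := by
  have h0 : max (0 - δ) 0 = 0 := max_eq_right (by linarith)
  have h1 : max (0 - ε) 0 = 0 := max_eq_right (by linarith)
  rw [cut, cut, ← cfcₙ_comp (fun t : ℝ => max (t - ε) 0) (fun t : ℝ => max (t - δ) 0) a
    (by fun_prop) h1 (by fun_prop) h0 ha]
  refine cfcₙ_congr fun t _ => ?_
  simp only [Function.comp]
  rcases le_total (t - δ) 0 with h | h
  · rw [max_eq_right h, max_eq_right (by linarith), max_eq_right (by linarith)]
  · rw [max_eq_left h, sub_sub]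

/-- A continuous function of `a` vanishing at `0` that is inverse to `√a` on the support of
`(a - ε)₊`. -/
theorem exists_local_unit_cut {S : NonUnitalStarSubalgebra ℂ B} (hS : IsClosed (S : Set B)) {a : B}
    (ha : a ∈ S) (hsa : IsSelfAdjoint a) {ε : ℝ} (hε : 0 < ε) :
    ∃ f ∈ S, f * a * star f * cut a ε = cut a ε := by
  set F : ℝ → ℝ := fun t => t / (max t ε * √(max t ε)) with hF
  have hm : ∀ t, 0 < max t ε := fun t => lt_max_of_lt_right hε
  have hFc : Continuous F := by
    refine continuous_id.div (by fun_prop) fun t => ?_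
    have := hm t
    positivity
  have hF0 : F 0 = 0 := by simp [hF]
  have h0 : max (0 - ε) 0 = 0 := max_eq_right (by linarith)
  refine ⟨cfcₙ F a, cfcₙ_real_mem hS F ha, ?_⟩
  have e : cfcₙ F a * a * star (cfcₙ F a) = cfcₙ (fun t => F t * t * F t) a := by
    rw [(cfcₙ_predicate F a).star_eq, cfcₙ_mul _ _ a (by fun_prop) (by simp) (by fun_prop) hF0,
      cfcₙ_mul _ _ a (by fun_prop) hF0 (by fun_prop) rfl, cfcₙ_id' ℝ a]
  rw [e, cut, ← cfcₙ_mul _ (fun t : ℝ => max (t - ε) 0) a (by fun_prop) (by simp) (by fun_prop) h0]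
  refine cfcₙ_congr fun t _ => ?_
  rcases le_total t ε with h | h
  · simp only [max_eq_right (sub_nonpos.2 h), mul_zero]
  · have ht : 0 < t := hε.trans_le h
    have hs : √t * √t = t := Real.mul_self_sqrt ht.le
    have hs0 : √t ≠ 0 := (Real.sqrt_pos.2 ht).ne'
    have : F t * t * F t = 1 := by
      simp only [hF, max_eq_left h]
      field_simp
      rw [sq, hs]
    simp only [this, one_mul]

/-- A selfadjoint element of norm at most `1/2` is quasi-invertible, with the quasi-inverse in any
closed subalgebra that contains it. -/
theorem exists_quasiInverse_mem {S : NonUnitalStarSubalgebra ℂ B} (hS : IsClosed (S : Set B)) {k : B}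
    (hk : k ∈ S) (hsa : IsSelfAdjoint k) (hn : ‖k‖ ≤ 1 / 2) : ∃ j ∈ S, j + k + j * k = 0 := by
  set F : ℝ → ℝ := fun t => -t / (1 + t) with hF
  have hle : ∀ t ∈ quasispectrum ℝ k, 0 < 1 + t := by
    intro t ht
    have h1 : ‖t‖ ≤ ‖k‖ := NonUnitalIsometricContinuousFunctionalCalculus.norm_quasispectrum_le
      (𝕜 := ℝ) k ht hsa
    have := abs_le.1 (h1.trans hn)
    linarith [this.1]
  have hFc : ContinuousOn F (quasispectrum ℝ k) :=
    (by fun_prop : ContinuousOn (fun t : ℝ => -t) _).div (by fun_prop) fun t ht => (hle t ht).ne'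
  have hF0 : F 0 = 0 := by simp [hF]
  refine ⟨cfcₙ F k, cfcₙ_real_mem hS F hk, ?_⟩
  have e : cfcₙ F k + k + cfcₙ F k * k = cfcₙ (fun t => F t + t + F t * t) k := by
    have hFid : ContinuousOn (fun t => F t * t) (quasispectrum ℝ k) := hFc.mul continuousOn_id
    have hFa : ContinuousOn (fun t => F t + t) (quasispectrum ℝ k) := hFc.add continuousOn_id
    rw [cfcₙ_add _ _ k hFa (by simp [hF0]) hFid (by simp),
      cfcₙ_add _ _ k hFc hF0 (by fun_prop) rfl, cfcₙ_mul _ _ k hFc hF0 (by fun_prop) rfl,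
      cfcₙ_id' ℝ k]
  rw [e, ← cfcₙ_const_zero ℝ k]
  refine cfcₙ_congr fun t ht => ?_
  have := (hle t ht).ne'
  simp only [hF]
  field_simp
  ring

/-- Approximate units generated by a positive element `b`: the elements `p = b (b + η)⁻¹`, written
as `p² = f b f^*` with `f = b^{1/2} (b + η)⁻¹`. -/
theorem exists_approxUnit_mem {S : NonUnitalStarSubalgebra ℂ B} (hS : IsClosed (S : Set B)) {b : B}
    (hb : b ∈ S) (hbpos : ∃ y, b = star y * y) {η : ℝ} (hη : 0 < η) :
    ∃ p ∈ S, ∃ f ∈ S, star p = p ∧ ‖p‖ ≤ 1 ∧ f * b * star f = p * p ∧ ‖b * p - b‖ ≤ η ∧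
      ‖p * b * p - p * b - b * p + b‖ ≤ η ∧ ∃ y, ((η⁻¹ : ℝ) : ℂ) • b - p * p = star y * y := by
  have hbsa := isSelfAdjoint_of_eq_star_mul_self hbpos
  have hnn : ∀ t ∈ quasispectrum ℝ b, 0 ≤ t := fun t =>
    quasispectrum_nonneg_of_eq_star_mul_self hbpos
  set P : ℝ → ℝ := fun t => t / (|t| + η) with hP
  set F : ℝ → ℝ := fun t => √t / (|t| + η) with hF
  have hne : ∀ t : ℝ, |t| + η ≠ 0 := fun t => by positivity
  have hPc : Continuous P := continuous_id.div (by fun_prop) hne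
  have hFc : Continuous F := Real.continuous_sqrt.div (by fun_prop) hne
  have hP0 : P 0 = 0 := by simp [hP]
  have hF0 : F 0 = 0 := by simp [hF]
  have c1 : Continuous fun t => P t * t := by fun_prop
  have c2 : Continuous fun t => P t * t * P t := by fun_prop
  have c3 : Continuous fun t => t * P t := by fun_prop
  have c4 : Continuous fun t => F t * t := by fun_prop
  have hP1 : ∀ t, 0 ≤ t → P t = t / (t + η) := fun t ht => by simp only [hP, abs_of_nonneg ht]
  refine ⟨cfcₙ P b, cfcₙ_real_mem hS P hb, cfcₙ F b, cfcₙ_real_mem hS F hb,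
    (cfcₙ_predicate P b).star_eq, norm_cfcₙ_le fun t ht => ?_, ?_, ?_, ?_, ?_⟩
  · have := hnn t ht
    rw [hP1 t this, Real.norm_of_nonneg (by positivity), div_le_one (by positivity)]
    linarith
  · rw [(cfcₙ_predicate F b).star_eq, ← cfcₙ_mul P P b (by fun_prop) hP0 (by fun_prop) hP0]
    conv_lhs => enter [1, 2]; rw [← cfcₙ_id' ℝ b]
    rw [← cfcₙ_mul F _ b (by fun_prop) hF0 (by fun_prop) rfl,
      ← cfcₙ_mul _ F b (by fun_prop) (by simp) (by fun_prop) hF0]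
    refine cfcₙ_congr fun t ht => ?_
    have h1 : √t * √t = t := Real.mul_self_sqrt (hnn t ht)
    simp only [hP, hF]
    have := hne t
    field_simp
    rw [sq, h1, sq]
  · have e : b * cfcₙ P b - b = cfcₙ (fun t => t * P t - t) b := by
      rw [cfcₙ_sub _ _ b (by fun_prop) (by simp) (by fun_prop) rfl,
        cfcₙ_mul _ _ b (by fun_prop) rfl (by fun_prop) hP0, cfcₙ_id' ℝ b]
    rw [e]
    refine norm_cfcₙ_le fun t ht => ?_
    have h0 := hnn t ht
    have e2 : t * P t - t = -(η * (t / (t + η))) := by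
      rw [hP1 t h0]
      have : t + η ≠ 0 := by positivity
      field_simp
      ring
    have h1 : t / (t + η) ≤ 1 := (div_le_one (by positivity)).2 (by linarith)
    have h2 : 0 ≤ t / (t + η) := by positivity
    rw [e2, norm_neg, Real.norm_of_nonneg (by positivity)]
    nlinarith
  · have e : cfcₙ P b * b * cfcₙ P b - cfcₙ P b * b - b * cfcₙ P b + b
        = cfcₙ (fun t => P t * t * P t - P t * t - t * P t + t) b := by
      rw [cfcₙ_add _ _ b (by fun_prop) (by simp [hP0]) (by fun_prop) rfl,
        cfcₙ_sub _ _ b (by fun_prop) (by simp [hP0]) (by fun_prop) (by simp),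
        cfcₙ_sub _ _ b (by fun_prop) (by simp) (by fun_prop) (by simp),
        cfcₙ_mul _ _ b (by fun_prop) (by simp) (by fun_prop) hP0,
        cfcₙ_mul _ _ b (by fun_prop) hP0 (by fun_prop) rfl,
        cfcₙ_mul _ _ b (by fun_prop) rfl (by fun_prop) hP0, cfcₙ_id' ℝ b]
    rw [e]
    refine norm_cfcₙ_le fun t ht => ?_
    have h0 := hnn t ht
    have e2 : P t * t * P t - P t * t - t * P t + t = t * (η / (t + η)) ^ 2 := by
      rw [hP1 t h0]
      have : t + η ≠ 0 := by positivity
      field_simp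
      ring
    rw [e2, Real.norm_of_nonneg (by positivity), div_pow, mul_div_assoc', div_le_iff₀ (by positivity)]
    nlinarith [mul_nonneg hη.le (sq_nonneg t), mul_nonneg h0 (mul_nonneg hη.le hη.le), pow_pos hη 3]
  · set Q : ℝ → ℝ := fun t => √(η⁻¹ * t - P t * P t) with hQ
    have hQc : Continuous Q := by fun_prop
    have hQ0 : Q 0 = 0 := by simp [hQ, hP0]
    refine ⟨cfcₙ Q b, ?_⟩
    rw [(cfcₙ_predicate Q b).star_eq, ← cfcₙ_mul Q Q b (by fun_prop) hQ0 (by fun_prop) hQ0,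
      ← cfcₙ_mul P P b (by fun_prop) hP0 (by fun_prop) hP0]
    have e : ((η⁻¹ : ℝ) : ℂ) • b = cfcₙ (fun t : ℝ => η⁻¹ * t) b := by
      rw [cfcₙ_const_mul_id η⁻¹ b]
      exact Complex.coe_smul _ _
    rw [e, ← cfcₙ_sub (fun t : ℝ => η⁻¹ * t) (fun t => P t * P t) b (by fun_prop) (by simp)
      (by fun_prop) (by simp [hP0])]
    refine cfcₙ_congr fun t ht => (Real.mul_self_sqrt ?_).symm
    have h0 := hnn t ht
    rw [hP1 t h0, sub_nonneg]
    have h1 : t / (t + η) ≤ 1 := (div_le_one (by positivity)).2 (by linarith)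
    have h2 : 0 ≤ t / (t + η) := by positivity
    have h3 : t / (t + η) ≤ η⁻¹ * t := by
      rw [inv_mul_eq_div]
      gcongr
      linarith
    nlinarith

/-- If `f b f^* = p²` and `p` is almost a unit for `r`, then conjugating `b` by `r f` gives almost
`r²`. -/
theorem norm_conj_approxUnit_sub_le {b p f r : B} (hp : star p = p) (hpn : ‖p‖ ≤ 1)
    (hf : f * b * star f = p * p) (hr : star r = r) :
    ‖r * f * b * star (r * f) - r * r‖ ≤ 2 * ‖r‖ * ‖r * p - r‖ := by
  have e : r * f * b * star (r * f) - r * r = (r * p - r) * (p * r) + r * star (r * p - r) := by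
    rw [star_sub, star_mul, star_mul, hr, hp]
    calc _ = r * (f * b * star f) * r - r * r := by simp only [mul_assoc]
      _ = _ := by
        rw [hf]
        simp only [sub_mul, mul_sub, mul_assoc]
        abel
  rw [e]
  calc _ ≤ ‖r * p - r‖ * (‖p‖ * ‖r‖) + ‖r‖ * ‖star (r * p - r)‖ := by
        refine (norm_add_le _ _).trans (add_le_add ((norm_mul_le _ _).trans ?_) (norm_mul_le _ _))
        gcongr
        exact norm_mul_le _ _
    _ ≤ ‖r * p - r‖ * (1 * ‖r‖) + ‖r‖ * ‖r * p - r‖ := by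
        rw [norm_star]; gcongr
    _ = _ := by ring

/-- If `a ≤ C b` then `a` is a limit of elements `d b d^*`: with `p = b (b + η)⁻¹` one has
`‖a^{1/2} (1 - p)‖² ≤ C ‖(1 - p) b (1 - p)‖ ≤ C η`. -/
theorem exists_conj_approx_of_le {S : NonUnitalStarSubalgebra ℂ B} (hS : IsClosed (S : Set B))
    {a b : B} (ha : a ∈ S) (hb : b ∈ S) (hapos : ∃ y, a = star y * y)
    (hbpos : ∃ y, b = star y * y) {C : ℝ} (hC : 0 ≤ C)
    (hab : ∃ y, (C : ℂ) • b - a = star y * y) {ε : ℝ} (hε : 0 < ε) :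
    ∃ d ∈ S, ‖d * b * star d - a‖ < ε := by
  let _ := CStarAlgebra.spectralOrder B
  have := CStarAlgebra.spectralOrderedRing B
  obtain ⟨r, hr, hrs, hra⟩ := exists_sqrt_mem hS ha hapos
  obtain ⟨z, hz⟩ := hbpos
  obtain ⟨y, hy⟩ := hab
  -- `η` is chosen so that `2 ‖r‖ √(C η) < ε`.
  obtain ⟨η, hη, hηε⟩ : ∃ η : ℝ, 0 < η ∧ 2 * ‖r‖ * √(C * η) < ε := by
    refine ⟨(ε / (2 * ‖r‖ + 1)) ^ 2 / (C + 1), by positivity, ?_⟩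
    have h1 : √(C * ((ε / (2 * ‖r‖ + 1)) ^ 2 / (C + 1))) ≤ ε / (2 * ‖r‖ + 1) := by
      refine Real.sqrt_le_iff.2 ⟨by positivity, ?_⟩
      rw [mul_div_assoc', div_le_iff₀ (by positivity)]
      have : 0 ≤ (ε / (2 * ‖r‖ + 1)) ^ 2 := by positivity
      nlinarith
    calc _ ≤ 2 * ‖r‖ * (ε / (2 * ‖r‖ + 1)) := by gcongr
      _ < ε := by
        rw [mul_div_assoc', div_lt_iff₀ (by positivity)]
        nlinarith [norm_nonneg r]
  obtain ⟨p, -, f, hf, hps, hpn, hfp, -, hpb, -⟩ := exists_approxUnit_mem hS hb ⟨z, hz⟩ hη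
  have hexp : ∀ w : B, star (w * p - w) * (w * p - w)
      = p * (star w * w) * p - p * (star w * w) - (star w * w) * p + star w * w := by
    intro w
    rw [star_sub, star_mul, hps]
    simp only [sub_mul, mul_sub, mul_assoc]
    abel
  have hkey : ‖r * p - r‖ ≤ √(C * η) := by
    refine Real.le_sqrt_of_sq_le ?_
    have hle : star (r * p - r) * (r * p - r) ≤ (C : ℂ) • (star (z * p - z) * (z * p - z)) := by
      rw [← sub_nonneg]
      have : (C : ℂ) • (star (z * p - z) * (z * p - z)) - star (r * p - r) * (r * p - r)
          = star (y * p - y) * (y * p - y) := by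
        rw [hexp, hexp, hexp, hrs, ← hz, hra, ← hy]
        simp only [smul_add, smul_sub, mul_sub, sub_mul, mul_smul_comm, smul_mul_assoc]
        abel
      rw [this]
      exact star_mul_self_nonneg _
    have h1 := CStarAlgebra.norm_le_norm_of_nonneg_of_le (star_mul_self_nonneg _) hle
    rw [CStarRing.norm_star_mul_self, norm_smul, Complex.norm_real, Real.norm_of_nonneg hC, hexp,
      ← hz] at h1
    rw [sq]
    exact h1.trans (mul_le_mul_of_nonneg_left hpb hC)
  refine ⟨r * f, mul_mem hr hf, ?_⟩
  rw [← hra]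
  exact (norm_conj_approxUnit_sub_le hps hpn hfp hrs).trans_lt
    (lt_of_le_of_lt (by gcongr) hηε)

end CStar

end

open ContinuousLinearMap (adjoint adjoint_comp adjoint_adjoint adjoint_id)
open OpFam URep

/-! ### Positivity of families of operators -/

section

namespace OpFam

-- Shortcut instances: instance search through the `lp` space is slow.

instance {A : Type u} [NonUnitalCStarAlgebra A] (H K : Type) [NormedAddCommGroup H]
    [InnerProductSpace ℂ H] [NormedAddCommGroup K] [InnerProductSpace ℂ K] :
    AddCommGroup (OpFam A H K) := inferInstance

instance {A : Type u} [NonUnitalCStarAlgebra A] (H K : Type) [NormedAddCommGroup H]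
    [InnerProductSpace ℂ H] [NormedAddCommGroup K] [InnerProductSpace ℂ K] :
    AddZeroClass (OpFam A H K) := inferInstance

instance {A : Type u} [NonUnitalCStarAlgebra A] (H K : Type) [NormedAddCommGroup H]
    [InnerProductSpace ℂ H] [NormedAddCommGroup K] [InnerProductSpace ℂ K] : SMul ℂ (OpFam A H K) :=
  Module.toDistribMulAction.toSMul

theorem comp_smul {A : Type u} [NonUnitalCStarAlgebra A] {H₁ H₂ H₃ : Type}
    [NormedAddCommGroup H₁] [InnerProductSpace ℂ H₁] [NormedAddCommGroup H₂]
    [InnerProductSpace ℂ H₂] [NormedAddCommGroup H₃] [InnerProductSpace ℂ H₃]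
    (c : ℂ) (x : OpFam A H₂ H₃) (y : OpFam A H₁ H₂) : comp x (c • y) = c • comp x y :=
  OpFam.ext fun r => by ext z; simp

theorem smul_comp {A : Type u} [NonUnitalCStarAlgebra A] {H₁ H₂ H₃ : Type}
    [NormedAddCommGroup H₁] [InnerProductSpace ℂ H₁] [NormedAddCommGroup H₂]
    [InnerProductSpace ℂ H₂] [NormedAddCommGroup H₃] [InnerProductSpace ℂ H₃]
    (c : ℂ) (x : OpFam A H₂ H₃) (y : OpFam A H₁ H₂) : comp (c • x) y = c • comp x y :=
  OpFam.ext fun r => by ext z; simp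

section Pos

variable {A : Type u} [NonUnitalCStarAlgebra A] {H K : Type}
  [NormedAddCommGroup H] [InnerProductSpace ℂ H]
  [NormedAddCommGroup K] [InnerProductSpace ℂ K]

/-- Positivity of a family of operators, checked in each representation. -/
def Pos (x : OpFam A H H) : Prop := ∀ r, (x r).IsPositive

theorem Pos.add {x y : OpFam A H H} (hx : Pos x) (hy : Pos y) : Pos (x + y) :=
  fun r => (hx r).add (hy r)

theorem Pos.smul {x : OpFam A H H} (hx : Pos x) {c : ℝ} (hc : 0 ≤ c) : Pos ((c : ℂ) • x) :=
  fun r => (hx r).smul_of_nonneg (by exact_mod_cast hc)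

theorem Pos.zero : Pos (0 : OpFam A H H) := fun _ => ContinuousLinearMap.isPositive_zero

theorem isClosed_pos : IsClosed {x : OpFam A H H | Pos x} := by
  have h : {x : OpFam A H H | Pos x} = ⋂ r, {x : OpFam A H H | (x r).IsPositive} := by
    ext x; simp [Pos]
  rw [h]
  refine isClosed_iInter fun r => ?_
  have hc : Continuous fun x : OpFam A H H => x r :=
    continuous_of_sub_bound (fun x y => rfl) 1 fun x => by simpa using norm_coord_le x r
  have h2 : IsClosed {T : HTensor H r.L →L[ℂ] HTensor H r.L | 0 ≤ T} := isClosed_Ici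
  have h3 : {x : OpFam A H H | (x r).IsPositive} = (fun x : OpFam A H H => x r) ⁻¹' {T | 0 ≤ T} := by
    ext x
    exact (ContinuousLinearMap.nonneg_iff_isPositive _).symm
  rw [h3]
  exact h2.preimage hc

theorem Pos.exists_eq_star_mul_self {x : OpFam A H H} (hx : Pos x) :
    ∃ y : OpFam A H H, x = star y * y := by
  choose R hR using fun r => exists_adjoint_comp (hx r)
  refine ⟨OpFam.of R (‖x‖ + 1) fun r => ?_, OpFam.ext fun r => hR r⟩
  have h1 : ‖R r‖ * ‖R r‖ = ‖x r‖ := by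
    rw [hR r]
    exact (ContinuousLinearMap.norm_adjoint_comp_self (R r)).symm
  have h2 := norm_coord_le x r
  nlinarith [norm_nonneg (R r), norm_nonneg x]

theorem pos_of_eq_star_mul_self {x : OpFam A H H} (hx : ∃ y, x = star y * y) : Pos x := by
  obtain ⟨y, rfl⟩ := hx
  exact fun r => ContinuousLinearMap.isPositive_adjoint_comp_self (y r)

theorem Pos.norm_smul_id_sub {x : OpFam A H H} (hx : Pos x) :
    Pos ((‖x‖ : ℂ) • mult (.id ℂ H) - x) := fun r => by
  have h1 : x r ≤ algebraMap ℝ _ ‖x r‖ := IsSelfAdjoint.le_algebraMap_norm_self (hx r).isSelfAdjoint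
  have h2 : (algebraMap ℝ (HTensor H r.L →L[ℂ] HTensor H r.L)) ‖x r‖ ≤ algebraMap ℝ _ ‖x‖ :=
    algebraMap_mono _ (norm_coord_le x r)
  have h3 := h1.trans h2
  rw [ContinuousLinearMap.le_def] at h3
  convert h3 using 1
  rw [sub_coord, smul_coord, mult_coord, htmap_id, Algebra.algebraMap_eq_smul_one,
    ← Complex.coe_smul]
  rfl

variable [CompleteSpace H] [CompleteSpace K]

theorem Pos.conj {x : OpFam A H H} (hx : Pos x) (d : OpFam A H K) :
    Pos (comp (comp d x) (adj d)) := fun r => by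
  simpa only [comp_coord, adj_coord, ContinuousLinearMap.comp_assoc] using (hx r).conj_adjoint (d r)

theorem pos_comp_adj (d : OpFam A H K) : Pos (comp d (adj d)) := fun r => by
  have h := (ContinuousLinearMap.isPositive_one (E := HTensor H r.L) (𝕜 := ℂ)).conj_adjoint (d r)
  exact h

theorem Pos.adj_eq {x : OpFam A H H} (hx : Pos x) : adj x = x :=
  OpFam.ext fun r => (hx r).isSelfAdjoint

/-- `d m d^* ≤ ‖m‖ d d^*` for positive `m`. -/
theorem Pos.norm_smul_comp_adj_sub {x : OpFam A H H} (hx : Pos x) (d : OpFam A H K) :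
    Pos ((‖x‖ : ℂ) • comp d (adj d) - comp (comp d x) (adj d)) := by
  have h := hx.norm_smul_id_sub.conj d
  rwa [comp_sub, sub_comp, comp_smul, comp_mult_id, smul_comp] at h

end Pos

variable {G : Type v} [Group G] [TopologicalSpace G] {X : GCStar.{u} G} {μ ν lam : URep G}

theorem invK_smul (c : ℂ) {x : OpFam X.carrier μ.H ν.H} (hx : x ∈ invK X μ ν) :
    c • x ∈ invK X μ ν :=
  ⟨Submodule.smul_mem _ c hx.1, fun g => by rw [act_smul, hx.2]⟩

theorem invK_sub {x y : OpFam X.carrier μ.H ν.H} (hx : x ∈ invK X μ ν) (hy : y ∈ invK X μ ν) :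
    x - y ∈ invK X μ ν :=
  ⟨sub_mem hx.1 hy.1, fun g => by rw [act_sub, hx.2, hy.2]⟩

end OpFam

variable {G : Type v} [Group G] [TopologicalSpace G] {X Y : GCStar.{u} G}

/-! ### Local units and Cuntz subequivalence -/

namespace PosElt

theorem pos_val (a : PosElt X) : Pos a.val := a.pos

/-- The set of elements below `t` is closed. -/
theorem le_of_forall_norm_sub_lt {a t : PosElt X}
    (h : ∀ ε : ℝ, 0 < ε → ∃ (x : OpFam X.carrier a.rep.H a.rep.H) (hx : x ∈ invK X a.rep a.rep)
      (hp : Pos x), ‖x - a.val‖ < ε ∧ (⟨a.rep, x, hx, hp⟩ : PosElt X) ≤ t) : a ≤ t := by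
  refine subeq_iff.2 fun ε hε => ?_
  obtain ⟨x, hx, hp, hn, hle⟩ := h (ε / 2) (half_pos hε)
  obtain ⟨d, hd, hdn⟩ := subeq_iff.1 hle (ε / 2) (half_pos hε)
  refine ⟨d, hd, ?_⟩
  have e : comp (comp d t.val) (adj d) - a.val
      = (comp (comp d t.val) (adj d) - x) + (x - a.val) := by abel
  rw [e]
  exact (norm_add_le _ _).trans_lt (by linarith)

/-- `x ≤ C y` implies `x ≾ y`. -/
theorem le_of_pos_smul_sub {μ : URep G} {x y : OpFam X.carrier μ.H μ.H} (hx : x ∈ invK X μ μ)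
    (hxp : Pos x) (hy : y ∈ invK X μ μ) (hyp : Pos y) {C : ℝ} (hC : 0 ≤ C)
    (h : Pos ((C : ℂ) • y - x)) : (⟨μ, x, hx, hxp⟩ : PosElt X) ≤ ⟨μ, y, hy, hyp⟩ :=
  subeq_iff.2 fun _ hε => exists_conj_approx_of_le (S := invAlg X μ) isClosed_invAlg hx hy
    hxp.exists_eq_star_mul_self hyp.exists_eq_star_mul_self hC h.exists_eq_star_mul_self hε

/-- `d b d^* ≾ b` for invariant `d` with coefficients in the compact operators. -/
theorem conj_elt_le {μ ν : URep G} {y : OpFam X.carrier ν.H ν.H} (hy : y ∈ invK X ν ν)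
    (hyp : Pos y) {d : OpFam X.carrier ν.H μ.H} (hd : d ∈ invK X ν μ) :
    (⟨μ, comp (comp d y) (adj d), invK_comp (invK_comp hd hy) (invK_adj hd), hyp.conj d⟩ : PosElt X)
      ≤ ⟨ν, y, hy, hyp⟩ :=
  subeq_iff.2 fun _ hε => ⟨d, hd, by simpa using hε⟩

end PosElt

namespace OpFam

variable {μ ν : URep G}

/-- The element `c` has a local unit of the form `f a f^*`. This is the algebraic form of compact
containment `[c] ≪ [a]`. -/
def LocalUnit (X : GCStar.{u} G) (μ : URep G) (a c : OpFam X.carrier μ.H μ.H) : Prop :=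
  ∃ f ∈ invK X μ μ, comp (comp (comp f a) (adj f)) c = c

theorem exists_sqrt {a : OpFam X.carrier μ.H μ.H} (ha : a ∈ invK X μ μ) (hp : Pos a) :
    ∃ r ∈ invK X μ μ, adj r = r ∧ comp r r = a :=
  exists_sqrt_mem (S := invAlg X μ) isClosed_invAlg ha hp.exists_eq_star_mul_self

/-- The perturbation argument behind compact containment: if `f a f^*` is a unit for `c`, then
every `d b d^*` close to `a` still yields a factorization of `c` through `b`. -/
theorem LocalUnit.exists_factor {a c : OpFam X.carrier μ.H μ.H}
    (ha : a ∈ invK X μ μ) (hap : Pos a) (h : LocalUnit X μ a c) :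
    ∃ η : ℝ, 0 < η ∧ ∀ (ν : URep G) (b s : OpFam X.carrier ν.H ν.H) (d : OpFam X.carrier ν.H μ.H),
      s ∈ invK X ν ν → adj s = s → comp s s = b → d ∈ invK X ν μ →
      ‖comp (comp d b) (adj d) - a‖ ≤ η →
      ∃ x ∈ invK X ν μ, ∃ w ∈ invK X ν μ, c = comp x (comp (adj (comp w s)) c) := by
  obtain ⟨f, hf, hfc⟩ := h
  have hfn : ‖f‖ * (1 / (2 * (‖f‖ * ‖f‖ + 1))) * ‖f‖ ≤ 1 / 2 := by
    rw [mul_one_div, div_mul_eq_mul_div, div_le_div_iff₀ (by positivity) (by positivity)]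
    linarith
  refine ⟨1 / (2 * (‖f‖ * ‖f‖ + 1)), by positivity, fun ν b s d hs hss hsb hd hn => ?_⟩
  have hw : comp f d ∈ invK X ν μ := invK_comp hf hd
  set z := comp (comp f d) s with hz
  have hzm : z ∈ invK X ν μ := invK_comp hw hs
  set p := comp (comp f a) (adj f) with hp
  have hq : comp z (adj z) = comp (comp f (comp (comp d b) (adj d))) (adj f) := by
    rw [hz, adj_comp, adj_comp, hss, ← hsb]
    simp only [comp_assoc]
  have hpm : p ∈ invK X μ μ := invK_comp (invK_comp hf ha) (invK_adj hf)
  have hk : comp z (adj z) - p ∈ invK X μ μ := invK_sub (invK_comp hzm (invK_adj hzm)) hpm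
  have hksa : IsSelfAdjoint (comp z (adj z) - p) :=
    IsSelfAdjoint.sub (pos_comp_adj z).adj_eq (hap.conj f).adj_eq
  have hkn : ‖comp z (adj z) - p‖ ≤ 1 / 2 := by
    rw [hq, hp, ← sub_comp, ← comp_sub]
    refine (PosElt.norm_conj_le _ _).trans ?_
    calc _ ≤ ‖f‖ * (1 / (2 * (‖f‖ * ‖f‖ + 1))) * ‖f‖ := by gcongr
      _ ≤ 1 / 2 := hfn
  obtain ⟨j, hj, hjk⟩ := exists_quasiInverse_mem (S := invAlg X μ) isClosed_invAlg hk hksa hkn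
  -- `(1 + j) (1 + k) = 1` and `(1 + k) c = z z^* c`, because `p c = c`
  have hjk' : j + (comp z (adj z) - p) + comp j (comp z (adj z) - p) = 0 := hjk
  refine ⟨z + comp j z, invK_add hzm (invK_comp hj hzm), comp f d, hw, ?_⟩
  have h1 := congrArg (fun t => comp t c) hjk'
  simp only [add_comp, comp_sub, sub_comp, comp_assoc, zero_comp] at h1
  have h2 : comp p c = c := hfc
  rw [h2] at h1
  rw [← hz, add_comp]
  simp only [comp_assoc]
  have h3 : comp z (comp (adj z) c) + comp j (comp z (comp (adj z) c)) - c = 0 := by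
    rw [← h1]; abel
  exact (sub_eq_zero.1 h3).symm

/-- Compact containment in its quantitative form: `c ≾ b` for all `b` that come close to
dominating `a`. -/
theorem LocalUnit.exists_le {a c : OpFam X.carrier μ.H μ.H}
    (ha : a ∈ invK X μ μ) (hap : Pos a) (hc : c ∈ invK X μ μ) (hcp : Pos c)
    (h : LocalUnit X μ a c) :
    ∃ η : ℝ, 0 < η ∧ ∀ (b : PosElt X) (d : OpFam X.carrier b.rep.H μ.H), d ∈ invK X b.rep μ →
      ‖comp (comp d b.val) (adj d) - a‖ ≤ η → (⟨μ, c, hc, hcp⟩ : PosElt X) ≤ b := by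
  obtain ⟨η, hη, H⟩ := h.exists_factor ha hap
  refine ⟨η, hη, fun b d hd hn => ?_⟩
  obtain ⟨s, hs, hss, hsb⟩ := exists_sqrt b.mem b.pos
  obtain ⟨x, hx, w, hw, hxw⟩ := H b.rep b.val s d hs hss hsb hd hn
  have hm : Pos (comp (comp (adj w) c) w) := by
    have := hcp.conj (adj w)
    rwa [adj_adj] at this
  -- `c = x w'^* c = x w'^* c w' x^*` with `w' = w s`
  have e : c = comp (comp (comp x s) (comp (comp (adj w) c) w)) (adj (comp x s)) := by
    have h1 : c = comp c (comp (comp w s) (adj x)) := by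
      have := congrArg adj hxw
      rw [adj_comp, adj_comp, hcp.adj_eq, adj_adj] at this
      simpa only [comp_assoc] using this
    conv_lhs => rw [hxw, h1]
    simp only [adj_comp, hss, comp_assoc]
  have hxs : comp x s ∈ invK X b.rep μ := invK_comp hx hs
  have hb : comp (comp x s) (adj (comp x s)) = comp (comp x b.val) (adj x) := by
    rw [adj_comp, hss, ← hsb]; simp only [comp_assoc]
  have h2 := hm.norm_smul_comp_adj_sub (comp x s)
  rw [← e, hb] at h2
  exact (PosElt.le_of_pos_smul_sub hc hcp _ _ (norm_nonneg _) h2).trans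
    (PosElt.conj_elt_le b.mem b.pos hx)

end OpFam

namespace PosElt

/-- The positive element `(a - ε)₊`. -/
def cut (a : PosElt X) {ε : ℝ} (hε : 0 ≤ ε) : PosElt X where
  rep := a.rep
  val := EqCuntz.cut a.val ε
  mem := cut_mem (S := invAlg X a.rep) isClosed_invAlg a.mem ε
  pos := pos_of_eq_star_mul_self (cut_eq_star_mul_self _ hε)

theorem norm_cut_sub_le (a : PosElt X) {ε : ℝ} (hε : 0 ≤ ε) : ‖EqCuntz.cut a.val ε - a.val‖ ≤ ε :=
  EqCuntz.norm_cut_sub_le a.pos_val.exists_eq_star_mul_self hε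

theorem isSelfAdjoint_val (a : PosElt X) : IsSelfAdjoint a.val := a.pos_val.adj_eq

theorem localUnit_cut (a : PosElt X) {ε : ℝ} (hε : 0 < ε) :
    LocalUnit X a.rep a.val (a.cut hε.le).val :=
  exists_local_unit_cut (S := invAlg X a.rep) isClosed_invAlg a.mem a.isSelfAdjoint_val hε

theorem cut_cut (a : PosElt X) {δ ε : ℝ} (hδ : 0 ≤ δ) (hε : 0 ≤ ε) :
    (a.cut hδ).cut hε = a.cut (add_nonneg hδ hε) := by
  have h : EqCuntz.cut (EqCuntz.cut a.val δ) ε = EqCuntz.cut a.val (δ + ε) :=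
    EqCuntz.cut_cut a.isSelfAdjoint_val hδ hε
  unfold cut
  congr 1

theorem le_of_localUnit {a : PosElt X} {c : OpFam X.carrier a.rep.H a.rep.H}
    (hc : c ∈ invK X a.rep a.rep) (hcp : Pos c) (h : LocalUnit X a.rep a.val c) {b : PosElt X}
    (hab : a ≤ b) : (⟨a.rep, c, hc, hcp⟩ : PosElt X) ≤ b := by
  obtain ⟨η, hη, H⟩ := h.exists_le a.mem a.pos hc hcp
  obtain ⟨d, hd, hn⟩ := subeq_iff.1 hab η hη
  exact H b d hd hn.le

theorem cut_le (a : PosElt X) {ε : ℝ} (hε : 0 < ε) : a.cut hε.le ≤ a :=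
  le_of_localUnit _ _ (a.localUnit_cut hε) le_rfl

/-- An element is below `t` as soon as all its cut-downs are. -/
theorem le_of_forall_cut_le {a t : PosElt X} (h : ∀ ε : ℝ, ∀ hε : 0 < ε, a.cut hε.le ≤ t) :
    a ≤ t :=
  le_of_forall_norm_sub_lt fun ε hε => ⟨_, _, _, (a.norm_cut_sub_le (half_pos hε).le).trans_lt
    (half_lt_self hε), h (ε / 2) (half_pos hε)⟩

/-- In an approximation of `a` by `d b d^*`, the element `b` may be replaced by `(b - δ)₊` for
small `δ`. -/
theorem norm_conj_cut_sub_le {μ : URep G} {a : OpFam X.carrier μ.H μ.H} (b : PosElt X)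
    (d : OpFam X.carrier b.rep.H μ.H) {η : ℝ} (hη : 0 < η)
    (h : ‖comp (comp d b.val) (adj d) - a‖ ≤ η / 2) {δ : ℝ} (hδ : 0 ≤ δ)
    (hδη : δ ≤ η / (2 * (‖d‖ * ‖d‖ + 1))) :
    ‖comp (comp d (EqCuntz.cut b.val δ)) (adj d) - a‖ ≤ η := by
  have hdn : ‖d‖ * (η / (2 * (‖d‖ * ‖d‖ + 1))) * ‖d‖ ≤ η / 2 := by
    rw [mul_div_assoc', div_mul_eq_mul_div, div_le_div_iff₀ (by positivity) (by positivity)]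
    linarith
  have e : comp (comp d (EqCuntz.cut b.val δ)) (adj d) - a
      = comp (comp d (EqCuntz.cut b.val δ - b.val)) (adj d) + (comp (comp d b.val) (adj d) - a) := by
    rw [comp_sub, sub_comp]; abel
  rw [e]
  refine (norm_add_le _ _).trans ?_
  have h1 : ‖comp (comp d (EqCuntz.cut b.val δ - b.val)) (adj d)‖ ≤ η / 2 := by
    refine (norm_conj_le _ _).trans ?_
    calc _ ≤ ‖d‖ * (η / (2 * (‖d‖ * ‖d‖ + 1))) * ‖d‖ := by
          gcongr
          exact (b.norm_cut_sub_le hδ).trans hδη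
      _ ≤ η / 2 := hdn
  linarith

end PosElt

end

section

variable {G : Type v} [Group G] [TopologicalSpace G] {X Y : GCStar.{u} G}

/-! ### Countable direct sums of representations -/

theorem isClosed_setOf_continuous_apply {T : Type*} [TopologicalSpace T] {H K : Type*}
    [NormedAddCommGroup H] [InnerProductSpace ℂ H] [NormedAddCommGroup K] [InnerProductSpace ℂ K]
    (U : T → (H ≃ₗᵢ[ℂ] K)) : IsClosed {z : H | Continuous fun g => U g z} := by
  rw [← isSeqClosed_iff_isClosed]
  intro z z₀ hz hlim
  have : TendstoUniformly (fun n g => U g (z n)) (fun g => U g z₀) atTop := by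
    rw [Metric.tendstoUniformly_iff]
    intro ε hε
    filter_upwards [Metric.tendsto_nhds.1 hlim ε hε] with n hn g
    rw [LinearIsometryEquiv.dist_map, dist_comm]; exact hn
  exact this.continuous (Frequently.of_forall hz)

theorem memℓp_of_norm_eq {E : ℕ → Type*} [∀ n, NormedAddCommGroup (E n)]
    {f g : ∀ n, E n} (hf : Memℓp f 2) (h : ∀ n, ‖g n‖ = ‖f n‖) :
    Memℓp g 2 := by
  have h2 : (0 : ℝ) < (2 : ℝ≥0∞).toReal := by norm_num
  rw [memℓp_gen_iff h2] at hf ⊢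
  simpa only [h] using hf

theorem lp_norm_congr {E : ℕ → Type*} [∀ n, NormedAddCommGroup (E n)]
    {f g : lp E 2} (h : ∀ n, ‖g n‖ = ‖f n‖) : ‖g‖ = ‖f‖ := by
  have h2 : (0 : ℝ) < (2 : ℝ≥0∞).toReal := by norm_num
  simp only [lp.norm_eq_tsum_rpow h2, h]

section lpSum
variable (E : ℕ → Type) [∀ n, NormedAddCommGroup (E n)] [∀ n, InnerProductSpace ℂ (E n)]

/-- The inclusion of a summand of a countable Hilbert space direct sum. -/
def lpIncl (n : ℕ) : E n →ₗᵢ[ℂ] lp E 2 where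
  toLinearMap := lp.lsingle (𝕜 := ℂ) 2 n
  norm_map' x := lp.norm_single (by norm_num) n x

theorem lpIncl_apply (n : ℕ) (x : E n) : lpIncl E n x = lp.single 2 n x := rfl

variable {E} in
theorem lp_hasSum_lpIncl (f : lp E 2) : HasSum (fun n => lpIncl E n (f n)) f :=
  lp.hasSum_single ENNReal.ofNat_ne_top f

variable {E} in
theorem lp_induction {p : lp E 2 → Prop} (hcl : IsClosed {x | p x}) (h0 : p 0)
    (hadd : ∀ x y, p x → p y → p (x + y)) (hs : ∀ n x, p (lpIncl E n x)) (f : lp E 2) : p f := by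
  refine hcl.mem_of_tendsto (lp_hasSum_lpIncl f) (Eventually.of_forall fun s => ?_)
  change p (∑ n ∈ s, lpIncl E n (f n))
  induction s using Finset.induction_on with
  | empty => simpa using h0
  | insert a s ha ih => rw [Finset.sum_insert ha]; exact hadd _ _ (hs _ _) ih

instance [∀ n, TopologicalSpace.SeparableSpace (E n)] :
    TopologicalSpace.SeparableSpace (lp E 2) := by
  have hc : TopologicalSpace.IsSeparable (⋃ n, Set.range (lpIncl E n)) :=
    TopologicalSpace.IsSeparable.iUnion fun n =>
      TopologicalSpace.isSeparable_range (lpIncl E n).continuous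
  have h1 := (hc.span (R := ℂ)).closure
  rw [← TopologicalSpace.isSeparable_univ_iff]
  refine h1.mono fun z hz => ?_
  clear hz
  set R := Submodule.span ℂ (⋃ n, Set.range (lpIncl E n))
  change z ∈ R.topologicalClosure
  induction z using lp_induction with
  | hcl => exact Submodule.isClosed_topologicalClosure _
  | h0 => exact zero_mem _
  | hadd x y hx hy => exact add_mem hx hy
  | hs n x =>
    exact Submodule.le_topologicalClosure _
      (Submodule.subset_span (Set.mem_iUnion.2 ⟨n, x, rfl⟩))

variable {E} in
/-- The diagonal unitary with given unitary entries. -/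
def lpCongr (U : ∀ n, E n ≃ₗᵢ[ℂ] E n) : lp E 2 ≃ₗᵢ[ℂ] lp E 2 where
  toFun f := ⟨fun n => U n (f n), memℓp_of_norm_eq (lp.memℓp f) fun n => (U n).norm_map _⟩
  invFun f := ⟨fun n => (U n).symm (f n),
    memℓp_of_norm_eq (lp.memℓp f) fun n => (U n).symm.norm_map _⟩
  map_add' _ _ := lp.ext (funext fun n => (U n).map_add _ _)
  map_smul' _ _ := lp.ext (funext fun n => (U n).map_smul _ _)
  left_inv _ := lp.ext (funext fun n => (U n).symm_apply_apply _)
  right_inv _ := lp.ext (funext fun n => (U n).apply_symm_apply _)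
  norm_map' _ := lp_norm_congr fun n => (U n).norm_map _

variable {E} in
theorem lpCongr_apply (U : ∀ n, E n ≃ₗᵢ[ℂ] E n) (f : lp E 2) (n : ℕ) :
    lpCongr U f n = U n (f n) := rfl

variable {E} in
theorem lpCongr_lpIncl (U : ∀ n, E n ≃ₗᵢ[ℂ] E n) (n : ℕ) (x : E n) :
    lpCongr U (lpIncl E n x) = lpIncl E n (U n x) := by
  ext m
  rw [lpCongr_apply, lpIncl_apply, lpIncl_apply]
  by_cases h : m = n
  · subst h; simp
  · rw [lp.single_apply_ne 2 n x h, lp.single_apply_ne 2 n _ h, map_zero]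

end lpSum

namespace URep

/-- The Hilbert space direct sum of a sequence of representations. -/
abbrev seqSum (μ : ℕ → URep G) : URep G where
  H := lp (fun n => (μ n).H) 2
  ρ :=
    { toFun := fun g => lpCongr fun n => (μ n).ρ g
      map_one' := by ext f n; simp [lpCongr_apply]
      map_mul' := fun g h => by ext f n; simp [lpCongr_apply] }
  cont f := by
    induction f using lp_induction with
    | hcl => exact isClosed_setOf_continuous_apply _
    | h0 => simpa using continuous_const
    | hadd x y hx hy => simp only [map_add]; exact hx.add hy
    | hs n x =>
      have h : (fun g => lpCongr (fun n => (μ n).ρ g) (lpIncl (fun n => (μ n).H) n x))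
          = fun g => lpIncl (fun n => (μ n).H) n ((μ n).ρ g x) :=
        funext fun g => lpCongr_lpIncl (E := fun n => (μ n).H) (fun n => (μ n).ρ g) n x
      change Continuous fun g => lpCongr (fun n => (μ n).ρ g) (lpIncl (fun n => (μ n).H) n x)
      rw [h]
      exact (lpIncl _ n).continuous.comp ((μ n).cont x)

/-- The inclusion of a summand. -/
def seqIncl (μ : ℕ → URep G) (n : ℕ) : (μ n).H →L[ℂ] (seqSum μ).H :=
  (lpIncl (fun n => (μ n).H) n).toContinuousLinearMap

variable (μ : ℕ → URep G)

theorem intertwines_seqIncl (n : ℕ) : Intertwines (μ := μ n) (ν := seqSum μ) (seqIncl μ n) :=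
  fun g => ContinuousLinearMap.ext fun x => (lpCongr_lpIncl (fun n => (μ n).ρ g) n x).symm

theorem adjoint_seqIncl_comp_self (n : ℕ) :
    adjoint (seqIncl μ n) ∘L seqIncl μ n = .id ℂ (μ n).H :=
  adjoint_linearIsometry_comp (lpIncl (fun n => (μ n).H) n)

theorem adjoint_seqIncl_comp_of_ne {m n : ℕ} (h : m ≠ n) :
    adjoint (seqIncl μ m) ∘L seqIncl μ n = 0 := by
  ext x
  refine ext_inner_left ℂ fun w => ?_
  rw [ContinuousLinearMap.comp_apply, ContinuousLinearMap.adjoint_inner_right]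
  change inner ℂ (lp.single (E := fun n => (μ n).H) 2 m w) (lp.single 2 n x) = inner ℂ w 0
  rw [lp.inner_single_left, lp.single_apply_ne (E := fun n => (μ n).H) 2 n x h]

end URep

end

section

variable {G : Type v} [Group G] [TopologicalSpace G] {X Y : GCStar.{u} G}

/-! ### Suprema of increasing sequences -/

section Telescope
variable (μ : ℕ → URep G) (x y : ∀ n, OpFam X.carrier (μ (n + 1)).H (μ n).H)

/-- Compatible embeddings of the spaces `H_n` into their direct sum: `W₀ = ι₀` and
`W_{n+1} = W_n x_n + ι_{n+1} (1 - y_n^* x_n)`. They satisfy `W_{n+1} y_n^* c = W_n c` for all `c`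
with `x_n y_n^* c = c`. -/
def embed : ∀ n, OpFam X.carrier (μ n).H (seqSum μ).H
  | 0 => mult (seqIncl μ 0)
  | n + 1 => comp (embed n) (x n)
      + comp (mult (seqIncl μ (n + 1))) (mult (.id ℂ _) - comp (adj (y n)) (x n))

/-- Left inverses of the compatible embeddings. -/
def unembed : ∀ n, OpFam X.carrier (seqSum μ).H (μ n).H
  | 0 => mult (adjoint (seqIncl μ 0))
  | n + 1 => comp (adj (y n)) (unembed n) + mult (adjoint (seqIncl μ (n + 1)))

theorem seqIncl_adj_comp_embed (n m : ℕ) (h : n < m) :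
    comp (mult (adjoint (seqIncl μ m))) (embed μ x y n) = 0 := by
  induction n with
  | zero => rw [embed, mult_comp_mult, adjoint_seqIncl_comp_of_ne μ h.ne', mult_zero]
  | succ n ih =>
    rw [embed, comp_add, ← comp_assoc, ← comp_assoc, ih (by omega), mult_comp_mult,
      adjoint_seqIncl_comp_of_ne μ h.ne', mult_zero, zero_comp, zero_comp, add_zero]

theorem unembed_comp_seqIncl (n m : ℕ) (h : n < m) :
    comp (unembed μ y n) (mult (seqIncl μ m)) = 0 := by
  induction n with
  | zero => rw [unembed, mult_comp_mult, adjoint_seqIncl_comp_of_ne μ h.ne, mult_zero]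
  | succ n ih =>
    rw [unembed, add_comp, comp_assoc, ih (by omega), mult_comp_mult,
      adjoint_seqIncl_comp_of_ne μ h.ne, mult_zero, comp_zero, add_zero]

theorem unembed_comp_embed (n : ℕ) :
    comp (unembed μ y n) (embed μ x y n) = mult (.id ℂ (μ n).H) := by
  induction n with
  | zero => rw [unembed, embed, mult_comp_mult, adjoint_seqIncl_comp_self]
  | succ n ih =>
    have h1 := unembed_comp_seqIncl μ y n (n + 1) (Nat.lt_succ_self n)
    have h2 := seqIncl_adj_comp_embed μ x y n (n + 1) (Nat.lt_succ_self n)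
    rw [unembed, embed, add_comp, comp_add, comp_add]
    rw [comp_assoc _ _ (comp (embed μ x y n) _), ← comp_assoc (unembed μ y n) (embed μ x y n), ih,
      mult_id_comp, comp_assoc _ _ (comp (mult _) _),
      ← comp_assoc (unembed μ y n) (mult _), h1, zero_comp, comp_zero, ← comp_assoc, h2, zero_comp,
      ← comp_assoc, mult_comp_mult, adjoint_seqIncl_comp_self, mult_id_comp]
    abel

variable {x y}

theorem embed_succ_comp {n : ℕ} {c : OpFam X.carrier (μ n).H (μ n).H}
    (h : c = comp (x n) (comp (adj (y n)) c)) :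
    comp (embed μ x y (n + 1)) (comp (adj (y n)) c) = comp (embed μ x y n) c := by
  rw [embed, add_comp, comp_assoc, ← h, comp_assoc, sub_comp, mult_id_comp, comp_assoc, ← h,
    sub_self, comp_zero, add_zero]

theorem embed_comp_mem (hx : ∀ n, x n ∈ invK X (μ (n + 1)) (μ n))
    (hy : ∀ n, y n ∈ invK X (μ (n + 1)) (μ n)) (n : ℕ) {lam : URep G}
    {z : OpFam X.carrier lam.H (μ n).H} (hz : z ∈ invK X lam (μ n)) :
    comp (embed μ x y n) z ∈ invK X lam (seqSum μ) := by
  induction n with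
  | zero => exact invK_mult_comp (intertwines_seqIncl μ 0) hz
  | succ n ih =>
    rw [embed, add_comp, comp_assoc, comp_assoc]
    refine invK_add (ih (invK_comp (hx n) hz)) (invK_mult_comp (intertwines_seqIncl μ (n + 1)) ?_)
    rw [sub_comp, mult_id_comp]
    exact invK_sub hz (invK_comp (invK_comp (invK_adj (hy n)) (hx n)) hz)

theorem comp_unembed_mem (hy : ∀ n, y n ∈ invK X (μ (n + 1)) (μ n)) (n : ℕ) {lam : URep G}
    {z : OpFam X.carrier (μ n).H lam.H} (hz : z ∈ invK X (μ n) lam) :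
    comp z (unembed μ y n) ∈ invK X (seqSum μ) lam := by
  induction n with
  | zero => exact invK_comp_mult hz (intertwines_seqIncl μ 0).adj
  | succ n ih =>
    rw [unembed, comp_add, ← comp_assoc]
    exact invK_add (ih (invK_comp hz (invK_adj (hy n))))
      (invK_comp_mult hz (intertwines_seqIncl μ (n + 1)).adj)

end Telescope

namespace PosElt

/-- `C` is an upper bound of the sequence `a`, and a norm limit of elements below `a n`. Such a `C`
is a supremum of `a`. -/
structure IsApproxSup (a : ℕ → PosElt X) (C : PosElt X) : Prop where
  le : ∀ n, a n ≤ C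
  approx : ∀ ε : ℝ, 0 < ε → ∀ᶠ n in atTop, ∃ (x : OpFam X.carrier C.rep.H C.rep.H)
    (hx : x ∈ invK X C.rep C.rep) (hp : Pos x),
      ‖x - C.val‖ < ε ∧ (⟨C.rep, x, hx, hp⟩ : PosElt X) ≤ a n

theorem IsApproxSup.le_of_forall_le {a : ℕ → PosElt X} {C t : PosElt X} (h : IsApproxSup a C)
    (ht : ∀ n, a n ≤ t) : C ≤ t :=
  le_of_forall_norm_sub_lt fun ε hε => by
    obtain ⟨n, x, hx, hp, hn, hle⟩ := (h.approx ε hε).exists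
    exact ⟨x, hx, hp, hn, hle.trans (ht n)⟩

/-- In an ordered Banach space whose positive cone `P` is closed, a sequence that increases up to
constants, `D n ≤ K_n D (n + 1)`, is dominated by the element `∑ λ_n D n`, and every partial sum of
this series is dominated by some `D n`. -/
theorem exists_tendsto_of_le_smul {E : Type*} [NormedAddCommGroup E] [NormedSpace ℂ E]
    [CompleteSpace E] {P : E → Prop} (hcl : IsClosed {x | P x}) (h0 : P 0)
    (hadd : ∀ x y, P x → P y → P (x + y)) (hsmul : ∀ (c : ℝ) x, 0 ≤ c → P x → P ((c : ℂ) • x))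
    (D : ℕ → E) (hDp : ∀ n, P (D n))
    (hDD : ∀ n, ∃ K : ℝ, 0 ≤ K ∧ P ((K : ℂ) • D (n + 1) - D n)) :
    ∃ (Cv : E) (S : ℕ → E), Tendsto S atTop (𝓝 Cv) ∧ (∀ n, S n ∈ Submodule.span ℂ (Set.range D)) ∧
      (∀ n, P (S n)) ∧ (∀ n, ∃ K : ℝ, 0 ≤ K ∧ P ((K : ℂ) • Cv - D n)) ∧
      ∀ n, ∃ K : ℝ, 0 ≤ K ∧ P ((K : ℂ) • D n - S n) := by
  set lam : ℕ → ℝ := fun n => (1 / 2) ^ n / (1 + ‖D n‖) with hlam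
  have hlam0 : ∀ n, 0 < lam n := fun n => by positivity
  have hsum : Summable fun n => (lam n : ℂ) • D n := by
    refine Summable.of_norm_bounded (g := fun n : ℕ => ((1 : ℝ) / 2) ^ n) summable_geometric_two
      fun n => ?_
    rw [norm_smul, Complex.norm_real, Real.norm_of_nonneg (hlam0 n).le, hlam, div_mul_eq_mul_div,
      div_le_iff₀ (by positivity)]
    have : (0 : ℝ) < (1 / 2) ^ n := by positivity
    nlinarith
  set S : ℕ → E := fun n => ∑ k ∈ Finset.range n, (lam k : ℂ) • D k with hS
  have hS1 : ∀ n, S (n + 1) = S n + (lam n : ℂ) • D n := fun n => Finset.sum_range_succ _ _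
  set Cv := ∑' n, (lam n : ℂ) • D n with hCv
  have hSlim : Tendsto S atTop (𝓝 Cv) := hsum.hasSum.tendsto_sum_nat
  have hSp : ∀ n m, n ≤ m → P (S m - S n) := fun n m h => by
    induction m, h using Nat.le_induction with
    | base => rw [sub_self]; exact h0
    | succ m hm ih =>
      rw [hS1, add_sub_right_comm]
      exact hadd _ _ ih (hsmul _ _ (hlam0 m).le (hDp m))
  have hS0 : ∀ n, P (S n) := fun n => by
    have := hSp 0 n (Nat.zero_le n)
    simpa only [hS, Finset.sum_range_zero, sub_zero] using this
  have hCS : ∀ n, P (Cv - S n) := fun n =>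
    hcl.mem_of_tendsto (hSlim.sub_const (S n))
      ((eventually_ge_atTop n).mono fun m hm => hSp n m hm)
  have hSD : ∀ n, ∃ K : ℝ, 0 ≤ K ∧ P ((K : ℂ) • D n - S (n + 1)) := fun n => by
    induction n with
    | zero =>
      refine ⟨lam 0, (hlam0 0).le, ?_⟩
      simpa only [hS, zero_add, Finset.sum_range_one, sub_self] using h0
    | succ n ih =>
      obtain ⟨K, hK0, hKp⟩ := ih
      obtain ⟨L, hL0, hLp⟩ := hDD n
      refine ⟨K * L + lam (n + 1), by have := hlam0 (n + 1); positivity, ?_⟩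
      have e : ((K * L + lam (n + 1) : ℝ) : ℂ) • D (n + 1) - S (n + 1 + 1)
          = (K : ℂ) • ((L : ℂ) • D (n + 1) - D n) + ((K : ℂ) • D n - S (n + 1)) := by
        rw [hS1 (n + 1), smul_sub, smul_smul, Complex.ofReal_add, Complex.ofReal_mul, add_smul]
        abel
      rw [e]
      exact hadd _ _ (hsmul _ _ hK0 hLp) hKp
  refine ⟨Cv, fun n => S (n + 1), hSlim.comp (tendsto_add_atTop_nat 1), fun n =>
    sum_mem fun k _ => Submodule.smul_mem _ _ (Submodule.subset_span ⟨k, rfl⟩), fun n => hS0 _,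
    fun n => ⟨(lam n)⁻¹, by have := hlam0 n; positivity, ?_⟩, hSD⟩
  have e : (((lam n)⁻¹ : ℝ) : ℂ) • Cv - D n
      = (((lam n)⁻¹ : ℝ) : ℂ) • ((Cv - S (n + 1)) + S n) := by
    have e2 : Cv - S (n + 1) + S n = Cv - (lam n : ℂ) • D n := by rw [hS1]; abel
    have hne : (lam n : ℂ) ≠ 0 := by exact_mod_cast (hlam0 n).ne'
    rw [e2, smul_sub, smul_smul, Complex.ofReal_inv, inv_mul_cancel₀ hne, one_smul]
  rw [e]
  exact hsmul _ _ (by have := hlam0 n; positivity) (hadd _ _ (hCS (n + 1)) (hS0 n))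

/-- A sequence of positive elements over one representation that increases up to constants has a
supremum. -/
theorem exists_isApproxSup_of_le_smul {μ : URep G} (D : ℕ → OpFam X.carrier μ.H μ.H)
    (hDm : ∀ n, D n ∈ invK X μ μ) (hDp : ∀ n, Pos (D n))
    (hDD : ∀ n, ∃ K : ℝ, 0 ≤ K ∧ Pos ((K : ℂ) • D (n + 1) - D n)) :
    ∃ C : PosElt X, IsApproxSup (fun n => ⟨μ, D n, hDm n, hDp n⟩) C := by
  obtain ⟨Cv, S, hlim, hspan, hSp, hDC, hSD⟩ := exists_tendsto_of_le_smul (P := Pos) isClosed_pos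
    Pos.zero (fun _ _ => Pos.add) (fun _ _ hc hx => hx.smul hc) D hDp hDD
  have hSm : ∀ n, S n ∈ invK X μ μ := fun n =>
    (Submodule.span_le (p := (invAlg X μ).toSubmodule)).2
      (by rintro _ ⟨k, rfl⟩; exact hDm k) (hspan n)
  have hCm : Cv ∈ invK X μ μ :=
    (isClosed_invAlg (X := X) (μ := μ)).mem_of_tendsto hlim (Eventually.of_forall hSm)
  have hCp : Pos Cv := isClosed_pos.mem_of_tendsto hlim (Eventually.of_forall hSp)
  refine ⟨⟨μ, Cv, hCm, hCp⟩, ⟨fun n => ?_, fun ε hε => ?_⟩⟩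
  · obtain ⟨K, hK0, hKp⟩ := hDC n
    exact le_of_pos_smul_sub (hDm n) (hDp n) hCm hCp hK0 hKp
  · filter_upwards [hlim.eventually (Metric.ball_mem_nhds Cv hε)] with n hn
    obtain ⟨K, hK0, hKp⟩ := hSD n
    exact ⟨S n, hSm n, hSp n, by simpa [dist_eq_norm] using hn,
      le_of_pos_smul_sub (hSm n) (hSp n) (hDm n) (hDp n) hK0 hKp⟩

theorem embed_conj_mem (μ : ℕ → URep G) {x y : ∀ n, OpFam X.carrier (μ (n + 1)).H (μ n).H}
    (hx : ∀ n, x n ∈ invK X (μ (n + 1)) (μ n)) (hy : ∀ n, y n ∈ invK X (μ (n + 1)) (μ n)) (n : ℕ)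
    {z : OpFam X.carrier (μ n).H (μ n).H} (hz : z ∈ invK X (μ n) (μ n)) :
    comp (comp (embed μ x y n) z) (adj (embed μ x y n)) ∈ invK X (seqSum μ) (seqSum μ) := by
  have h1 := invK_adj (embed_comp_mem μ hx hy n hz)
  rw [adj_comp] at h1
  have h3 := invK_adj (embed_comp_mem μ hx hy n h1)
  rwa [adj_comp, adj_comp, adj_adj, adj_adj] at h3

section
variable {c : ℕ → PosElt X} {x y : ∀ n, OpFam X.carrier (c (n + 1)).rep.H (c n).rep.H}
  (hx : ∀ n, x n ∈ invK X (c (n + 1)).rep (c n).rep)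
  (hy : ∀ n, y n ∈ invK X (c (n + 1)).rep (c n).rep)

variable (c x y) in
/-- The element `W_n c_n W_n^*`. -/
def embeddedVal (n : ℕ) :
    OpFam X.carrier (seqSum fun n => (c n).rep).H (seqSum fun n => (c n).rep).H :=
  comp (comp (embed (fun n => (c n).rep) x y n) (c n).val)
    (adj (embed (fun n => (c n).rep) x y n))

theorem embeddedVal_mem (hx : ∀ n, x n ∈ invK X (c (n + 1)).rep (c n).rep)
    (hy : ∀ n, y n ∈ invK X (c (n + 1)).rep (c n).rep) (n : ℕ) :
    embeddedVal c x y n ∈ invK X (seqSum fun n => (c n).rep)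
    (seqSum fun n => (c n).rep) :=
  embed_conj_mem (fun n => (c n).rep) hx hy n (c n).mem

theorem pos_embeddedVal (n : ℕ) : Pos (embeddedVal c x y n) := (c n).pos_val.conj _

/-- Passing from `c_n` to `W_n c_n W_n^*` does not change the Cuntz class, although `W_n` need not
be isometric: `W_n` has a left inverse. -/
theorem le_embedded (n : ℕ) : c n ≤ ⟨seqSum fun n => (c n).rep, embeddedVal c x y n,
    embeddedVal_mem hx hy n, pos_embeddedVal n⟩ := by
  set μ : ℕ → URep G := fun n => (c n).rep with hμ
  set W := embed μ x y with hW
  refine subeq_iff.2 fun ε hε => ?_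
  obtain ⟨e, he, hlt⟩ := (c n).exists_approx_unit hε
  refine ⟨comp e (unembed μ y n), comp_unembed_mem μ hy n he, ?_⟩
  have h1 : comp (unembed μ y n) (W n) = mult (.id ℂ (μ n).H) := unembed_comp_embed μ x y n
  have h2 : comp (adj (W n)) (adj (unembed μ y n)) = mult (.id ℂ (μ n).H) := by
    rw [← adj_comp, h1, adj_mult]
    congr 1
    exact adjoint_id
  have h3 : comp (comp (comp e (unembed μ y n)) (comp (comp (W n) (c n).val) (adj (W n))))
        (adj (comp e (unembed μ y n)))
      = comp (comp e (c n).val) (adj e) := by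
    calc _ = comp (comp e (comp (comp (comp (unembed μ y n) (W n)) (c n).val)
          (comp (adj (W n)) (adj (unembed μ y n))))) (adj e) := by
            rw [adj_comp]; simp only [comp_assoc]
      _ = _ := by rw [h1, h2, mult_id_comp, comp_mult_id]
  change ‖comp (comp (comp e (unembed μ y n)) (comp (comp (W n) (c n).val) (adj (W n))))
    (adj (comp e (unembed μ y n)))
    - (c n).val‖ < ε
  rw [h3]
  exact hlt

theorem embedded_le (n : ℕ) : (⟨seqSum fun n => (c n).rep, embeddedVal c x y n,
    embeddedVal_mem hx hy n, pos_embeddedVal n⟩ : PosElt X) ≤ c n := by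
  set μ : ℕ → URep G := fun n => (c n).rep with hμ
  set W := embed μ x y with hW
  refine le_of_forall_norm_sub_lt fun ε hε => ?_
  obtain ⟨δ, hδ, hδε⟩ : ∃ δ : ℝ, 0 < δ ∧ ‖W n‖ * δ * ‖W n‖ < ε := by
    refine ⟨ε / (‖W n‖ * ‖W n‖ + 1), by positivity, ?_⟩
    rw [mul_assoc, mul_comm, mul_assoc, div_mul_eq_mul_div, div_lt_iff₀ (by positivity)]
    nlinarith [mul_nonneg (norm_nonneg (W n)) (norm_nonneg (W n))]
  obtain ⟨e, he, hlt⟩ := (c n).exists_approx_unit hδ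
  have h1 : comp (comp (comp (W n) e) (c n).val) (adj (comp (W n) e))
      = comp (comp (W n) (comp (comp e (c n).val) (adj e))) (adj (W n)) := by
    rw [adj_comp]; simp only [comp_assoc]
  have h4 : comp (W n) e ∈ invK X (μ n) (seqSum μ) := embed_comp_mem μ hx hy n he
  refine ⟨comp (comp (comp (W n) e) (c n).val) (adj (comp (W n) e)),
    invK_comp (invK_comp h4 (c n).mem) (invK_adj h4), (c n).pos_val.conj _, ?_,
    conj_elt_le (c n).mem (c n).pos h4⟩
  have h5 : comp (comp (comp (W n) e) (c n).val) (adj (comp (W n) e)) - embeddedVal c x y n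
      = comp (comp (W n) (comp (comp e (c n).val) (adj e) - (c n).val)) (adj (W n)) := by
    rw [h1, comp_sub, sub_comp]; rfl
  change ‖comp (comp (comp (W n) e) (c n).val) (adj (comp (W n) e)) - embeddedVal c x y n‖ < ε
  rw [h5]
  refine (norm_conj_le _ _).trans_lt (lt_of_le_of_lt ?_ hδε)
  gcongr

/-- If `c_n = x_n y_n^* c_n`, then `W_n c_n = W_{n+1} y_n^* c_n`, so that a comparison of `y_n^*
c_n y_n` with `c_{n+1}` becomes one between the embedded elements. -/
theorem pos_smul_embeddedVal_sub {n : ℕ} (hxy : (c n).val = comp (x n) (comp (adj (y n)) (c n).val))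
    (hK : ∃ K : ℝ, 0 ≤ K ∧
      Pos ((K : ℂ) • (c (n + 1)).val - comp (comp (adj (y n)) (c n).val) (y n))) :
    ∃ K : ℝ, 0 ≤ K ∧
      Pos ((K : ℂ) • embeddedVal c x y (n + 1) - embeddedVal c x y n) := by
  set μ : ℕ → URep G := fun n => (c n).rep with hμ
  set W := embed μ x y with hW
  obtain ⟨K, hK0, hKp⟩ := hK
  refine ⟨K, hK0, ?_⟩
  have h1 := hKp.conj (W (n + 1))
  rw [comp_sub, sub_comp, comp_smul, smul_comp] at h1
  have h2 : comp (W (n + 1)) (comp (adj (y n)) (c n).val) = comp (W n) (c n).val :=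
    embed_succ_comp μ hxy
  have h3 : comp (comp (W (n + 1)) (comp (comp (adj (y n)) (c n).val) (y n))) (adj (W (n + 1)))
      = comp (comp (W n) (c n).val) (adj (W n)) := by
    have h4 := congrArg adj h2
    rw [adj_comp, adj_comp, adj_comp, adj_adj, (c n).pos_val.adj_eq] at h4
    rw [← comp_assoc, h2]
    calc _ = comp (W n) (comp (comp (c n).val (y n)) (adj (W (n + 1)))) := by
          simp only [comp_assoc]
      _ = _ := by rw [h4]; simp only [comp_assoc]
  rw [h3] at h1
  exact h1

end

/-- The supremum of a sequence of positive elements, each of which factors through the next one. The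
sequence is moved along the compatible embeddings `W_n` into one algebra, where
`∑ λ_n W_n c_n W_n^*` is the supremum. -/
theorem exists_isApproxSup_of_factor (c : ℕ → PosElt X)
    (x y : ∀ n, OpFam X.carrier (c (n + 1)).rep.H (c n).rep.H)
    (hx : ∀ n, x n ∈ invK X (c (n + 1)).rep (c n).rep)
    (hy : ∀ n, y n ∈ invK X (c (n + 1)).rep (c n).rep)
    (hxy : ∀ n, (c n).val = comp (x n) (comp (adj (y n)) (c n).val))
    (hK : ∀ n, ∃ K : ℝ, 0 ≤ K ∧
      Pos ((K : ℂ) • (c (n + 1)).val - comp (comp (adj (y n)) (c n).val) (y n))) :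
    ∃ C : PosElt X, IsApproxSup c C := by
  obtain ⟨C, hC⟩ := exists_isApproxSup_of_le_smul (embeddedVal c x y)
    (embeddedVal_mem hx hy) pos_embeddedVal fun n => pos_smul_embeddedVal_sub (hxy n) (hK n)
  refine ⟨C, fun n => (le_embedded hx hy n).trans (hC.le n), fun ε hε => ?_⟩
  filter_upwards [hC.approx ε hε] with n ⟨z, hz, hzp, hn, hle⟩
  exact ⟨z, hz, hzp, hn, hle.trans (embedded_le hx hy n)⟩

end PosElt

end

section

variable {G : Type v} [Group G] [TopologicalSpace G] {X Y : GCStar.{u} G}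

namespace PosElt

/-- A comparison `a ≾ b` restricts to cut-downs: `(a - ε)₊ ≾ (b - δ)₊` for all small `δ`. -/
theorem exists_cut_le_cut {a b : PosElt X} (hab : a ≤ b) {ε : ℝ} (hε : 0 < ε) :
    ∃ δ₀ : ℝ, 0 < δ₀ ∧ ∀ δ (hδ : 0 ≤ δ), δ ≤ δ₀ → a.cut hε.le ≤ b.cut hδ := by
  obtain ⟨η, hη, H⟩ := (a.localUnit_cut hε).exists_le a.mem a.pos (a.cut hε.le).mem (a.cut hε.le).pos
  obtain ⟨d, hd, hn⟩ := subeq_iff.1 hab (η / 2) (half_pos hη)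
  exact ⟨η / (2 * (‖d‖ * ‖d‖ + 1)), by positivity, fun δ hδ hle =>
    H (b.cut hδ) d hd (norm_conj_cut_sub_le b d hη hn.le hδ hle)⟩

/-- If `a ≾ b`, then `(a - ε)₊` factors through the spaces of `(b - δ)₊` for all small `δ`, in the
form needed to embed both into a common representation. -/
theorem exists_cut_factor {a b : PosElt X} (hab : a ≤ b) {ε : ℝ} (hε : 0 < ε) :
    ∃ δ₀ : ℝ, 0 < δ₀ ∧ ∀ δ, 0 ≤ δ → δ ≤ δ₀ →
      ∃ x ∈ invK X b.rep a.rep, ∃ y ∈ invK X b.rep a.rep,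
        EqCuntz.cut a.val ε = comp x (comp (adj y) (EqCuntz.cut a.val ε)) ∧
        ∃ K : ℝ, 0 ≤ K ∧ Pos ((K : ℂ) • EqCuntz.cut b.val δ
          - comp (comp (adj y) (EqCuntz.cut a.val ε)) y) := by
  obtain ⟨η, hη, H⟩ := (a.localUnit_cut hε).exists_factor a.mem a.pos
  obtain ⟨d, hd, hn⟩ := subeq_iff.1 hab (η / 2) (half_pos hη)
  refine ⟨η / (2 * (‖d‖ * ‖d‖ + 1)), by positivity, fun δ hδ hle => ?_⟩
  obtain ⟨s, hs, hss, hsb⟩ : ∃ s ∈ invK X b.rep b.rep, adj s = s ∧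
      comp s s = EqCuntz.cut b.val δ := exists_sqrt (b.cut hδ).mem (b.cut hδ).pos
  obtain ⟨x, hx, w, hw, hxw⟩ := H b.rep (EqCuntz.cut b.val δ) s d hs hss hsb hd
    (norm_conj_cut_sub_le b d hη hn.le hδ hle)
  refine ⟨x, hx, comp w s, invK_comp hw hs, hxw, ?_⟩
  have hm : Pos (comp (comp (adj w) (EqCuntz.cut a.val ε)) (adj (adj w))) :=
    (a.cut hε.le).pos_val.conj (adj w)
  rw [adj_adj] at hm
  refine ⟨‖comp (comp (adj w) (EqCuntz.cut a.val ε)) w‖, norm_nonneg _, ?_⟩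
  have h := hm.norm_smul_comp_adj_sub s
  have e1 : comp s (adj s) = EqCuntz.cut b.val δ := by rw [hss, hsb]
  have e2 : comp (comp (adj (comp w s)) (EqCuntz.cut a.val ε)) (comp w s)
      = comp (comp s (comp (comp (adj w) (EqCuntz.cut a.val ε)) w)) (adj s) := by
    rw [adj_comp, hss]; simp only [comp_assoc]
  rw [e1] at h
  rw [e2]
  exact h

theorem cut_le_cut (a : PosElt X) {δ ε : ℝ} (hδ : 0 ≤ δ) (hδε : δ < ε) :
    a.cut (hδ.trans hδε.le) ≤ a.cut hδ := by
  have h := (a.cut hδ).cut_le (sub_pos.2 hδε)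
  rw [cut_cut] at h
  simpa only [add_sub_cancel] using h

theorem exists_pos_le_all (f : ℕ → ℝ) (hf : ∀ k, 0 < f k) (n : ℕ) :
    ∃ D : ℝ, 0 < D ∧ ∀ k ≤ n, D ≤ f k := by
  induction n with
  | zero => exact ⟨f 0, hf 0, fun k hk => by rw [Nat.le_zero.1 hk]⟩
  | succ n ih =>
    obtain ⟨D, hD, h⟩ := ih
    refine ⟨min D (f (n + 1)), lt_min hD (hf _), fun k hk => ?_⟩
    rcases Nat.le_succ_iff.1 hk with hk | rfl
    · exact (min_le_left _ _).trans (h k hk)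
    · exact min_le_right _ _

/-- Every increasing sequence of positive elements has a supremum. It is the supremum of suitable
cut-downs `(a_n - ε_n)₊`, each of which factors through the next one. -/
theorem exists_isApproxSup {a : ℕ → PosElt X} (ha : ∀ n m, n ≤ m → a n ≤ a m) :
    ∃ C : PosElt X, IsApproxSup a C := by
  choose δ₁ hδ₁ h₁ using fun (n : ℕ) (e : {e : ℝ // 0 < e}) =>
    exists_cut_factor (ha n (n + 1) n.le_succ) e.2
  have hn0 : ∀ n : ℕ, (0 : ℝ) < 1 / ((n : ℝ) + 1) := fun n => by positivity
  have h₂ : ∀ n : ℕ, ∃ D : ℝ, 0 < D ∧ ∀ k ≤ n, ∀ δ (hδ : 0 ≤ δ), δ ≤ D →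
      (a k).cut (hn0 n).le ≤ (a (n + 1)).cut hδ := fun n => by
    have h3 : ∀ k, ∃ f : ℝ, 0 < f ∧ (k ≤ n → ∀ δ (hδ : 0 ≤ δ), δ ≤ f →
        (a k).cut (hn0 n).le ≤ (a (n + 1)).cut hδ) := fun k => by
      by_cases hk : k ≤ n
      · obtain ⟨f, hf, h⟩ := exists_cut_le_cut (ha k (n + 1) (by omega)) (hn0 n)
        exact ⟨f, hf, fun _ => h⟩
      · exact ⟨1, one_pos, fun h => absurd h hk⟩
    choose f hf h using h3
    obtain ⟨D, hD, hDf⟩ := exists_pos_le_all f hf n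
    exact ⟨D, hD, fun k hk δ hδ hle => h k hk δ hδ (hle.trans (hDf k hk))⟩
  choose D hD h₃ using h₂
  let ε : ℕ → {e : ℝ // 0 < e} := fun n => Nat.rec ⟨1, one_pos⟩
    (fun n e => ⟨min (D n) (δ₁ n e), lt_min (hD n) (hδ₁ n e)⟩) n
  have hε : ∀ n, (ε (n + 1) : ℝ) = min (D n) (δ₁ n (ε n)) := fun n => rfl
  choose x hx y hy hxy hK using fun n => h₁ n (ε n) (ε (n + 1)) (ε (n + 1)).2.le
    ((hε n).trans_le (min_le_right _ _))
  obtain ⟨C, hC⟩ := exists_isApproxSup_of_factor (fun n => (a n).cut (ε n).2.le) x y hx hy hxy hK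
  refine ⟨C, fun k => le_of_forall_cut_le fun e he => ?_, fun e he => ?_⟩
  · obtain ⟨n, hn⟩ := exists_nat_one_div_lt he
    set m := max n k with hm
    have h4 : 1 / ((m : ℝ) + 1) < e := lt_of_le_of_lt (by
      have : (n : ℝ) ≤ m := by exact_mod_cast le_max_left n k
      gcongr) hn
    exact ((cut_le_cut (a k) (hn0 m).le h4).trans (h₃ m k (le_max_right _ _) _ (ε (m + 1)).2.le
      ((hε m).trans_le (min_le_left _ _)))).trans (hC.le (m + 1))
  · filter_upwards [hC.approx e he] with n ⟨z, hz, hzp, hn, hle⟩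
    exact ⟨z, hz, hzp, hn, hle.trans ((a n).cut_le (ε n).2)⟩

end PosElt

/-! ### The Cuntz semigroup is an object of `Cu` -/

theorem CompactlyContained.le {S : Type*} [Preorder S] {s t : S} (h : CompactlyContained s t) :
    s ≤ t := by
  obtain ⟨k, hk⟩ := h (fun _ => t) monotone_const t (by simp) le_rfl
  exact hk

theorem CompactlyContained.mono {S : Type*} [Preorder S] {s s' t t' : S} (hs : s' ≤ s) (ht : t ≤ t')
    (h : CompactlyContained s t) : CompactlyContained s' t' := fun u hu w hw hle => by
  obtain ⟨k, hk⟩ := h u hu w hw (ht.trans hle)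
  exact ⟨k, hs.trans hk⟩

namespace CuG

open PosElt

theorem exists_rep (u : ℕ → CuG X) : ∃ a : ℕ → PosElt X, u = fun n => mk (a n) :=
  ⟨fun n => Quotient.out (u n), funext fun n => (Quotient.out_eq (u n)).symm⟩

theorem isLUB_of_isApproxSup {a : ℕ → PosElt X} {C : PosElt X} (h : IsApproxSup a C) :
    IsLUB (Set.range fun n => mk (a n)) (mk C) := by
  refine ⟨?_, fun t => ?_⟩
  · rintro _ ⟨n, rfl⟩
    exact mk_le_mk.2 (h.le n)
  · induction t using CuG.ind with
    | h t => exact fun ht => mk_le_mk.2 (h.le_of_forall_le fun n => mk_le_mk.1 (ht ⟨n, rfl⟩))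

/-- An increasing sequence with supremum `[s]` is represented by elements of which some positive
element `C` with `[C] = [s]` is a norm limit. -/
theorem exists_isApproxSup {u : ℕ → CuG X} (hu : Monotone u) :
    ∃ (a : ℕ → PosElt X) (C : PosElt X), u = (fun n => mk (a n)) ∧ IsApproxSup a C := by
  obtain ⟨a, rfl⟩ := exists_rep u
  obtain ⟨C, hC⟩ := PosElt.exists_isApproxSup fun n m h => mk_le_mk.1 (hu h)
  exact ⟨a, C, rfl, hC⟩

/-- A local unit `f a f^*` for `c` gives `[c] ≪ [a]`: if `a` is below the supremum `C` of a
sequence, then some `d x d^*` with `x` below a term of the sequence is already close enough to `a`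
to dominate `c`. -/
theorem compactlyContained_of_localUnit {μ : URep G} {a c : OpFam X.carrier μ.H μ.H}
    (ha : a ∈ invK X μ μ) (hap : Pos a) (hc : c ∈ invK X μ μ) (hcp : Pos c)
    (h : LocalUnit X μ a c) :
    CompactlyContained (mk ⟨μ, c, hc, hcp⟩) (mk ⟨μ, a, ha, hap⟩) := by
  intro u hu w hw hle
  obtain ⟨A, C, rfl, hC⟩ := exists_isApproxSup hu
  rw [hw.unique (isLUB_of_isApproxSup hC)] at hle
  obtain ⟨η, hη, H⟩ := h.exists_le ha hap hc hcp
  obtain ⟨d, hd, hn⟩ := subeq_iff.1 (mk_le_mk.1 hle) (η / 2) (half_pos hη)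
  obtain ⟨k, z, hz, hzp, hzn, hzle⟩ :=
    (hC.approx (η / (2 * (‖d‖ * ‖d‖ + 1))) (by positivity)).exists
  refine ⟨k, mk_le_mk.2 ((H ⟨C.rep, z, hz, hzp⟩ d hd ?_).trans hzle)⟩
  have e : comp (comp d z) (adj d) - a
      = comp (comp d (z - C.val)) (adj d) + (comp (comp d C.val) (adj d) - a) := by
    rw [comp_sub, sub_comp]; abel
  change ‖comp (comp d z) (adj d) - a‖ ≤ η
  rw [e]
  refine (norm_add_le _ _).trans ?_
  have h1 : ‖comp (comp d (z - C.val)) (adj d)‖ ≤ η / 2 := by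
    refine (norm_conj_le _ _).trans ?_
    calc _ ≤ ‖d‖ * (η / (2 * (‖d‖ * ‖d‖ + 1))) * ‖d‖ := by gcongr
      _ ≤ η / 2 := by
        rw [mul_assoc, mul_comm, mul_assoc, div_mul_eq_mul_div,
          div_le_div_iff₀ (by positivity) (by positivity)]
        nlinarith [mul_nonneg (norm_nonneg d) (norm_nonneg d)]
  have h2 : ‖comp (comp d C.val) (adj d) - a‖ < η / 2 := hn
  linarith

theorem compactlyContained_cut (a : PosElt X) {ε : ℝ} (hε : 0 < ε) :
    CompactlyContained (mk (a.cut hε.le)) (mk a) :=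
  compactlyContained_of_localUnit a.mem a.pos _ _ (a.localUnit_cut hε)

theorem one_div_succ_nonneg (n : ℕ) : (0 : ℝ) ≤ 1 / ((n : ℝ) + 1) := by positivity

theorem one_div_succ_lt {n m : ℕ} (h : n < m) : 1 / ((m : ℝ) + 1) < 1 / ((n : ℝ) + 1) := by
  have : (n : ℝ) < m := by exact_mod_cast h
  gcongr

theorem isLUB_cut (a : PosElt X) :
    IsLUB (Set.range fun n : ℕ => mk (a.cut (one_div_succ_nonneg n))) (mk a) := by
  refine ⟨?_, fun t => ?_⟩
  · rintro _ ⟨n, rfl⟩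
    exact mk_le_mk.2 (a.cut_le (by positivity))
  · induction t using CuG.ind with
    | h t =>
      refine fun ht => mk_le_mk.2 (le_of_forall_cut_le fun ε hε => ?_)
      obtain ⟨n, hn⟩ := exists_nat_one_div_lt hε
      exact (cut_le_cut a (one_div_succ_nonneg n) hn).trans (mk_le_mk.1 (ht ⟨n, rfl⟩))

theorem rapidlyIncreasing_cut (a : PosElt X) :
    RapidlyIncreasing fun n : ℕ => mk (a.cut (one_div_succ_nonneg n)) := fun n => by
  have h0 : 0 < 1 / ((n : ℝ) + 1) - 1 / (((n + 1 : ℕ) : ℝ) + 1) :=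
    sub_pos.2 (one_div_succ_lt n.lt_succ_self)
  have h := compactlyContained_cut (a.cut (one_div_succ_nonneg (n + 1))) h0
  rw [PosElt.cut_cut] at h
  simpa only [add_sub_cancel] using h

theorem RapidlyIncreasing.monotone {S : Type*} [Preorder S] {u : ℕ → S} (h : RapidlyIncreasing u) :
    Monotone u := monotone_nat_of_le_succ fun n => (h n).le

/-- Compact containment in `[b]` is detected by the cut-downs of `b`. -/
theorem exists_le_cut {s : CuG X} {b : PosElt X} (h : CompactlyContained s (mk b)) :
    ∃ (ε : ℝ) (hε : 0 < ε), s ≤ mk (b.cut hε.le) := by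
  obtain ⟨k, hk⟩ := h _ (RapidlyIncreasing.monotone (rapidlyIncreasing_cut b)) _ (isLUB_cut b) le_rfl
  exact ⟨1 / ((k : ℝ) + 1), by positivity, hk⟩

end CuG

namespace PosElt

section sums
variable {μ ν : URep G} {a c : OpFam X.carrier μ.H μ.H} {b d : OpFam X.carrier ν.H ν.H}

/-- Direct sums of local units are local units. -/
theorem _root_.EqCuntz.OpFam.LocalUnit.sum (h : LocalUnit X μ a c) (h' : LocalUnit X ν b d) :
    LocalUnit X (μ.sum ν) (cj (inL μ.H ν.H) a + cj (inR μ.H ν.H) b)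
      (cj (inL μ.H ν.H) c + cj (inR μ.H ν.H) d) := by
  obtain ⟨f, hf, hfc⟩ := h
  obtain ⟨g, hg, hgd⟩ := h'
  refine ⟨cj (inL μ.H ν.H) f + cj (inR μ.H ν.H) g, invK_add (cj_mem (intertwines_inL μ ν) hf)
    (cj_mem (intertwines_inR μ ν) hg), ?_⟩
  have h1 : comp (comp (cj (inL μ.H ν.H) f + cj (inR μ.H ν.H) g)
      (cj (inL μ.H ν.H) a + cj (inR μ.H ν.H) b)) (adj (cj (inL μ.H ν.H) f + cj (inR μ.H ν.H) g))
      = cj (inL μ.H ν.H) (comp (comp f a) (adj f)) + cj (inR μ.H ν.H) (comp (comp g b) (adj g)) :=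
    sum_mono_aux a b f g
  have key : ∀ {K₁ K₂ K₃ K₄ : Type} [NormedAddCommGroup K₁] [InnerProductSpace ℂ K₁]
      [NormedAddCommGroup K₂] [InnerProductSpace ℂ K₂]
      [NormedAddCommGroup K₃] [InnerProductSpace ℂ K₃]
      [NormedAddCommGroup K₄] [InnerProductSpace ℂ K₄]
      (S : K₂ →L[ℂ] K₃) (T : K₁ →L[ℂ] K₂) (z : OpFam X.carrier K₄ K₁),
      comp (mult S) (comp (mult T) z) = comp (mult (S ∘L T)) z := by
    intro K₁ K₂ K₃ K₄ _ _ _ _ _ _ _ _ S T z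
    rw [← comp_assoc, mult_comp_mult]
  have h2 : ∀ (p : OpFam X.carrier μ.H μ.H) (q : OpFam X.carrier ν.H ν.H),
      comp (cj (inL μ.H ν.H) p + cj (inR μ.H ν.H) q) (cj (inL μ.H ν.H) c + cj (inR μ.H ν.H) d)
        = cj (inL μ.H ν.H) (comp p c) + cj (inR μ.H ν.H) (comp q d) := fun p q => by
    simp only [cj, comp_add, add_comp, comp_assoc, key,
      adjoint_inL_inL, adjoint_inR_inR, adjoint_inL_inR, adjoint_inR_inL, mult_id_comp, mult_zero,
      zero_comp, comp_zero, add_zero, zero_add]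
  rw [h1, h2, hfc, hgd]

end sums

theorem IsApproxSup.sum {a b : ℕ → PosElt X} {C D : PosElt X} (ha : IsApproxSup a C)
    (hb : IsApproxSup b D) : IsApproxSup (fun n => PosElt.sum (a n) (b n)) (PosElt.sum C D) := by
  refine ⟨fun n => sum_mono (ha.le n) (hb.le n), fun ε hε => ?_⟩
  filter_upwards [ha.approx (ε / 2) (half_pos hε), hb.approx (ε / 2) (half_pos hε)]
    with n ⟨x, hx, hxp, hxn, hxle⟩ ⟨y, hy, hyp, hyn, hyle⟩
  have h1 := sum_mono hxle hyle
  have h2 := norm_cj_le (X := X) (norm_inL_le (H := C.rep.H) (K := D.rep.H)) (x - C.val)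
  have h3 := norm_cj_le (X := X) (norm_inR_le (H := C.rep.H) (K := D.rep.H)) (y - D.val)
  have h4 : ‖cj (inL C.rep.H D.rep.H) x + cj (inR C.rep.H D.rep.H) y
      - (cj (inL C.rep.H D.rep.H) C.val + cj (inR C.rep.H D.rep.H) D.val)‖ < ε := by
    rw [add_sub_add_comm, ← cj_sub, ← cj_sub]
    exact (norm_add_le _ _).trans_lt (by linarith)
  refine ⟨cj (inL C.rep.H D.rep.H) x + cj (inR C.rep.H D.rep.H) y,
    (PosElt.sum ⟨C.rep, x, hx, hxp⟩ ⟨D.rep, y, hy, hyp⟩).mem,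
    (PosElt.sum ⟨C.rep, x, hx, hxp⟩ ⟨D.rep, y, hy, hyp⟩).pos, ?_, ?_⟩
  · exact h4
  · exact h1

end PosElt

namespace CuG
open PosElt

theorem add_le_add' {s s' t t' : CuG X} (h : s ≤ s') (h' : t ≤ t') : s + t ≤ s' + t' := by
  induction s using CuG.ind with | h s => ?_
  induction s' using CuG.ind with | h s' => ?_
  induction t using CuG.ind with | h t => ?_
  induction t' using CuG.ind with | h t' => ?_
  exact mk_le_mk.2 (sum_mono (mk_le_mk.1 h) (mk_le_mk.1 h'))

theorem isCuSemigroup (X : GCStar.{u} G) : IsCuSemigroup (CuG X) where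
  add_mono _ _ _ _ := add_le_add'
  exists_sup u hu := by
    obtain ⟨a, C, rfl, hC⟩ := exists_isApproxSup hu
    exact ⟨mk C, isLUB_of_isApproxSup hC⟩
  exists_rapid s := by
    induction s using CuG.ind with
    | h s => exact ⟨_, rapidlyIncreasing_cut s, isLUB_cut s⟩
  sup_add u w hu hw s t hs ht := by
    obtain ⟨a, C, rfl, hC⟩ := exists_isApproxSup hu
    obtain ⟨b, D, rfl, hD⟩ := exists_isApproxSup hw
    rw [hs.unique (isLUB_of_isApproxSup hC), ht.unique (isLUB_of_isApproxSup hD)]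
    exact isLUB_of_isApproxSup (hC.sum hD)
  add_compact s₁ s₂ t₁ t₂ h₁ h₂ := by
    induction t₁ using CuG.ind with | h b₁ => ?_
    induction t₂ using CuG.ind with | h b₂ => ?_
    obtain ⟨ε₁, hε₁, h₁⟩ := exists_le_cut h₁
    obtain ⟨ε₂, hε₂, h₂⟩ := exists_le_cut h₂
    exact CompactlyContained.mono (add_le_add' h₁ h₂) le_rfl
      (compactlyContained_of_localUnit (PosElt.sum b₁ b₂).mem (PosElt.sum b₁ b₂).pos
        (PosElt.sum (b₁.cut hε₁.le) (b₂.cut hε₂.le)).mem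
        (PosElt.sum (b₁.cut hε₁.le) (b₂.cut hε₂.le)).pos
        ((b₁.localUnit_cut hε₁).sum (b₂.localUnit_cut hε₂)))

/-! ### Functoriality -/

theorem map_mono (φ : X ⟶ Y) : Monotone (map φ) := fun s t h => by
  induction s using CuG.ind with | h s => ?_
  induction t using CuG.ind with | h t => ?_
  exact mk_le_mk.2 (PosElt.map_mono φ (mk_le_mk.1 h))

theorem _root_.EqCuntz.PosElt.IsApproxSup.map {a : ℕ → PosElt X} {C : PosElt X}
    (h : IsApproxSup a C) (φ : X ⟶ Y) :
    IsApproxSup (fun n => PosElt.map φ (a n)) (PosElt.map φ C) := by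
  refine ⟨fun n => PosElt.map_mono φ (h.le n), fun ε hε => ?_⟩
  filter_upwards [h.approx ε hε] with n ⟨x, hx, hxp, hxn, hxle⟩
  have h1 := PosElt.map_mono φ hxle
  have h2 : ‖mapHom φ.toHom x - mapHom φ.toHom C.val‖ < ε := by
    rw [← mapHom_sub]
    exact (norm_mapHom_le _ _).trans_lt hxn
  refine ⟨mapHom φ.toHom x, invK_mapHom φ hx, (PosElt.map φ ⟨C.rep, x, hx, hxp⟩).pos, ?_, ?_⟩
  · exact h2
  · exact h1

theorem _root_.EqCuntz.OpFam.LocalUnit.map {μ : URep G} {a c : OpFam X.carrier μ.H μ.H}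
    (h : LocalUnit X μ a c) (φ : X ⟶ Y) :
    LocalUnit Y μ (mapHom φ.toHom a) (mapHom φ.toHom c) := by
  obtain ⟨f, hf, hfc⟩ := h
  exact ⟨mapHom φ.toHom f, invK_mapHom φ hf, by
    rw [← mapHom_adj, ← mapHom_comp, ← mapHom_comp, ← mapHom_comp, hfc]⟩

theorem isCuMorphism_map (φ : X ⟶ Y) : IsCuMorphism (map φ) where
  map_zero := rfl
  map_add s t := by
    induction s using CuG.ind with | h s => ?_
    induction t using CuG.ind with | h t => ?_
    have h : PosElt.map φ (PosElt.sum s t) = PosElt.sum (PosElt.map φ s) (PosElt.map φ t) := by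
      have h' : mapHom φ.toHom (cj (inL s.rep.H t.rep.H) s.val + cj (inR s.rep.H t.rep.H) t.val)
          = cj (inL s.rep.H t.rep.H) (mapHom φ.toHom s.val)
            + cj (inR s.rep.H t.rep.H) (mapHom φ.toHom t.val) := by
        rw [mapHom_add, mapHom_cj, mapHom_cj]
      unfold PosElt.map PosElt.sum
      congr 1
    exact congrArg mk h
  mono := map_mono φ
  map_sup u hu s hs := by
    obtain ⟨a, C, rfl, hC⟩ := exists_isApproxSup hu
    rw [hs.unique (isLUB_of_isApproxSup hC)]
    exact isLUB_of_isApproxSup (hC.map φ)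
  map_compact s t h := by
    induction t using CuG.ind with | h b => ?_
    obtain ⟨ε, hε, h⟩ := exists_le_cut h
    exact CompactlyContained.mono (map_mono φ h) le_rfl
      (compactlyContained_of_localUnit (PosElt.map φ b).mem (PosElt.map φ b).pos
        (PosElt.map φ (b.cut hε.le)).mem (PosElt.map φ (b.cut hε.le)).pos
        ((b.localUnit_cut hε).map φ))

end CuG

end

/-! ### Compact operators and strict positivity -/

section

section Operators

variable {H K L : Type*} [NormedAddCommGroup H] [InnerProductSpace ℂ H]
  [NormedAddCommGroup K] [InnerProductSpace ℂ K] [NormedAddCommGroup L] [InnerProductSpace ℂ L]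

/-- Multiplying a compact operator from the left turns bounded strong convergence into norm
convergence. -/
theorem tendsto_norm_comp_of_isCompactOperator {q : ℕ → H →L[ℂ] L} {M : ℝ} (hM : ∀ n, ‖q n‖ ≤ M)
    (hq : ∀ z, Tendsto (fun n => q n z) atTop (𝓝 0)) {x : K →L[ℂ] H} (hx : IsCompactOperator x) :
    Tendsto (fun n => ‖q n ∘L x‖) atTop (𝓝 0) := by
  have hM0 : 0 ≤ M := (norm_nonneg _).trans (hM 0)
  have hK : TotallyBounded (x '' Metric.closedBall 0 1) :=
    (hx.isCompact_closure_image_closedBall (𝕜₁ := ℂ) (f := x.toLinearMap) 1).totallyBounded.subset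
      subset_closure
  refine squeeze_zero' (Eventually.of_forall fun _ => norm_nonneg _) (g := fun n => ‖q n ∘L x‖)
    (Eventually.of_forall fun _ => le_rfl) (Metric.tendsto_nhds.2 fun ε hε => ?_)
  have hδ : 0 < ε / (2 * (M + 1)) := by positivity
  obtain ⟨t, ht, hcov⟩ := Metric.totallyBounded_iff.1 hK _ hδ
  have hev : ∀ᶠ n in atTop, ∀ y ∈ t, ‖q n y‖ < ε / 4 := by
    refine (eventually_all_finite ht).2 fun y _ => ?_
    have := (hq y).norm
    rw [norm_zero] at this
    exact this.eventually_lt_const (by positivity)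
  filter_upwards [hev] with n hn
  rw [Real.dist_eq, sub_zero, abs_of_nonneg (norm_nonneg _)]
  refine (ContinuousLinearMap.opNorm_le_of_unit_norm (C := 3 * ε / 4) (by positivity)
    fun u hu => ?_).trans_lt (by linarith)
  obtain ⟨y, hy, hxy⟩ := Set.mem_iUnion₂.1 (hcov ⟨u, by simp [hu], rfl⟩)
  have h1 : ‖q n (x u - y)‖ ≤ ε / 2 := by
    refine ((q n).le_opNorm _).trans ?_
    have h2 : ‖x u - y‖ ≤ ε / (2 * (M + 1)) := by
      rw [← dist_eq_norm]; exact (Metric.mem_ball.1 hxy).le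
    calc _ ≤ M * (ε / (2 * (M + 1))) := by gcongr; exact hM n
      _ ≤ (M + 1) * (ε / (2 * (M + 1))) := by gcongr; linarith
      _ = ε / 2 := by field_simp
  have e : (q n ∘L x) u = q n (x u - y) + q n y := by simp
  rw [e]
  refine (norm_add_le _ _).trans ?_
  linarith [hn y hy]

variable [CompleteSpace H]

/-- The range of a self-adjoint operator is the orthogonal complement of its kernel. -/
theorem denseRange_of_injective {s : H →L[ℂ] H} (hs : IsSelfAdjoint s)
    (hinj : ∀ z, s z = 0 → z = 0) : DenseRange s := by
  have h1 : (LinearMap.range s.toLinearMap).topologicalClosure = ⊤ := by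
    rw [Submodule.topologicalClosure_eq_top_iff, Submodule.eq_bot_iff]
    intro z hz
    refine hinj z (ext_inner_right ℂ fun w => ?_)
    have h2 := (Submodule.mem_orthogonal' _ _).1 hz (s w) ⟨w, rfl⟩
    rw [inner_zero_left, ← ContinuousLinearMap.adjoint_inner_right,
      ContinuousLinearMap.isSelfAdjoint_iff'.1 hs, h2]
  intro z
  have h2 : z ∈ (LinearMap.range s.toLinearMap).topologicalClosure := h1 ▸ Submodule.mem_top
  rwa [← SetLike.mem_coe, Submodule.topologicalClosure_coe] at h2

/-- A bounded sequence of operators which is annihilated in norm by an injective self-adjoint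
operator is annihilated in norm by every compact operator. -/
theorem tendsto_norm_comp_of_injective {s : H →L[ℂ] H} (hs : IsSelfAdjoint s)
    (hinj : ∀ z, s z = 0 → z = 0) {q : ℕ → H →L[ℂ] L} {M : ℝ} (hM : ∀ n, ‖q n‖ ≤ M)
    (hq : Tendsto (fun n => ‖q n ∘L s‖) atTop (𝓝 0)) {x : K →L[ℂ] H} (hx : IsCompactOperator x) :
    Tendsto (fun n => ‖q n ∘L x‖) atTop (𝓝 0) := by
  have hM0 : 0 ≤ M := (norm_nonneg _).trans (hM 0)
  refine tendsto_norm_comp_of_isCompactOperator hM (fun z => ?_) hx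
  refine Metric.tendsto_nhds.2 fun ε hε => ?_
  obtain ⟨w, hw⟩ := (denseRange_of_injective hs hinj).exists_dist_lt z
    (show 0 < ε / (2 * (M + 1)) by positivity)
  filter_upwards [hq.eventually_lt_const (show 0 < ε / (2 * (‖w‖ + 1)) by positivity)] with n hn
  have e : q n z = q n (z - s w) + (q n ∘L s) w := by simp
  rw [dist_zero_right, e]
  have h1 : ‖q n (z - s w)‖ ≤ M * (ε / (2 * (M + 1))) := by
    refine ((q n).le_opNorm _).trans ?_
    rw [dist_eq_norm] at hw
    gcongr
    exact hM n
  have h2 : ‖(q n ∘L s) w‖ ≤ ε / (2 * (‖w‖ + 1)) * ‖w‖ :=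
    ((q n ∘L s).le_opNorm _).trans (by gcongr)
  have h3 : M * (ε / (2 * (M + 1))) < ε / 2 := by
    rw [mul_div_assoc', div_lt_div_iff₀ (by positivity) (by positivity)]
    nlinarith
  have h4 : ε / (2 * (‖w‖ + 1)) * ‖w‖ < ε / 2 := by
    rw [div_mul_eq_mul_div, div_lt_div_iff₀ (by positivity) (by positivity)]
    nlinarith [norm_nonneg w]
  exact (norm_add_le _ _).trans_lt (by linarith)

/-- The C*-algebra of compact operators. -/
def compactAlg (H : Type*) [NormedAddCommGroup H] [InnerProductSpace ℂ H] [CompleteSpace H] :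
    NonUnitalStarSubalgebra ℂ (H →L[ℂ] H) where
  carrier := {T | IsCompactOperator T}
  add_mem' h h' := h.add h'
  zero_mem' := isCompactOperator_zero
  mul_mem' h _ := h.comp_clm _
  smul_mem' c _ h := h.smul c
  star_mem' h := isCompactOperator_adjoint h

theorem isClosed_compactAlg : IsClosed (compactAlg H : Set (H →L[ℂ] H)) :=
  isClosed_setOfPred_isCompactOperator

/-- An injective positive operator `s` generates an approximate unit for the compact operators,
inside any closed subalgebra containing `s`, whose squares have the form `f s f^*`. -/
theorem exists_approxUnit_injective {S : NonUnitalStarSubalgebra ℂ (H →L[ℂ] H)}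
    (hS : IsClosed (S : Set (H →L[ℂ] H))) {s : H →L[ℂ] H} (hsS : s ∈ S) (hs : s.IsPositive)
    (hinj : ∀ z, s z = 0 → z = 0) {x : K →L[ℂ] H} (hx : IsCompactOperator x) {ε : ℝ} (hε : 0 < ε) :
    ∃ p ∈ S, ∃ f ∈ S, star p = p ∧ ‖p‖ ≤ 1 ∧ f * s * star f = p * p ∧ ‖p ∘L x - x‖ < ε ∧
      ∃ C : ℝ, 0 ≤ C ∧ p * p ≤ (C : ℂ) • s := by
  have hpos : ∃ y, s = star y * y := by
    obtain ⟨R, hR⟩ := exists_adjoint_comp hs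
    exact ⟨R, hR⟩
  choose p hp f hf hps hpn hfp hsp _ y hy using fun n : ℕ =>
    exists_approxUnit_mem hS hsS hpos (η := 1 / ((n : ℝ) + 1)) (by positivity)
  have hssa : star s = s := hs.isSelfAdjoint
  have hM : ∀ n, ‖p n - 1‖ ≤ 2 := fun n => by
    have h1 : ‖(1 : H →L[ℂ] H)‖ ≤ 1 := ContinuousLinearMap.norm_id_le
    exact (norm_sub_le _ _).trans (by linarith [hpn n])
  have h0 : Tendsto (fun n => ‖(p n - 1) ∘L s‖) atTop (𝓝 0) := by
    refine squeeze_zero (fun _ => norm_nonneg _) (fun n => ?_)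
      (tendsto_one_div_add_atTop_nhds_zero_nat (𝕜 := ℝ))
    have e : (p n - 1) ∘L s = star (s * p n - s) := by
      rw [star_sub, star_mul, hssa, hps]
      change (p n - 1) * s = _
      rw [sub_mul, one_mul]
    rw [e, norm_star]
    exact hsp n
  obtain ⟨n, hn⟩ := ((tendsto_norm_comp_of_injective hs.isSelfAdjoint hinj hM h0 hx).eventually_lt_const
    hε).exists
  refine ⟨p n, hp n, f n, hf n, hps n, hpn n, hfp n, ?_, (1 / ((n : ℝ) + 1))⁻¹, by positivity, ?_⟩
  · have e : (p n - 1) ∘L x = p n ∘L x - x := by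
      rw [ContinuousLinearMap.sub_comp]; rfl
    rwa [← e]
  · rw [← sub_nonneg, hy n]
    exact star_mul_self_nonneg _

end Operators

end

section

section StrictPos

variable {H : Type} [NormedAddCommGroup H] [InnerProductSpace ℂ H] [CompleteSpace H]

open scoped ComplexOrder

/-- Vector states show that a strictly positive operator is injective. -/
theorem IsStrictlyPos.injective {s : compactOperator (RingHom.id ℂ) H H} (hs : IsStrictlyPos s)
    (z : H) (hz : s.1 z = 0) : z = 0 := by
  by_contra hne
  let τ : compactOperator (RingHom.id ℂ) H H →ₗ[ℂ] ℂ :=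
    { toFun := fun x => inner ℂ z (x.1 z)
      map_add' := fun x y => by
        change inner ℂ z (x.1 z + y.1 z) = _
        rw [inner_add_right]
      map_smul' := fun c x => by
        change inner ℂ z (c • x.1 z) = _
        rw [inner_smul_right]; rfl }
  have hc : IsCompactOperator (InnerProductSpace.rankOne ℂ z z : H →L[ℂ] H) :=
    isCompactOperator_of_finiteDim_range (E := Submodule.span ℂ {z}) fun x => by
      rw [InnerProductSpace.rankOne_apply]
      exact Submodule.smul_mem _ _ (Submodule.mem_span_singleton_self z)
  have h := hs.2 τ (fun x hx => hx.inner_nonneg_right z) fun h0 => by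
    have h1 : τ ⟨_, hc⟩ = 0 := by rw [h0]; rfl
    have h2 : inner ℂ z ((InnerProductSpace.rankOne ℂ z z : H →L[ℂ] H) z) = 0 := h1
    rw [InnerProductSpace.rankOne_apply, inner_smul_right] at h2
    simp [hne] at h2
  have h3 : τ s = 0 := by
    change inner ℂ z (s.1 z) = 0
    rw [hz, inner_zero_right]
  exact h.ne' h3

/-- Compression of a positive operator by a self-adjoint `p`: `x ≤ 2 p x p + 2 (1 - p) x (1 - p)`. -/
theorem le_two_smul_compress {x p : H →L[ℂ] H} (hx : 0 ≤ x) (hp : star p = p) :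
    x ≤ (2 : ℂ) • (p * x * p) + (2 : ℂ) • ((1 - p) * x * (1 - p)) := by
  rw [← sub_nonneg]
  have h : 0 ≤ (2 * p - 1) * x * star (2 * p - 1) := star_right_conjugate_nonneg hx _
  have h1 : star (2 * p - 1) = 2 * p - 1 := by simp [hp, two_mul]
  rw [h1] at h
  convert h using 1
  simp only [two_smul, two_mul]
  noncomm_ring

/-- `x` is dominated by multiples of an injective positive compact operator, up to positive
compact errors of arbitrarily small norm. -/
theorem exists_le_smul_add {s : H →L[ℂ] H} (hsc : IsCompactOperator s) (hs : 0 ≤ s)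
    (hinj : ∀ z, s z = 0 → z = 0) {x : H →L[ℂ] H} (hxc : IsCompactOperator x) (hx : 0 ≤ x)
    {ε : ℝ} (hε : 0 < ε) :
    ∃ C : ℝ, ∃ r : H →L[ℂ] H, IsCompactOperator r ∧ 0 ≤ r ∧ ‖r‖ ≤ ε ∧ x ≤ (C : ℂ) • s + r := by
  obtain ⟨p, -, f, -, hps, hpn, -, hpx, C, hC, hCs⟩ := exists_approxUnit_injective
    isClosed_compactAlg (show s ∈ compactAlg H from hsc)
    ((ContinuousLinearMap.nonneg_iff_isPositive s).1 hs) hinj hxc (show 0 < ε / 4 by positivity)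
  have h1p : star (1 - p) = 1 - p := by simp [hps]
  have h1 : p * x * p ≤ ((‖x‖ * C : ℝ) : ℂ) • s := by
    have h2 : x ≤ algebraMap ℝ _ ‖x‖ := IsSelfAdjoint.le_algebraMap_norm_self (.of_nonneg hx)
    have h3 := star_right_conjugate_le_conjugate h2 p
    rw [hps, ← Algebra.commutes, mul_assoc, ← Algebra.smul_def] at h3
    refine h3.trans ?_
    have h4 := smul_le_smul_of_nonneg_left hCs (norm_nonneg x)
    refine h4.trans_eq ?_
    rw [← Complex.coe_smul, smul_smul]
    push_cast
    rfl
  refine ⟨2 * (‖x‖ * C), (2 : ℂ) • ((1 - p) * x * (1 - p)), ?_, ?_, ?_, ?_⟩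
  · have h2 : ∀ q : H →L[ℂ] H, IsCompactOperator ((q ∘L x) ∘L q) := fun q =>
      (hxc.clm_comp q).comp_clm q
    exact (h2 (1 - p)).smul (2 : ℂ)
  · have := star_right_conjugate_nonneg hx (1 - p)
    rw [h1p] at this
    rw [two_smul]
    exact add_nonneg this this
  · have h2 : ‖(1 - p) * x‖ ≤ ε / 4 := by
      have e : (1 - p) * x = -(p ∘L x - x) := by
        rw [sub_mul, one_mul, neg_sub]; rfl
      rw [e, norm_neg]; exact hpx.le
    have h3 : ‖1 - p‖ ≤ 2 := by
      have h1 : ‖(1 : H →L[ℂ] H)‖ ≤ 1 := ContinuousLinearMap.norm_id_le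
      exact (norm_sub_le _ _).trans (by linarith)
    rw [norm_smul]
    calc _ ≤ ‖(2 : ℂ)‖ * (ε / 4 * 2) := by
          gcongr; exact (norm_mul_le _ _).trans (by gcongr)
      _ = ε := by norm_num; ring
  · refine (le_two_smul_compress hx hps).trans ?_
    gcongr
    rw [two_smul, Complex.ofReal_mul, mul_smul, Complex.ofReal_ofNat, two_smul]
    exact add_le_add h1 h1

/-- An injective positive compact operator is strictly positive. -/
theorem isStrictlyPos_of_injective {s : compactOperator (RingHom.id ℂ) H H} (hs : s.1.IsPositive)
    (hinj : ∀ z, s.1 z = 0 → z = 0) : IsStrictlyPos s := by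
  refine ⟨hs, fun τ hτ hne => ?_⟩
  have hs0 : 0 ≤ s.1 := (ContinuousLinearMap.nonneg_iff_isPositive _).2 hs
  refine lt_of_le_of_ne (hτ s hs) fun h0 => hne ?_
  have hmono : ∀ x y : compactOperator (RingHom.id ℂ) H H, x.1 ≤ y.1 → τ x ≤ τ y := by
    intro x y hxy
    rw [← sub_nonneg, ← map_sub]
    exact hτ _ hxy
  have hpos : ∀ x : compactOperator (RingHom.id ℂ) H H, 0 ≤ x.1 → τ x = 0 := by
    intro x hx
    choose C r hrc hr hrn hle using fun n : ℕ => exists_le_smul_add s.2 hs0 hinj x.2 hx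
      (show 0 < (1 / 4 : ℝ) ^ n by positivity)
    -- all the errors are absorbed by the single operator `∑ 2ⁿ rₙ`
    have hsum : Summable fun n => (2 : ℂ) ^ n • r n := by
      refine Summable.of_norm_bounded (g := fun n => (1 / 2 : ℝ) ^ n)
        (summable_geometric_of_lt_one (by norm_num) (by norm_num)) fun n => ?_
      rw [norm_smul, norm_pow]
      calc _ ≤ ‖(2 : ℂ)‖ ^ n * (1 / 4) ^ n := by gcongr; exact hrn n
        _ = (1 / 2) ^ n := by rw [← mul_pow]; norm_num
    have hpos' : ∀ n, 0 ≤ (2 : ℂ) ^ n • r n := fun n => by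
      have := smul_nonneg (show (0 : ℝ) ≤ 2 ^ n by positivity) (hr n)
      rw [← Complex.coe_smul] at this
      simpa using this
    have hRc : ∑' n, (2 : ℂ) ^ n • r n ∈ compactAlg H :=
      isClosed_compactAlg.mem_of_tendsto hsum.hasSum (Eventually.of_forall fun t =>
        sum_mem fun n _ => SMulMemClass.smul_mem ((2 : ℂ) ^ n) (show r n ∈ compactAlg H from hrc n))
    have hle' : ∀ n, (2 : ℂ) ^ n * τ x ≤ τ ⟨_, hRc⟩ := fun n => by
      have h1 : τ x ≤ τ ((C n : ℂ) • s + ⟨r n, hrc n⟩) := hmono _ _ (hle n)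
      rw [map_add, map_smul, ← h0, smul_zero, zero_add] at h1
      have h2 : τ ((2 : ℂ) ^ n • ⟨r n, hrc n⟩) ≤ τ ⟨_, hRc⟩ :=
        hmono _ _ (hsum.le_tsum n fun j _ => hpos' j)
      rw [map_smul, smul_eq_mul] at h2
      refine le_trans ?_ h2
      have h3 : (0 : ℂ) ≤ 2 ^ n := by
        simp
      exact mul_le_mul_of_nonneg_left h1 h3
    have hx0 : 0 ≤ τ x := hτ x ((ContinuousLinearMap.nonneg_iff_isPositive _).1 hx)
    obtain ⟨t, ht0, ht⟩ : ∃ t : ℝ, 0 ≤ t ∧ τ x = t :=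
      ⟨(τ x).re, (Complex.le_def.1 hx0).1, (Complex.eq_re_of_ofReal_le hx0)⟩
    have hb : ∀ n : ℕ, 2 ^ n * t ≤ (τ ⟨_, hRc⟩).re := fun n => by
      have := (Complex.le_def.1 (hle' n)).1
      rw [ht] at this
      have e : ((2 : ℂ) ^ n * t) = ((2 ^ n * t : ℝ) : ℂ) := by push_cast; rfl
      rwa [e, Complex.ofReal_re] at this
    have : t = 0 := by
      by_contra hne
      have htp : 0 < t := lt_of_le_of_ne ht0 (Ne.symm hne)
      obtain ⟨n, hn⟩ := pow_unbounded_of_one_lt ((τ ⟨_, hRc⟩).re / t) (one_lt_two)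
      rw [div_lt_iff₀ htp] at hn
      linarith [hb n]
    rw [ht, this]; simp
  have hsa : ∀ x : compactOperator (RingHom.id ℂ) H H, IsSelfAdjoint x.1 → τ x = 0 := by
    intro x hx
    have hp : IsCompactOperator (x.1⁺ : H →L[ℂ] H) :=
      cfcₙ_real_mem (S := compactAlg H) isClosed_compactAlg _ x.2
    have hn : IsCompactOperator (x.1⁻ : H →L[ℂ] H) :=
      cfcₙ_real_mem (S := compactAlg H) isClosed_compactAlg _ x.2
    have h1 := hpos ⟨x.1⁺, hp⟩ (CFC.posPart_nonneg x.1)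
    have h2 := hpos ⟨x.1⁻, hn⟩ (CFC.negPart_nonneg x.1)
    have e : x = (⟨x.1⁺, hp⟩ : compactOperator (RingHom.id ℂ) H H) - ⟨x.1⁻, hn⟩ :=
      Subtype.ext (CFC.posPart_sub_negPart x.1 hx).symm
    rw [e, map_sub, h1, h2, sub_zero]
  ext x
  have hxs : star x.1 ∈ compactAlg H := star_mem (show x.1 ∈ compactAlg H from x.2)
  let xs : compactOperator (RingHom.id ℂ) H H := ⟨star x.1, hxs⟩
  have h1 : τ (x + xs) = 0 := hsa _ (by
    change star (x.1 + star x.1) = x.1 + star x.1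
    rw [star_add, star_star, add_comm])
  have h2 : τ (Complex.I • (xs - x)) = 0 := hsa _ (by
    change star (Complex.I • (star x.1 - x.1)) = Complex.I • (star x.1 - x.1)
    rw [star_smul, star_sub, star_star, RCLike.star_def, Complex.conj_I, neg_smul, ← smul_neg,
      neg_sub])
  rw [map_smul, smul_eq_mul, mul_eq_zero, map_sub] at h2
  rw [map_add] at h1
  have h3 : τ xs - τ x = 0 := h2.resolve_left Complex.I_ne_zero
  have h4 : 2 * τ x = 0 := by linear_combination h1 - h3
  simpa using h4

end StrictPos

end

/-! ### Invariant strictly positive operators -/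

section

section Haar

variable {G : Type v} [Group G] [TopologicalSpace G]

open MeasureTheory InnerProductSpace
open scoped ComplexOrder

theorem isPositive_rankOne {H : Type*} [NormedAddCommGroup H] [InnerProductSpace ℂ H]
    [CompleteSpace H] (x : H) : (0 : H →L[ℂ] H) ≤ rankOne ℂ x x := by
  rw [ContinuousLinearMap.nonneg_iff_isPositive, ContinuousLinearMap.isPositive_iff_complex]
  intro z
  rw [rankOne_apply, inner_smul_left, inner_conj_symm, inner_mul_symm_re_eq_norm]
  rw [← inner_conj_symm z x, RCLike.conj_mul]
  constructor
  · simp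
  · positivity

theorem continuous_rankOne_self {H : Type*} [NormedAddCommGroup H] [InnerProductSpace ℂ H] :
    Continuous fun x : H => (rankOne ℂ x x : H →L[ℂ] H) := by
  have h : Continuous fun x : H => (innerSL ℂ x).smulRight x :=
    (ContinuousLinearMap.smulRightL ℂ H H).continuous₂.comp
      ((innerSL ℂ (E := H)).continuous.prodMk continuous_id)
  convert h using 2 with x
  ext z
  simp [rankOne_apply]

/-- A strictly positive element of `K(H)` with a continuous orbit map, before averaging. -/
theorem exists_continuous_orbit (ν : URep G) : ∃ F : G → ν.H →L[ℂ] ν.H, Continuous F ∧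
    (∀ g, IsCompactOperator (F g)) ∧ (∀ g, 0 ≤ F g) ∧ (∀ z, inner ℂ z (F 1 z) = 0 → z = 0) ∧
    ∀ h g, ν.op h * F g * ν.op h⁻¹ = F (h * g) := by
  obtain ⟨ξ, hξ⟩ := TopologicalSpace.exists_dense_seq ν.H
  set c : ℕ → ℝ := fun n => (1 / 2) ^ n / (1 + ‖ξ n‖ * ‖ξ n‖) with hc
  have hc0 : ∀ n, 0 < c n := fun n => by positivity
  set T : ℕ → G → ν.H →L[ℂ] ν.H := fun n g => c n • rankOne ℂ (ν.ρ g (ξ n)) (ν.ρ g (ξ n)) with hT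
  have hTn : ∀ n g, ‖T n g‖ ≤ (1 / 2 : ℝ) ^ n := fun n g => by
    rw [hT]
    simp only [norm_smul, norm_rankOne, LinearIsometryEquiv.norm_map]
    rw [Real.norm_of_nonneg (hc0 n).le, hc, div_mul_eq_mul_div, div_le_iff₀ (by positivity)]
    have : (0 : ℝ) < (1 / 2) ^ n := by positivity
    nlinarith
  have hgs : Summable fun n : ℕ => (1 / 2 : ℝ) ^ n :=
    summable_geometric_of_lt_one (by norm_num) (by norm_num)
  have hsum : ∀ g, Summable fun n => T n g := fun g => .of_norm_bounded hgs fun n => hTn n g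
  have hTp : ∀ n g, 0 ≤ T n g := fun n g => smul_nonneg (hc0 n).le (isPositive_rankOne _)
  refine ⟨fun g => ∑' n, T n g, ?_, fun g => ?_, fun g => tsum_nonneg fun n => hTp n g,
    fun z hz => ?_, fun h g => ?_⟩
  · refine continuous_tsum (fun n => ?_) hgs hTn
    exact Continuous.const_smul (continuous_rankOne_self.comp (ν.cont (ξ n))) (c n)
  · refine isClosed_compactAlg.mem_of_tendsto (hsum g).hasSum (Eventually.of_forall fun t =>
      sum_mem fun n _ => ?_)
    have h1 : IsCompactOperator (rankOne ℂ (ν.ρ g (ξ n)) (ν.ρ g (ξ n)) : ν.H →L[ℂ] ν.H) :=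
      isCompactOperator_of_finiteDim_range (E := Submodule.span ℂ {ν.ρ g (ξ n)}) fun x => by
        rw [rankOne_apply]
        exact Submodule.smul_mem _ _ (Submodule.mem_span_singleton_self _)
    exact h1.smul (c n)
  · have h1 : ∀ n, inner ℂ (ξ n) z = 0 := fun n => by
      have h2 : T n 1 ≤ ∑' n, T n 1 := (hsum 1).le_tsum n fun j _ => hTp j 1
      have h3 := ((ContinuousLinearMap.le_def _ _).1 h2).inner_nonneg_right z
      rw [sub_apply, inner_sub_right, hz, zero_sub] at h3
      have h4 : inner ℂ z (T n 1 z) = ((c n * ‖inner ℂ (ξ n) z‖ ^ 2 : ℝ) : ℂ) := by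
        rw [hT]
        simp only [map_one, LinearIsometryEquiv.coe_one, id_eq, smul_apply,
          rankOne_apply]
        rw [← Complex.coe_smul, inner_smul_right, inner_smul_right, ← inner_conj_symm z,
          RCLike.mul_conj]
        push_cast
        rfl
      rw [h4, ← Complex.ofReal_neg, Complex.zero_le_real] at h3
      have h5 : ‖inner ℂ (ξ n) z‖ ^ 2 ≤ 0 := by nlinarith [hc0 n]
      have h6 : ‖inner ℂ (ξ n) z‖ = 0 := by nlinarith [norm_nonneg (inner ℂ (ξ n) z : ℂ)]
      exact norm_eq_zero.1 h6
    have h2 : ∀ w, inner ℂ w z = 0 := fun w =>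
      hξ.induction_on (p := fun w => inner ℂ w z = 0) w
        (isClosed_eq (by fun_prop) continuous_const) h1
    exact inner_self_eq_zero.1 (h2 z)
  · have h1 := (ContinuousLinearMap.mulLeftRight ℂ (ν.H →L[ℂ] ν.H) (ν.op h) (ν.op h⁻¹)).map_tsum
      (hsum g)
    simp only [ContinuousLinearMap.mulLeftRight_apply] at h1
    rw [h1]
    refine tsum_congr fun n => ?_
    rw [hT]
    ext z
    have h2 : inner ℂ (ν.ρ g (ξ n)) (ν.ρ h⁻¹ z) = inner ℂ (ν.ρ (h * g) (ξ n)) z := by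
      have := ContinuousLinearMap.adjoint_inner_left (ν.op h⁻¹) z (ν.ρ g (ξ n))
      rw [adjoint_op, inv_inv] at this
      rw [map_mul]
      exact this.symm
    change ν.ρ h (c n • rankOne ℂ (ν.ρ g (ξ n)) (ν.ρ g (ξ n)) (ν.ρ h⁻¹ z)) = c n • rankOne ℂ _ _ z
    rw [rankOne_apply, rankOne_apply, h2, ← Complex.coe_smul, ← Complex.coe_smul, map_smul,
      map_smul, map_mul]
    rfl

/-- A `G`-invariant strictly positive element, obtained by averaging a strictly positive element
over the Haar measure. -/
theorem nonempty_strictElt [IsTopologicalGroup G] [CompactSpace G] [T2Space G] (ν : URep G) :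
    Nonempty (StrictElt ν) := by
  obtain ⟨F, hF, hFc, hFp, hFi, hFg⟩ := exists_continuous_orbit ν
  let _ : MeasurableSpace G := borel G
  have : BorelSpace G := ⟨rfl⟩
  let m : Measure G := Measure.haarMeasure ⊤
  have hm : IsProbabilityMeasure m := ⟨by
    have := Measure.haarMeasure_self (G := G) (K₀ := ⊤)
    simpa using this⟩
  have hint : Integrable F m := hF.integrable_of_hasCompactSupport (.of_compactSpace F)
  set s : ν.H →L[ℂ] ν.H := ∫ g, F g ∂m with hs
  have hsc : s ∈ compactAlg ν.H := by
    refine Convex.integral_mem (s := (compactAlg ν.H : Set (ν.H →L[ℂ] ν.H))) ?_ isClosed_compactAlg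
      (Eventually.of_forall hFc) hint
    exact (compactOperator (RingHom.id ℂ) ν.H ν.H).restrictScalars ℝ |>.convex
  have hsp : 0 ≤ s := by
    refine Convex.integral_mem (s := Set.Ici (0 : ν.H →L[ℂ] ν.H)) (convex_Ici 0) isClosed_Ici
      (Eventually.of_forall hFp) hint
  have hsi : ∀ z, s z = 0 → z = 0 := by
    intro z hz
    let Λ : (ν.H →L[ℂ] ν.H) →L[ℂ] ℂ := (innerSL ℂ z).comp (ContinuousLinearMap.apply ℂ ν.H z)
    have h1 : ∫ g, Λ (F g) ∂m = 0 := by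
      rw [Λ.integral_comp_comm hint]
      change inner ℂ z (s z) = 0
      rw [hz, inner_zero_right]
    have hnn : ∀ g, 0 ≤ Λ (F g) := fun g =>
      ((ContinuousLinearMap.nonneg_iff_isPositive _).1 (hFp g)).inner_nonneg_right z
    have hre : ∫ g, (Λ (F g)).re ∂m = 0 := by
      have h2 := (Complex.reCLM.integral_comp_comm (Λ.integrable_comp hint))
      rw [h1] at h2
      simpa using h2
    have hcont : Continuous fun g => (Λ (F g)).re :=
      Complex.continuous_re.comp (Λ.continuous.comp hF)
    -- the integrand is nonnegative, and strictly positive at the unit unless `z = 0`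
    by_contra hne
    have h3 := hcont.integral_pos_of_hasCompactSupport_nonneg_nonzero (μ := m) (x := 1)
      (.of_compactSpace _) (fun g => show (0 : ℝ) ≤ _ from (Complex.le_def.1 (hnn g)).1)
      fun h0 => hne (hFi z ?_)
    · exact h3.ne' hre
    · exact Complex.ext h0 (Complex.le_def.1 (hnn 1)).2.symm
  have hinv : ∀ h, ν.op h * s * ν.op h⁻¹ = s := by
    intro h
    let Φ := ContinuousLinearMap.mulLeftRight ℂ (ν.H →L[ℂ] ν.H) (ν.op h) (ν.op h⁻¹)
    have h1 : ∫ g, Φ (F g) ∂m = Φ s := Φ.integral_comp_comm hint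
    have h2 : ∀ g, Φ (F g) = F (h * g) := fun g => hFg h g
    have h3 : Φ s = ν.op h * s * ν.op h⁻¹ := rfl
    rw [← h3, ← h1]
    simp only [h2]
    exact integral_mul_left_eq_self F h
  exact ⟨⟨⟨s, hsc⟩, isStrictlyPos_of_injective
    ((ContinuousLinearMap.nonneg_iff_isPositive _).1 hsp) hsi, hinv⟩⟩

end Haar

end

/-! ### Comparison of invariant compact operators -/

section

section KLe

variable {G : Type v} [Group G] [TopologicalSpace G] {μ ν ν' lam : URep G}

theorem URep.Intertwines.conj_eq {V : μ.H →L[ℂ] ν.H} (hV : Intertwines V) (g : G) :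
    ν.op g ∘L V ∘L μ.op g⁻¹ = V := by
  rw [hV, ← ContinuousLinearMap.comp_assoc, op_comp_inv]
  rfl

theorem StrictElt.intertwines (s : StrictElt ν) : Intertwines (μ := ν) (ν := ν) s.val.1 := fun g => by
  conv_lhs => rw [← s.inv g]
  simp only [ContinuousLinearMap.comp_assoc]
  rw [op_inv_comp]
  rfl

theorem StrictElt.injective (s : StrictElt ν) : ∀ z, s.val.1 z = 0 → z = 0 :=
  s.strict.injective

theorem URep.Intertwines.add {V W : μ.H →L[ℂ] ν.H} (hV : Intertwines V) (hW : Intertwines W) :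
    Intertwines (V + W) := fun g => by
  rw [ContinuousLinearMap.add_comp, hV, hW, ContinuousLinearMap.comp_add]

theorem URep.Intertwines.sub {V W : μ.H →L[ℂ] ν.H} (hV : Intertwines V) (hW : Intertwines W) :
    Intertwines (V - W) := fun g => by
  rw [ContinuousLinearMap.sub_comp, hV, hW, ContinuousLinearMap.comp_sub]

theorem URep.Intertwines.smul (c : ℂ) {V : μ.H →L[ℂ] ν.H} (hV : Intertwines V) :
    Intertwines (c • V) := fun g => by
  rw [ContinuousLinearMap.smul_comp, hV, ContinuousLinearMap.comp_smul]

theorem URep.intertwines_zero : Intertwines (0 : μ.H →L[ℂ] ν.H) := fun g => by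
  rw [ContinuousLinearMap.zero_comp, ContinuousLinearMap.comp_zero]

theorem URep.isClosed_intertwines : IsClosed {V : μ.H →L[ℂ] ν.H | Intertwines V} := by
  have h : {V : μ.H →L[ℂ] ν.H | Intertwines V}
      = ⋂ g : G, {V : μ.H →L[ℂ] ν.H | V ∘L μ.op g = ν.op g ∘L V} := by
    ext V
    simp [Intertwines]
  rw [h]
  exact isClosed_iInter fun g => isClosed_eq (by fun_prop) (by fun_prop)

/-- The C*-algebra of bounded intertwiners. -/
def commAlg (ν : URep G) : NonUnitalStarSubalgebra ℂ (ν.H →L[ℂ] ν.H) where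
  carrier := {T | Intertwines (μ := ν) (ν := ν) T}
  add_mem' h h' := h.add h'
  zero_mem' := intertwines_zero
  mul_mem' h h' := h.comp h'
  smul_mem' c _ h := h.smul c
  star_mem' h := h.adj

theorem isClosed_commAlg : IsClosed (commAlg ν : Set (ν.H →L[ℂ] ν.H)) := isClosed_intertwines

/-- The C*-algebra `K(H_ν)^G`. -/
def opAlg (ν : URep G) : NonUnitalStarSubalgebra ℂ (ν.H →L[ℂ] ν.H) := compactAlg ν.H ⊓ commAlg ν

theorem isClosed_opAlg : IsClosed (opAlg ν : Set (ν.H →L[ℂ] ν.H)) :=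
  isClosed_compactAlg.inter isClosed_commAlg

theorem StrictElt.mem_opAlg (s : StrictElt ν) : s.val.1 ∈ opAlg ν := ⟨s.val.2, s.intertwines⟩

/-- The Cuntz comparison of invariant compact operators: `s` is a limit of operators `e s' e^*`
with compact intertwiners `e`. -/
def KLe (s' : ν'.H →L[ℂ] ν'.H) (s : ν.H →L[ℂ] ν.H) : Prop :=
  ∀ ε : ℝ, 0 < ε → ∃ e : ν'.H →L[ℂ] ν.H, IsCompactOperator e ∧ Intertwines e ∧
    ‖e ∘L s' ∘L adjoint e - s‖ < ε

/-- A strictly positive invariant operator on `ν'` dominates all invariant positive compact operators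
that come from `ν'`. -/
theorem StrictElt.kLe (s' : StrictElt ν') {t : ν'.H →L[ℂ] ν'.H} (ht : t ∈ opAlg ν')
    (htp : t.IsPositive) {V : ν'.H →L[ℂ] ν.H} (hV : Intertwines V) :
    KLe s'.val.1 (V ∘L t ∘L adjoint V) := by
  intro ε hε
  obtain ⟨R, hR⟩ := exists_adjoint_comp htp
  obtain ⟨r, hr, hrs, hrt⟩ := exists_sqrt_mem isClosed_opAlg ht ⟨R, hR⟩
  have hd : 0 < ε / (2 * (‖V‖ * ‖V‖ + 1) * (‖r‖ + 1)) := by positivity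
  obtain ⟨p, hp, f, hf, hps, hpn, hfp, hpr, -⟩ := exists_approxUnit_injective isClosed_opAlg
    s'.mem_opAlg s'.strict.1 s'.injective hr.1 hd
  have hrf : r * f ∈ opAlg ν' := mul_mem hr hf
  refine ⟨V ∘L (r * f), hrf.1.clm_comp V, hV.comp hrf.2, ?_⟩
  have h1 := norm_conj_approxUnit_sub_le hps hpn hfp hrs
  have h2 : ‖r * p - r‖ = ‖p ∘L r - r‖ := by
    rw [← norm_star (r * p - r), star_sub, star_mul, hps, hrs]
    rfl
  rw [h2] at h1
  have e : (V ∘L (r * f)) ∘L s'.val.1 ∘L adjoint (V ∘L (r * f)) - V ∘L t ∘L adjoint V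
      = V ∘L (r * f * s'.val.1 * star (r * f) - r * r) ∘L adjoint V := by
    rw [hrt, ContinuousLinearMap.sub_comp, ContinuousLinearMap.comp_sub, adjoint_comp]
    rfl
  rw [e]
  refine ((ContinuousLinearMap.opNorm_comp_le _ _).trans (mul_le_mul_of_nonneg_left
    (ContinuousLinearMap.opNorm_comp_le _ _) (norm_nonneg _))).trans_lt ?_
  rw [LinearIsometryEquiv.norm_map]
  calc _ ≤ ‖V‖ * (2 * ‖r‖ * (ε / (2 * (‖V‖ * ‖V‖ + 1) * (‖r‖ + 1))) * ‖V‖) := by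
        gcongr
        exact h1.trans (by gcongr)
    _ = ε * ((‖V‖ * ‖V‖) / (‖V‖ * ‖V‖ + 1)) * (‖r‖ / (‖r‖ + 1)) := by field_simp
    _ < ε := by
      have h3 : (‖V‖ * ‖V‖) / (‖V‖ * ‖V‖ + 1) ≤ 1 :=
        (div_le_one (by positivity)).2 (by linarith)
      have h4 : ‖r‖ / (‖r‖ + 1) < 1 := (div_lt_one (by positivity)).2 (by linarith)
      have h5 : 0 ≤ (‖V‖ * ‖V‖) / (‖V‖ * ‖V‖ + 1) := by positivity
      have h6 : 0 ≤ ‖r‖ / (‖r‖ + 1) := by positivity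
      calc _ ≤ ε * 1 * (‖r‖ / (‖r‖ + 1)) := by gcongr
        _ < ε := by nlinarith

/-- A strictly positive operator on a representation dominates those on its subrepresentations. -/
theorem StrictElt.kLe_of_sub (s : StrictElt ν) (s' : StrictElt ν') (h : ν.Sub ν') :
    KLe s'.val.1 s.val.1 := by
  obtain ⟨V, hV⟩ := h
  set W : ν.H →L[ℂ] ν'.H := V.toContinuousLinearMap
  have hW : Intertwines W := fun g => ContinuousLinearMap.ext fun ξ => hV g ξ
  have h1 := s'.kLe (t := W ∘L s.val.1 ∘L adjoint W)
    ⟨(s.val.2.comp_clm (adjoint W)).clm_comp W, hW.comp (s.intertwines.comp hW.adj)⟩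
    (s.strict.1.conj_adjoint W) hW.adj
  have h2 : adjoint W ∘L (W ∘L s.val.1 ∘L adjoint W) ∘L adjoint (adjoint W) = s.val.1 := by
    have h3 : adjoint W ∘L W = .id ℂ ν.H := adjoint_linearIsometry_comp V
    have h4 : adjoint W ∘L (W ∘L s.val.1 ∘L adjoint W) ∘L W
        = (adjoint W ∘L W) ∘L s.val.1 ∘L (adjoint W ∘L W) := rfl
    rw [adjoint_adjoint, h4, h3]
    rfl
  rwa [h2] at h1

end KLe

/-! ### Tensor products with invariant operators -/

namespace OpFam

section Tensor

variable {A : Type u} [NonUnitalCStarAlgebra A] {H₁ H₂ H₃ H₄ : Type}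
  [NormedAddCommGroup H₁] [InnerProductSpace ℂ H₁] [NormedAddCommGroup H₂]
  [InnerProductSpace ℂ H₂] [NormedAddCommGroup H₃] [InnerProductSpace ℂ H₃]
  [NormedAddCommGroup H₄] [InnerProductSpace ℂ H₄]

theorem tensor_add_left (S T : H₁ →L[ℂ] H₂) (x : OpFam A H₃ H₄) :
    tensor (S + T) x = tensor S x + tensor T x :=
  OpFam.ext fun r => by ext z; simp [tensor_coord, htmap_add_left]

theorem tensor_sub_left (S T : H₁ →L[ℂ] H₂) (x : OpFam A H₃ H₄) :
    tensor (S - T) x = tensor S x - tensor T x := by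
  rw [eq_sub_iff_add_eq, ← tensor_add_left, sub_add_cancel]

theorem tensor_zero_left (x : OpFam A H₃ H₄) : tensor (0 : H₁ →L[ℂ] H₂) x = 0 := by
  have h := tensor_sub_left (0 : H₁ →L[ℂ] H₂) 0 x
  rwa [sub_self, sub_self] at h

theorem tensor_zero (S : H₁ →L[ℂ] H₂) : tensor S (0 : OpFam A H₃ H₄) = 0 := by
  have h := tensor_sub S (0 : OpFam A H₃ H₄) 0
  rwa [sub_self, sub_self] at h

theorem adj_tensor [CompleteSpace H₁] [CompleteSpace H₂] [CompleteSpace H₃] [CompleteSpace H₄]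
    (S : H₁ →L[ℂ] H₂) (x : OpFam A H₃ H₄) : adj (tensor S x) = tensor (adjoint S) (adj x) :=
  OpFam.ext fun r => by
    rw [adj_coord, tensor_coord, tensor_coord, adjoint_comp, adjoint_comp, adjoint_htmap,
      LinearIsometryEquiv.adjoint_eq_symm, LinearIsometryEquiv.adjoint_eq_symm,
      LinearIsometryEquiv.symm_symm]
    rfl

theorem tensor_conj [CompleteSpace H₁] [CompleteSpace H₂] [CompleteSpace H₃] [CompleteSpace H₄]
    (e : H₁ →L[ℂ] H₂) (s : H₁ →L[ℂ] H₁) (d : OpFam A H₃ H₄) (x : OpFam A H₃ H₃) :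
    comp (comp (tensor e d) (tensor s x)) (adj (tensor e d))
      = tensor (e ∘L s ∘L adjoint e) (comp (comp d x) (adj d)) := by
  rw [adj_tensor, tensor_comp, tensor_comp]
  rfl

end Tensor

variable {G : Type v} [Group G] [TopologicalSpace G] {X : GCStar.{u} G} {μ ν μ' ν' : URep G}

theorem act_tensor' (g : G) (s : ν.H →L[ℂ] ν'.H) (x : OpFam X.carrier μ.H μ'.H) :
    act (μ := ν.tensor μ) (ν := ν'.tensor μ') g (tensor s x)
      = tensor (ν'.op g ∘L s ∘L ν.op g⁻¹) (act g x) := by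
  have h : ∀ (ν μ : URep G) (g), (ν.tensor μ).op g = htmap (ν.op g) (μ.op g) :=
    fun _ _ g => htcongr_coe _ _
  rw [act, act, h, h, ← tensor_mult, ← tensor_mult, mapHom_tensor]
  exact (congrArg (fun z => comp z _) (tensor_comp _ _ _ _)).trans (tensor_comp _ _ _ _)

theorem tensor_mem_invK {s : ν.H →L[ℂ] ν'.H} (hc : IsCompactOperator s) (hs : Intertwines s)
    {x : OpFam X.carrier μ.H μ'.H} (hx : x ∈ invK X μ μ') :
    tensor s x ∈ invK X (ν.tensor μ) (ν'.tensor μ') :=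
  ⟨tensor_mem hc hx.1, fun g => by rw [act_tensor', hs.conj_eq, hx.2]⟩

theorem intertwines_htmap {V : ν.H →L[ℂ] ν'.H} (hV : Intertwines V) {W : μ.H →L[ℂ] μ'.H}
    (hW : Intertwines W) : Intertwines (μ := ν.tensor μ) (ν := ν'.tensor μ') (htmap V W) := fun g => by
  have h : ∀ (ν μ : URep G) (g), (ν.tensor μ).op g = htmap (ν.op g) (μ.op g) :=
    fun _ _ g => htcongr_coe _ _
  rw [h, h, htmap_comp, htmap_comp, hV, hW]

end OpFam

variable {G : Type v} [Group G] [TopologicalSpace G] {X : GCStar.{u} G}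

namespace PosElt

/-- The positive element `s ⊗ a` for an invariant positive compact operator `s`. -/
def tensorOp {ν : URep G} (s : ν.H →L[ℂ] ν.H) (hs : s ∈ opAlg ν) (hp : s.IsPositive)
    (a : PosElt X) : PosElt X where
  rep := ν.tensor a.rep
  val := OpFam.tensor s a.val
  mem := tensor_mem_invK hs.1 hs.2 a.mem
  pos := tensor_pos hp a.pos

theorem norm_tensor_sub_tensor_le {A : Type u} [NonUnitalCStarAlgebra A] {H K : Type}
    [NormedAddCommGroup H] [InnerProductSpace ℂ H] [NormedAddCommGroup K] [InnerProductSpace ℂ K]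
    (s s' : H →L[ℂ] H) (x x' : OpFam A K K) :
    ‖OpFam.tensor s' x' - OpFam.tensor s x‖ ≤ ‖s' - s‖ * ‖x'‖ + ‖s‖ * ‖x' - x‖ := by
  have e : OpFam.tensor s' x' - OpFam.tensor s x
      = OpFam.tensor (s' - s) x' + OpFam.tensor s (x' - x) := by
    rw [tensor_sub_left, tensor_sub]; abel
  rw [e]
  exact (norm_add_le _ _).trans (add_le_add (norm_tensor_le _ _) (norm_tensor_le _ _))

/-- Comparison is compatible with tensor products, in both factors at once. -/
theorem tensorOp_le {ν ν' : URep G} {s : ν.H →L[ℂ] ν.H} {s' : ν'.H →L[ℂ] ν'.H} (hs : s ∈ opAlg ν)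
    (hp : s.IsPositive) (hs' : s' ∈ opAlg ν') (hp' : s'.IsPositive) (h : KLe s' s)
    {a b : PosElt X} (hab : a ≤ b) : tensorOp s hs hp a ≤ tensorOp s' hs' hp' b := by
  refine subeq_iff.2 fun ε hε => ?_
  obtain ⟨d, hd, hdn⟩ := subeq_iff.1 hab (min 1 (ε / (2 * (‖s‖ + 1))))
    (lt_min one_pos (by positivity))
  obtain ⟨e, hec, he, hen⟩ := h (ε / (2 * (‖a.val‖ + 1))) (by positivity)
  refine ⟨OpFam.tensor e d, tensor_mem_invK hec he hd, ?_⟩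
  change ‖comp (comp (OpFam.tensor e d) (OpFam.tensor s' b.val)) (adj (OpFam.tensor e d))
    - OpFam.tensor s a.val‖ < ε
  rw [tensor_conj]
  refine (norm_tensor_sub_tensor_le _ _ _ _).trans_lt ?_
  have h1 : ‖comp (comp d b.val) (adj d)‖ ≤ ‖a.val‖ + 1 := by
    have h2 := norm_add_le (comp (comp d b.val) (adj d) - a.val) a.val
    rw [sub_add_cancel] at h2
    linarith [hdn.trans_le (min_le_left _ _)]
  have h2 := hdn.trans_le (min_le_right _ _)
  have h3 : ‖e ∘L s' ∘L adjoint e - s‖ * ‖comp (comp d b.val) (adj d)‖ ≤ ε / 2 := by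
    calc _ ≤ ε / (2 * (‖a.val‖ + 1)) * (‖a.val‖ + 1) := by gcongr
      _ = ε / 2 := by field_simp
  have h4 : ‖s‖ * ‖comp (comp d b.val) (adj d) - a.val‖ < ε / 2 := by
    calc _ ≤ ‖s‖ * (ε / (2 * (‖s‖ + 1))) := by gcongr
      _ < ε / 2 := by
        rw [mul_div_assoc', div_lt_div_iff₀ (by positivity) (by positivity)]
        nlinarith [norm_nonneg s]
  linarith

theorem tensor_le_tensor {ν ν' : URep G} (s : StrictElt ν) (s' : StrictElt ν') (h : ν.Sub ν')
    {a b : PosElt X} (hab : a ≤ b) : PosElt.tensor s a ≤ PosElt.tensor s' b :=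
  tensorOp_le s.mem_opAlg s.strict.1 s'.mem_opAlg s'.strict.1 (s.kLe_of_sub s' h) hab

end PosElt

namespace CuG

theorem mk_tensor_eq {ν ν' : URep G} (s : StrictElt ν) (s' : StrictElt ν') {a a' : PosElt X}
    (h : CuRep.mk ν = CuRep.mk ν') (ha : mk a = mk a') :
    mk (PosElt.tensor s a) = mk (PosElt.tensor s' a') := by
  have hν : ν ≈ ν' := Quotient.exact h
  have ha' := mk_eq_mk.1 ha
  exact sound ⟨PosElt.tensor_le_tensor s s' (sub_of_equiv hν) ha'.1,
    PosElt.tensor_le_tensor s' s (sub_of_equiv (Setoid.symm hν)) ha'.2⟩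

theorem smul_mk [IsTopologicalGroup G] [CompactSpace G] [T2Space G] {ν : URep G} (s : StrictElt ν)
    (a : PosElt X) : CuRep.mk ν • mk a = mk (PosElt.tensor s a) := by
  have h : Nonempty (StrictElt (Quotient.out (CuRep.mk ν) : URep G)) := nonempty_strictElt _
  have e : CuRep.mk ν • mk a
      = mk (PosElt.tensor h.some (Quotient.out (mk a) : PosElt X)) := dif_pos h
  rw [e]
  exact mk_tensor_eq _ _ (Quotient.out_eq _) (Quotient.out_eq _)

end CuG

end

/-! ### The semimodule structure -/

section

section HT

variable {H K L : Type*} [NormedAddCommGroup H] [InnerProductSpace ℂ H] [CompleteSpace H]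
  [NormedAddCommGroup K] [InnerProductSpace ℂ K] [CompleteSpace K]
  [NormedAddCommGroup L] [InnerProductSpace ℂ L]

theorem isSelfAdjoint_of_isPositive {s : H →L[ℂ] H} (hs : s.IsPositive) : adjoint s = s :=
  ContinuousLinearMap.isSelfAdjoint_iff'.1 hs.isSelfAdjoint

/-- The tensor product of injective positive operators has dense range, hence is injective. -/
theorem htmap_injective {s : H →L[ℂ] H} {t : K →L[ℂ] K} (hs : s.IsPositive) (ht : t.IsPositive)
    (hsi : ∀ z, s z = 0 → z = 0) (hti : ∀ z, t z = 0 → z = 0) (z : HTensor H K)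
    (hz : htmap s t z = 0) : z = 0 := by
  have h1 : ∀ ξ η, inner ℂ (htmul (s ξ) (t η)) z = 0 := fun ξ η => by
    rw [← htmap_htmul, ← ContinuousLinearMap.adjoint_inner_right, adjoint_htmap,
      isSelfAdjoint_of_isPositive hs, isSelfAdjoint_of_isPositive ht, hz, inner_zero_right]
  have h2 : ∀ ξ η, inner ℂ (htmul (s ξ) η) z = 0 := fun ξ η =>
    (denseRange_of_injective ht.isSelfAdjoint hti).induction_on
      (p := fun η => inner ℂ (htmul (s ξ) η) z = 0) η
      (isClosed_eq ((continuous_htmul_right (s ξ)).inner continuous_const) continuous_const) (h1 ξ)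
  have h3 : ∀ ξ η, inner ℂ (htmul ξ η) z = 0 := fun ξ η =>
    (denseRange_of_injective hs.isSelfAdjoint hsi).induction_on
      (p := fun ξ => inner ℂ (htmul ξ η) z = 0) ξ
      (isClosed_eq ((continuous_htmul_left η).inner continuous_const) continuous_const)
      fun ξ => h2 ξ η
  have h4 : ∀ w, inner ℂ w z = 0 := fun w => by
    induction w using HTensor.induction with
    | hcl => exact isClosed_eq (by fun_prop) continuous_const
    | hadd x y hx hy => rw [inner_add_left, hx, hy, add_zero]
    | ht ξ η => exact h3 ξ η
  exact inner_self_eq_zero.1 (h4 z)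

/-- The isometry `ξ ↦ 1 ⊗ ξ`. -/
def oneTensor (K : Type*) [NormedAddCommGroup K] [InnerProductSpace ℂ K] :
    K →ₗᵢ[ℂ] HTensor ℂ K where
  toFun ξ := htmul 1 ξ
  map_add' := htmul_add_right 1
  map_smul' c ξ := htmul_smul_right c 1 ξ
  norm_map' ξ := by
    have h2 : ‖htmul (1 : ℂ) ξ‖ ^ 2 = ‖ξ‖ ^ 2 := by
      rw [← inner_self_eq_norm_sq (𝕜 := ℂ), ← inner_self_eq_norm_sq (𝕜 := ℂ), inner_htmul]
      simp
    exact (sq_eq_sq₀ (norm_nonneg _) (norm_nonneg _)).1 h2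

theorem oneTensor_apply {K : Type*} [NormedAddCommGroup K] [InnerProductSpace ℂ K] (ξ : K) :
    oneTensor K ξ = htmul 1 ξ := rfl

theorem adjoint_oneTensor_htmul (c : ℂ) (ξ : K) :
    adjoint (oneTensor K).toContinuousLinearMap (htmul c ξ) = c • ξ := by
  have h : htmul c ξ = (oneTensor K).toContinuousLinearMap (c • ξ) := by
    change _ = oneTensor K (c • ξ)
    rw [oneTensor_apply, htmul_smul_right, ← htmul_smul_left, smul_eq_mul, mul_one]
  rw [h]
  refine ext_inner_left ℂ fun w => ?_
  rw [ContinuousLinearMap.adjoint_inner_right]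
  exact (oneTensor K).inner_map_map _ _

theorem adjoint_coe_comp {H K : Type*} [NormedAddCommGroup H] [InnerProductSpace ℂ H]
    [CompleteSpace H] [NormedAddCommGroup K] [InnerProductSpace ℂ K] [CompleteSpace K]
    (e : H ≃ₗᵢ[ℂ] K) : adjoint (e : H →L[ℂ] K) ∘L (e : H →L[ℂ] K) = .id ℂ H := by
  ext z
  rw [LinearIsometryEquiv.adjoint_eq_symm]
  simp

section

variable {H₁ H₂ H₃ K₁ K₂ K₃ : Type*}
  [NormedAddCommGroup H₁] [InnerProductSpace ℂ H₁] [CompleteSpace H₁]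
  [NormedAddCommGroup H₂] [InnerProductSpace ℂ H₂] [CompleteSpace H₂]
  [NormedAddCommGroup H₃] [InnerProductSpace ℂ H₃]
  [NormedAddCommGroup K₁] [InnerProductSpace ℂ K₁] [CompleteSpace K₁]
  [NormedAddCommGroup K₂] [InnerProductSpace ℂ K₂] [CompleteSpace K₂]
  [NormedAddCommGroup K₃] [InnerProductSpace ℂ K₃]

theorem adjoint_htmap_comp_self {V : H₁ →L[ℂ] H₂} {W : K₁ →L[ℂ] K₂}
    (hV : adjoint V ∘L V = .id ℂ H₁) (hW : adjoint W ∘L W = .id ℂ K₁) :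
    adjoint (htmap V W) ∘L htmap V W = .id ℂ (HTensor H₁ K₁) := by
  rw [adjoint_htmap, htmap_comp, hV, hW, htmap_id]

theorem adjoint_htmap_comp_of_left {V : H₁ →L[ℂ] H₂} {V' : H₃ →L[ℂ] H₂} (W : K₁ →L[ℂ] K₂)
    (W' : K₃ →L[ℂ] K₂) (hV : adjoint V ∘L V' = 0) : adjoint (htmap V W) ∘L htmap V' W' = 0 := by
  rw [adjoint_htmap, htmap_comp, hV]
  exact HTensor.ext fun _ _ => by simp

theorem adjoint_htmap_comp_of_right (V : H₁ →L[ℂ] H₂) (V' : H₃ →L[ℂ] H₂) {W : K₁ →L[ℂ] K₂}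
    {W' : K₃ →L[ℂ] K₂} (hW : adjoint W ∘L W' = 0) : adjoint (htmap V W) ∘L htmap V' W' = 0 := by
  rw [adjoint_htmap, htmap_comp, hW]
  exact HTensor.ext fun _ _ => by simp

end

/-- The isometry defined on a direct sum by two isometries with orthogonal ranges. -/
theorem adjoint_comp_self_of_orthogonal {H K M : Type} [NormedAddCommGroup H] [InnerProductSpace ℂ H]
    [CompleteSpace H] [NormedAddCommGroup K] [InnerProductSpace ℂ K] [CompleteSpace K]
    [NormedAddCommGroup M] [InnerProductSpace ℂ M] [CompleteSpace M]
    {V : H →L[ℂ] M} {W : K →L[ℂ] M}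
    (hVV : adjoint V ∘L V = .id ℂ _) (hWW : adjoint W ∘L W = .id ℂ _) (hVW : adjoint V ∘L W = 0) :
    adjoint (V ∘L adjoint (inL H K) + W ∘L adjoint (inR H K))
      ∘L (V ∘L adjoint (inL H K) + W ∘L adjoint (inR H K)) = .id ℂ _ := by
  have hWV : adjoint W ∘L V = 0 := by
    have := congrArg adjoint hVW
    rwa [adjoint_comp, adjoint_adjoint, map_zero] at this
  have e : ∀ z, (adjoint (V ∘L adjoint (inL H K) + W ∘L adjoint (inR H K)))
      z = inL H K (adjoint V z) + inR H K (adjoint W z) := fun z => by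
    rw [map_add, adjoint_comp, adjoint_comp, adjoint_adjoint, adjoint_adjoint]
    rfl
  ext z
  have k1 := fun z => DFunLike.congr_fun hVV z
  have k2 := fun z => DFunLike.congr_fun hWW z
  have k3 := fun z => DFunLike.congr_fun hVW z
  have k4 := fun z => DFunLike.congr_fun hWV z
  simp only [ContinuousLinearMap.comp_apply, ContinuousLinearMap.id_apply,
    zero_apply] at k1 k2 k3 k4
  rw [ContinuousLinearMap.comp_apply, e]
  simp only [add_apply, ContinuousLinearMap.comp_apply, map_add, k1, k2, k3, k4,
    adjoint_inL_apply, adjoint_inR_apply, inL_apply, inR_apply]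
  refine WithLp.ofLp_injective 2 (Prod.ext ?_ ?_) <;> simp

theorem add_comp_inL {H K M : Type} [NormedAddCommGroup H] [InnerProductSpace ℂ H]
    [CompleteSpace H] [NormedAddCommGroup K] [InnerProductSpace ℂ K] [CompleteSpace K]
    [NormedAddCommGroup M] [InnerProductSpace ℂ M] (V : H →L[ℂ] M) (W : K →L[ℂ] M) :
    (V ∘L adjoint (inL H K) + W ∘L adjoint (inR H K)) ∘L inL H K = V := by
  ext z
  simp [adjoint_inL_apply, adjoint_inR_apply, inL_apply]

theorem add_comp_inR {H K M : Type} [NormedAddCommGroup H] [InnerProductSpace ℂ H]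
    [CompleteSpace H] [NormedAddCommGroup K] [InnerProductSpace ℂ K] [CompleteSpace K]
    [NormedAddCommGroup M] [InnerProductSpace ℂ M] (V : H →L[ℂ] M) (W : K →L[ℂ] M) :
    (V ∘L adjoint (inL H K) + W ∘L adjoint (inR H K)) ∘L inR H K = W := by
  ext z
  simp [adjoint_inL_apply, adjoint_inR_apply, inR_apply]

end HT

variable {G : Type v} [Group G] [TopologicalSpace G] {X : GCStar.{u} G}

/-- The strictly positive element `1` on the trivial representation. -/
def StrictElt.one (G : Type v) [Group G] [TopologicalSpace G] : StrictElt (URep.triv G) where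
  val := ⟨.id ℂ ℂ, isCompactOperator_of_locallyCompactSpace_dom _⟩
  strict := isStrictlyPos_of_injective ContinuousLinearMap.isPositive_one fun _ hz => hz
  inv g := by rfl

/-- The strictly positive element `s ⊗ t`. -/
def StrictElt.tensor {μ ν : URep G} (s : StrictElt μ) (t : StrictElt ν) :
    StrictElt (μ.tensor ν) where
  val := ⟨htmap s.val.1 t.val.1, isCompactOperator_htmap s.val.2 t.val.2⟩
  strict := isStrictlyPos_of_injective (isPositive_htmap s.strict.1 t.strict.1)
    (htmap_injective s.strict.1 t.strict.1 s.injective t.injective)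
  inv g := (intertwines_htmap s.intertwines t.intertwines).conj_eq g

/-- The strictly positive element `s ⊕ t`. -/
def StrictElt.sum {μ ν : URep G} (s : StrictElt μ) (t : StrictElt ν) : StrictElt (μ.sum ν) where
  val := ⟨inL μ.H ν.H ∘L s.val.1 ∘L adjoint (inL μ.H ν.H)
    + inR μ.H ν.H ∘L t.val.1 ∘L adjoint (inR μ.H ν.H),
    ((s.val.2.comp_clm (adjoint (inL μ.H ν.H))).clm_comp (inL μ.H ν.H)).add
      ((t.val.2.comp_clm (adjoint (inR μ.H ν.H))).clm_comp (inR μ.H ν.H))⟩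
  strict := by
    refine isStrictlyPos_of_injective ((s.strict.1.conj_adjoint _).add (t.strict.1.conj_adjoint _))
      fun z hz => ?_
    have h : WithLp.toLp 2 (s.val.1 z.fst, (0 : ν.H)) + WithLp.toLp 2 ((0 : μ.H), t.val.1 z.snd)
        = 0 := by
      have h2 : inL μ.H ν.H (s.val.1 (adjoint (inL μ.H ν.H) z))
        + inR μ.H ν.H (t.val.1 (adjoint (inR μ.H ν.H) z)) = 0 := hz
      rwa [adjoint_inL_apply, adjoint_inR_apply, inL_apply, inR_apply] at h2
    have h1 : s.val.1 z.fst + 0 = 0 := congrArg WithLp.fst h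
    have h2 : 0 + t.val.1 z.snd = 0 := congrArg WithLp.snd h
    rw [add_zero] at h1
    rw [zero_add] at h2
    exact WithLp.ofLp_injective 2 (Prod.ext (s.injective _ h1) (t.injective _ h2))
  inv g := (((intertwines_inL μ ν).comp (s.intertwines.comp (intertwines_inL μ ν).adj)).add
    ((intertwines_inR μ ν).comp (t.intertwines.comp (intertwines_inR μ ν).adj))).conj_eq g

namespace PosElt

theorem htassoc_htmap_oneTensor {K L : Type*} [NormedAddCommGroup K] [InnerProductSpace ℂ K]
    [NormedAddCommGroup L] [InnerProductSpace ℂ L] (w : HTensor K L) :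
    (htassoc ℂ K L).symm (htmul 1 w)
      = htmap (oneTensor K).toContinuousLinearMap (.id ℂ L) w := by
  induction w using HTensor.induction with
  | hcl =>
    exact isClosed_eq ((htassoc ℂ K L).symm.continuous.comp (continuous_htmul_right 1))
      (by fun_prop)
  | hadd x y hx hy => rw [htmul_add_right, map_add, hx, hy, map_add]
  | ht ξ η =>
    rw [htassoc_symm_htmul, htmap_htmul]
    rfl

theorem tensor_one_eq (a : PosElt X) :
    OpFam.tensor (.id ℂ ℂ) a.val = cj (oneTensor a.rep.H).toContinuousLinearMap a.val := by
  refine OpFam.ext fun r => HTensor.ext₃ fun c ξ ζ => ?_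
  change (htassoc ℂ a.rep.H r.L).symm (htmap (.id ℂ ℂ) (a.val r)
    (htassoc ℂ a.rep.H r.L (htmul (htmul c ξ) ζ)))
    = htmap (oneTensor a.rep.H).toContinuousLinearMap (.id ℂ r.L) (a.val r
      (htmap (adjoint (oneTensor a.rep.H).toContinuousLinearMap) (.id ℂ r.L) (htmul (htmul c ξ) ζ)))
  rw [htassoc_htmul, htmap_htmul, htmap_htmul, adjoint_oneTensor_htmul, htmul_smul_left, map_smul,
    map_smul, ← htassoc_htmap_oneTensor, ← map_smul, ← htmul_smul_left, smul_eq_mul, mul_one]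
  rfl

theorem tensor_one_equiv (a : PosElt X) :
    a ≤ PosElt.tensor (StrictElt.one G) a ∧ PosElt.tensor (StrictElt.one G) a ≤ a := by
  have hV : Intertwines (μ := a.rep) (ν := (URep.triv G).tensor a.rep)
      (oneTensor a.rep.H).toContinuousLinearMap := fun g => by
    have h : ((URep.triv G).tensor a.rep).op g = htmap ((URep.triv G).op g) (a.rep.op g) :=
      htcongr_coe _ _
    rw [h]
    ext ξ
    change htmul 1 (a.rep.op g ξ) = htmap ((URep.triv G).op g) (a.rep.op g) (htmul 1 ξ)
    rw [htmap_htmul]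
    rfl
  exact equiv_of_conj (a := a) (b := PosElt.tensor (StrictElt.one G) a)
    (oneTensor a.rep.H).toContinuousLinearMap hV (adjoint_linearIsometry_comp _) (tensor_one_eq a)

/-- The pentagon identity for the associativity of Hilbert space tensor products. -/
theorem htassoc_pentagon {H K L M : Type*} [NormedAddCommGroup H] [InnerProductSpace ℂ H]
    [NormedAddCommGroup K] [InnerProductSpace ℂ K] [NormedAddCommGroup L] [InnerProductSpace ℂ L]
    [NormedAddCommGroup M] [InnerProductSpace ℂ M] (ξ : H) (η : K) (w : HTensor L M) :
    (htassoc H (HTensor K L) M).symm (htmul ξ ((htassoc K L M).symm (htmul η w)))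
      = htmap (htassoc H K L : HTensor (HTensor H K) L →L[ℂ] HTensor H (HTensor K L)) (.id ℂ M)
          ((htassoc (HTensor H K) L M).symm (htmul (htmul ξ η) w)) := by
  induction w using HTensor.induction with
  | hcl =>
    exact isClosed_eq ((htassoc _ _ _).symm.continuous.comp ((continuous_htmul_right ξ).comp
      ((htassoc _ _ _).symm.continuous.comp (continuous_htmul_right η))))
      ((htmap _ _).continuous.comp ((htassoc _ _ _).symm.continuous.comp (continuous_htmul_right _)))
  | hadd x y hx hy => simp only [htmul_add_right, map_add, hx, hy]
  | ht a b => simp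

/-- Associativity of the tensor product, as an equality of positive elements after reassociation of
the underlying spaces. -/
theorem tensor_tensor_eq {H K : Type} [NormedAddCommGroup H] [InnerProductSpace ℂ H]
    [CompleteSpace H] [NormedAddCommGroup K] [InnerProductSpace ℂ K] [CompleteSpace K]
    (s : H →L[ℂ] H) (t : K →L[ℂ] K) (a : PosElt X) :
    OpFam.tensor s (OpFam.tensor t a.val)
      = cj (htassoc H K a.rep.H : HTensor (HTensor H K) a.rep.H →L[ℂ] HTensor H (HTensor K a.rep.H))
          (OpFam.tensor (htmap s t) a.val) := by
  refine OpFam.ext fun r => HTensor.ext₃ fun ξ w ζ => ?_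
  change (htassoc H (HTensor K a.rep.H) r.L).symm (htmap s (OpFam.tensor t a.val r)
    (htassoc H (HTensor K a.rep.H) r.L (htmul (htmul ξ w) ζ)))
    = htmap (htassoc H K a.rep.H : HTensor (HTensor H K) a.rep.H →L[ℂ] _) (.id ℂ r.L)
      (OpFam.tensor (htmap s t) a.val r
      (htmap (adjoint (htassoc H K a.rep.H : HTensor (HTensor H K) a.rep.H →L[ℂ] _)) (.id ℂ r.L)
        (htmul (htmul ξ w) ζ)))
  rw [LinearIsometryEquiv.adjoint_eq_symm, htassoc_htmul, htmap_htmul, htmap_htmul]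
  induction w using HTensor.induction with
  | hcl =>
    refine isClosed_eq ((htassoc _ _ _).symm.continuous.comp ((continuous_htmul_right _).comp
      ((OpFam.tensor t a.val r).continuous.comp (continuous_htmul_left ζ))))
      ((htmap _ _).continuous.comp ((OpFam.tensor (htmap s t) a.val r).continuous.comp
        ((continuous_htmul_left _).comp ((htassoc _ _ _).symm.continuous.comp
          (continuous_htmul_right ξ)))))
  | hadd x y hx hy => simp only [htmul_add_right, htmul_add_left, map_add, hx, hy]
  | ht η κ =>
    have h1 : ∀ (z : HTensor K (HTensor a.rep.H r.L)), OpFam.tensor t a.val r ((htassoc _ _ _).symm z)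
        = (htassoc _ _ _).symm (htmap t (a.val r) z) := fun z => by simp [tensor_coord]
    have h2 : ∀ (z : HTensor (HTensor H K) (HTensor a.rep.H r.L)),
        OpFam.tensor (htmap s t) a.val r ((htassoc _ _ _).symm z)
        = (htassoc _ _ _).symm (htmap (htmap s t) (a.val r) z) := fun z => by simp [tensor_coord]
    rw [← htassoc_symm_htmul, h1, htmap_htmul, htassoc_pentagon]
    simp only [LinearIsometryEquiv.coe_coe'', htassoc_symm_htmul, ContinuousLinearMap.id_apply]
    rw [← htassoc_symm_htmul (htmul ξ η) κ ζ, h2, htmap_htmul, htmap_htmul]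

theorem tensor_tensor_equiv {μ ν : URep G} (s : StrictElt μ) (t : StrictElt ν) (a : PosElt X) :
    PosElt.tensor (s.tensor t) a ≤ PosElt.tensor s (PosElt.tensor t a) ∧
      PosElt.tensor s (PosElt.tensor t a) ≤ PosElt.tensor (s.tensor t) a := by
  have hV : Intertwines (μ := (μ.tensor ν).tensor a.rep) (ν := μ.tensor (ν.tensor a.rep))
      (htassoc μ.H ν.H a.rep.H :
        HTensor (HTensor μ.H ν.H) a.rep.H →L[ℂ] HTensor μ.H (HTensor ν.H a.rep.H)) := fun g => by
    have h : ∀ (ν μ : URep G) (g), (ν.tensor μ).op g = htmap (ν.op g) (μ.op g) :=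
      fun _ _ g => htcongr_coe _ _
    rw [h, h, h, h]
    exact HTensor.ext₃ fun ξ η ζ => by simp
  exact equiv_of_conj (a := PosElt.tensor (s.tensor t) a)
    (b := PosElt.tensor s (PosElt.tensor t a)) _ hV (adjoint_coe_comp (htassoc μ.H ν.H a.rep.H))
    (tensor_tensor_eq s.val.1 t.val.1 a)

/-- A direct sum is equivalent to a sum of orthogonal conjugates. -/
theorem sum_equiv_of_orthogonal {a b c : PosElt X} {V : a.rep.H →L[ℂ] c.rep.H}
    {W : b.rep.H →L[ℂ] c.rep.H} (hV : Intertwines V) (hW : Intertwines W)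
    (hVV : adjoint V ∘L V = .id ℂ _) (hWW : adjoint W ∘L W = .id ℂ _) (hVW : adjoint V ∘L W = 0)
    (h : c.val = cj V a.val + cj W b.val) : sum a b ≤ c ∧ c ≤ sum a b := by
  refine equiv_of_conj (a := sum a b) (b := c)
    (V ∘L adjoint (inL a.rep.H b.rep.H) + W ∘L adjoint (inR a.rep.H b.rep.H))
    ((hV.comp (intertwines_inL a.rep b.rep).adj).add (hW.comp (intertwines_inR a.rep b.rep).adj))
    (adjoint_comp_self_of_orthogonal hVV hWW hVW) ?_
  change c.val = cj _ (cj (inL a.rep.H b.rep.H) a.val + cj (inR a.rep.H b.rep.H) b.val)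
  rw [cj_add, cj_cj, cj_cj, add_comp_inL, add_comp_inR, h]

theorem cj_htmap_tensor {H H' K K' : Type} [NormedAddCommGroup H] [InnerProductSpace ℂ H]
    [CompleteSpace H] [NormedAddCommGroup K] [InnerProductSpace ℂ K] [CompleteSpace K]
    [NormedAddCommGroup H'] [InnerProductSpace ℂ H']
    [CompleteSpace H'] [NormedAddCommGroup K'] [InnerProductSpace ℂ K'] [CompleteSpace K']
    (V : H →L[ℂ] H') (W : K →L[ℂ] K') (s : H →L[ℂ] H) (x : OpFam X.carrier K K) :
    cj (htmap V W) (OpFam.tensor s x) = OpFam.tensor (V ∘L s ∘L adjoint V) (cj W x) := by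
  rw [cj, cj, adjoint_htmap, ← tensor_mult, ← tensor_mult, tensor_comp, tensor_comp]
  rfl

theorem cj_id {H : Type} [NormedAddCommGroup H] [InnerProductSpace ℂ H] [CompleteSpace H]
    (x : OpFam X.carrier H H) : cj (.id ℂ H) x = x := by
  have hid : adjoint (ContinuousLinearMap.id ℂ H) = .id ℂ H := adjoint_id
  rw [cj, hid, mult_id_comp, comp_mult_id]

theorem id_comp_comp_id {H : Type} [NormedAddCommGroup H] [InnerProductSpace ℂ H] [CompleteSpace H]
    (s : H →L[ℂ] H) : (.id ℂ H) ∘L s ∘L adjoint (.id ℂ H) = s := by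
  have hid : adjoint (ContinuousLinearMap.id ℂ H) = .id ℂ H := adjoint_id
  rw [hid]
  rfl

theorem adjoint_id_comp_id {H : Type} [NormedAddCommGroup H] [InnerProductSpace ℂ H]
    [CompleteSpace H] : adjoint (.id ℂ H) ∘L (.id ℂ H) = .id ℂ H := by
  have hid : adjoint (ContinuousLinearMap.id ℂ H) = .id ℂ H := adjoint_id
  rw [hid]
  rfl

theorem sum_tensor_equiv {μ ν : URep G} (s : StrictElt μ) (t : StrictElt ν) (a : PosElt X) :
    sum (PosElt.tensor s a) (PosElt.tensor t a) ≤ PosElt.tensor (s.sum t) a ∧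
      PosElt.tensor (s.sum t) a ≤ sum (PosElt.tensor s a) (PosElt.tensor t a) := by
  have h : OpFam.tensor (inL μ.H ν.H ∘L s.val.1 ∘L adjoint (inL μ.H ν.H)
      + inR μ.H ν.H ∘L t.val.1 ∘L adjoint (inR μ.H ν.H)) a.val
      = cj (htmap (inL μ.H ν.H) (.id ℂ a.rep.H)) (OpFam.tensor s.val.1 a.val)
        + cj (htmap (inR μ.H ν.H) (.id ℂ a.rep.H)) (OpFam.tensor t.val.1 a.val) := by
    rw [cj_htmap_tensor, cj_htmap_tensor, cj_id, ← tensor_add_left]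
  exact sum_equiv_of_orthogonal (a := PosElt.tensor s a) (b := PosElt.tensor t a)
    (c := PosElt.tensor (s.sum t) a) (V := htmap (inL μ.H ν.H) (.id ℂ a.rep.H))
    (W := htmap (inR μ.H ν.H) (.id ℂ a.rep.H))
    (intertwines_htmap (intertwines_inL μ ν) intertwines_id)
    (intertwines_htmap (intertwines_inR μ ν) intertwines_id)
    (adjoint_htmap_comp_self adjoint_inL_inL adjoint_id_comp_id)
    (adjoint_htmap_comp_self adjoint_inR_inR adjoint_id_comp_id)
    (adjoint_htmap_comp_of_left _ _ adjoint_inL_inR) h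

theorem tensor_sum_equiv {ν : URep G} (s : StrictElt ν) (a b : PosElt X) :
    sum (PosElt.tensor s a) (PosElt.tensor s b) ≤ PosElt.tensor s (sum a b) ∧
      PosElt.tensor s (sum a b) ≤ sum (PosElt.tensor s a) (PosElt.tensor s b) := by
  have h : OpFam.tensor s.val.1 (cj (inL a.rep.H b.rep.H) a.val + cj (inR a.rep.H b.rep.H) b.val)
      = cj (htmap (.id ℂ ν.H) (inL a.rep.H b.rep.H)) (OpFam.tensor s.val.1 a.val)
        + cj (htmap (.id ℂ ν.H) (inR a.rep.H b.rep.H)) (OpFam.tensor s.val.1 b.val) := by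
    rw [cj_htmap_tensor, cj_htmap_tensor, id_comp_comp_id, tensor_add]
  exact sum_equiv_of_orthogonal (a := PosElt.tensor s a) (b := PosElt.tensor s b)
    (c := PosElt.tensor s (sum a b)) (V := htmap (.id ℂ ν.H) (inL a.rep.H b.rep.H))
    (W := htmap (.id ℂ ν.H) (inR a.rep.H b.rep.H))
    (intertwines_htmap (ν := ν) (ν' := ν) intertwines_id (intertwines_inL a.rep b.rep))
    (intertwines_htmap (ν := ν) (ν' := ν) intertwines_id (intertwines_inR a.rep b.rep))
    (adjoint_htmap_comp_self adjoint_id_comp_id adjoint_inL_inL)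
    (adjoint_htmap_comp_self adjoint_id_comp_id adjoint_inR_inR)
    (adjoint_htmap_comp_of_right _ _ adjoint_inL_inR) h

theorem le_of_val_eq_zero {a b : PosElt X} (h : a.val = 0) : a ≤ b :=
  subeq_iff.2 fun ε hε => ⟨0, invK_zero, by rw [zero_comp, zero_comp, h, sub_zero, norm_zero]; exact hε⟩

end PosElt

namespace CuG

theorem mk_eq_zero {a : PosElt X} (h : a.val = 0) : mk a = 0 :=
  sound ⟨PosElt.le_of_val_eq_zero h, PosElt.le_of_val_eq_zero rfl⟩

variable [IsTopologicalGroup G] [CompactSpace G] [T2Space G]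

theorem exists_smul_eq (r : CuRep G) : ∃ (ν : URep G) (s : StrictElt ν), r = CuRep.mk ν ∧
    ∀ {X : GCStar.{u} G} (a : PosElt X), r • mk a = mk (PosElt.tensor s a) := by
  induction r using Quotient.ind with | _ ν => ?_
  obtain ⟨s⟩ := nonempty_strictElt ν
  exact ⟨ν, s, rfl, fun a => smul_mk s a⟩

theorem one_smul' (x : CuG X) : (1 : CuRep G) • x = x := by
  induction x using CuG.ind with | h a => ?_
  exact (smul_mk (StrictElt.one G) a).trans (sound (PosElt.tensor_one_equiv a).symm)

theorem mul_smul' (r s : CuRep G) (x : CuG X) : (r * s) • x = r • s • x := by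
  induction x using CuG.ind with | h a => ?_
  obtain ⟨μ, σ, rfl, hr⟩ := exists_smul_eq.{u} r
  obtain ⟨ν, τ, rfl, hs⟩ := exists_smul_eq.{u} s
  rw [hs, hr, CuRep.mk_mul, smul_mk (σ.tensor τ)]
  exact sound (PosElt.tensor_tensor_equiv σ τ a)

theorem add_smul' (r s : CuRep G) (x : CuG X) : (r + s) • x = r • x + s • x := by
  induction x using CuG.ind with | h a => ?_
  obtain ⟨μ, σ, rfl, hr⟩ := exists_smul_eq.{u} r
  obtain ⟨ν, τ, rfl, hs⟩ := exists_smul_eq.{u} s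
  rw [hs, hr, CuRep.mk_add, smul_mk (σ.sum τ)]
  exact sound (PosElt.sum_tensor_equiv σ τ a).symm

theorem smul_add' (r : CuRep G) (x y : CuG X) : r • (x + y) = r • x + r • y := by
  induction x using CuG.ind with | h a => ?_
  induction y using CuG.ind with | h b => ?_
  obtain ⟨ν, σ, rfl, hr⟩ := exists_smul_eq.{u} r
  rw [mk_add, hr, hr, hr]
  exact sound (PosElt.tensor_sum_equiv σ a b).symm

theorem smul_zero' (r : CuRep G) : r • (0 : CuG X) = 0 := by
  obtain ⟨ν, σ, rfl, hr⟩ := exists_smul_eq.{u} r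
  exact (hr (PosElt.zero X)).trans (mk_eq_zero (tensor_zero _))

theorem zero_smul' (x : CuG X) : (0 : CuRep G) • x = 0 := by
  induction x using CuG.ind with | h a => ?_
  obtain ⟨σ⟩ := nonempty_strictElt (URep.zero G)
  refine (smul_mk σ a).trans (mk_eq_zero ?_)
  have h : σ.val.1 = 0 := ContinuousLinearMap.ext fun z => Subsingleton.elim _ _
  change OpFam.tensor σ.val.1 a.val = 0
  rw [h, tensor_zero_left]

theorem smul_le_smul' {r s : CuRep G} {x y : CuG X} (hxy : x ≤ y) (hrs : r ≤ s) :
    r • x ≤ s • y := by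
  induction x using CuG.ind with | h a => ?_
  induction y using CuG.ind with | h b => ?_
  obtain ⟨μ, σ, rfl, hr⟩ := exists_smul_eq.{u} r
  obtain ⟨ν, τ, rfl, hs⟩ := exists_smul_eq.{u} s
  rw [hr, hs]
  exact mk_le_mk.2 (PosElt.tensor_le_tensor σ τ hrs (mk_le_mk.1 hxy))

theorem map_smul' {Y : GCStar.{u} G} (φ : X ⟶ Y) (r : CuRep G) (x : CuG X) :
    map φ (r • x) = r • map φ x := by
  induction x using CuG.ind with | h a => ?_
  obtain ⟨ν, σ, rfl, hr⟩ := exists_smul_eq.{u} r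
  rw [hr, map_mk, map_mk, hr]
  rfl

end CuG

end

/-! ### Subrepresentations and limits of representations -/

section

section Strong

variable {H K L : Type*} [NormedAddCommGroup H] [InnerProductSpace ℂ H]
  [NormedAddCommGroup K] [InnerProductSpace ℂ K] [NormedAddCommGroup L] [InnerProductSpace ℂ L]

theorem isClosed_setOf_tendsto_apply {q : ℕ → H →L[ℂ] H} {M : ℝ} (hM : ∀ n, ‖q n‖ ≤ M) :
    IsClosed {z | Tendsto (fun n => q n z) atTop (𝓝 z)} := by
  have hM0 : 0 ≤ M := (norm_nonneg _).trans (hM 0)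
  refine isClosed_of_closure_subset fun z hz => Metric.tendsto_nhds.2 fun ε hε => ?_
  obtain ⟨w, hw, hzw⟩ := Metric.mem_closure_iff.1 hz (ε / (2 * (M + 1))) (by positivity)
  filter_upwards [Metric.tendsto_nhds.1 hw (ε / 2) (half_pos hε)] with n hn
  rw [dist_eq_norm] at hzw hn ⊢
  have e : q n z - z = (q n w - w) + (q n (z - w) - (z - w)) := by rw [map_sub]; abel
  have h1 : ‖q n (z - w) - (z - w)‖ ≤ (M + 1) * ‖z - w‖ := by
    refine (norm_sub_le _ _).trans ?_
    have := (q n).le_of_opNorm_le (hM n) (z - w)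
    linarith
  have h2 : (M + 1) * ‖z - w‖ < ε / 2 := by
    calc _ < (M + 1) * (ε / (2 * (M + 1))) := by gcongr
      _ = ε / 2 := by field_simp
  rw [e]
  exact (norm_add_le _ _).trans_lt (by linarith)

variable [CompleteSpace H] [CompleteSpace K]

theorem norm_le_one_of_isometry {V : H →L[ℂ] K} (hV : adjoint V ∘L V = .id ℂ H) : ‖V‖ ≤ 1 := by
  have h1 := ContinuousLinearMap.norm_adjoint_comp_self V
  rw [hV] at h1
  have h2 : ‖ContinuousLinearMap.id ℂ H‖ ≤ 1 := ContinuousLinearMap.norm_id_le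
  nlinarith [norm_nonneg V]

theorem norm_comp_adjoint_le_one {V : H →L[ℂ] K} (hV : adjoint V ∘L V = .id ℂ H) :
    ‖V ∘L adjoint V‖ ≤ 1 := by
  have h1 := norm_le_one_of_isometry hV
  refine (ContinuousLinearMap.opNorm_comp_le _ _).trans ?_
  rw [LinearIsometryEquiv.norm_map]
  nlinarith [norm_nonneg V]

/-- Compressions of a compact self-adjoint operator along projections converging strongly to the
identity converge in norm. -/
theorem tendsto_norm_compress_sub {p : ℕ → H →L[ℂ] H} (hps : ∀ n, adjoint (p n) = p n)
    (hp1 : ∀ n, ‖p n‖ ≤ 1) (hp : ∀ z, Tendsto (fun n => p n z) atTop (𝓝 z)) {s : H →L[ℂ] H}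
    (hs : IsCompactOperator s) (hsa : adjoint s = s) :
    Tendsto (fun n => ‖p n ∘L s ∘L p n - s‖) atTop (𝓝 0) := by
  have h1 : Tendsto (fun n => ‖(p n - .id ℂ H) ∘L s‖) atTop (𝓝 0) := by
    refine tendsto_norm_comp_of_isCompactOperator (M := 2) (fun n => ?_) (fun z => ?_) hs
    · have h2 : ‖ContinuousLinearMap.id ℂ H‖ ≤ 1 := ContinuousLinearMap.norm_id_le
      exact (norm_sub_le _ _).trans (by linarith [hp1 n])
    · simpa using (hp z).sub_const z
  refine squeeze_zero (fun _ => norm_nonneg _) (fun n => ?_)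
    (g := fun n => 2 * ‖(p n - .id ℂ H) ∘L s‖) (by
    have := h1.const_mul 2
    rwa [mul_zero] at this)
  have e : p n ∘L s ∘L p n - s
      = ((p n - .id ℂ H) ∘L s) ∘L p n + adjoint ((p n - .id ℂ H) ∘L s) := by
    have hid : adjoint (ContinuousLinearMap.id ℂ H) = .id ℂ H := adjoint_id
    rw [adjoint_comp, map_sub, hps, hsa, hid]
    ext z
    simp
  rw [e]
  refine (norm_add_le _ _).trans ?_
  rw [LinearIsometryEquiv.norm_map]
  have h3 := (ContinuousLinearMap.opNorm_comp_le ((p n - .id ℂ H) ∘L s) (p n)).trans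
    (mul_le_of_le_one_right (norm_nonneg _) (hp1 n))
  linarith

end Strong

variable {G : Type v} [Group G] [TopologicalSpace G] {X : GCStar.{u} G}

namespace URep

/-- The restriction of a representation to a closed invariant subspace. -/
abbrev subrep (ν : URep G) (E : Submodule ℂ ν.H) (hE : IsClosed (E : Set ν.H))
    (hinv : ∀ g, ∀ x ∈ E, ν.ρ g x ∈ E) : URep G where
  H := E
  cs := hE.completeSpace_coe
  sep := by
    have := UniformSpace.secondCountable_of_separable ν.H
    infer_instance
  ρ :=
    { toFun := fun g =>
        { toFun := fun x => ⟨ν.ρ g x, hinv g x x.2⟩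
          invFun := fun x => ⟨ν.ρ g⁻¹ x, hinv g⁻¹ x x.2⟩
          map_add' := fun x y => Subtype.ext (map_add (ν.ρ g) _ _)
          map_smul' := fun c x => Subtype.ext (map_smul (ν.ρ g) _ _)
          left_inv := fun x => Subtype.ext (DFunLike.congr_fun (ν.op_inv_comp g) x.1)
          right_inv := fun x => Subtype.ext (DFunLike.congr_fun (ν.op_comp_inv g) x.1)
          norm_map' := fun x => (ν.ρ g).norm_map x }
      map_one' := LinearIsometryEquiv.ext fun x => Subtype.ext (by
        change ν.ρ 1 x = x
        rw [map_one]; rfl)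
      map_mul' := fun g h => LinearIsometryEquiv.ext fun x => Subtype.ext (by
        change ν.ρ (g * h) x = ν.ρ g (ν.ρ h x)
        rw [map_mul]; rfl) }
  cont ξ := (ν.cont ξ).subtype_mk _

section

variable (ν : URep G) (E : Submodule ℂ ν.H) (hE : IsClosed (E : Set ν.H))
    (hinv : ∀ g, ∀ x ∈ E, ν.ρ g x ∈ E)

theorem sub_subrep : (ν.subrep E hE hinv).Sub ν := ⟨E.subtypeₗᵢ, fun _ _ => rfl⟩

end

/-- The limit of a sequence of representations, each contained in the next one. -/
theorem exists_limit (ν : ℕ → URep G) (h : ∀ n, (ν n).Sub (ν (n + 1))) :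
    ∃ (lam : URep G) (J : ∀ n, (ν n).H →L[ℂ] lam.H), (∀ n, Intertwines (J n)) ∧
      (∀ n, adjoint (J n) ∘L J n = .id ℂ (ν n).H) ∧
      ∀ z, Tendsto (fun n => (J n ∘L adjoint (J n)) z) atTop (𝓝 z) := by
  choose V' hV' using h
  let V : ∀ n, (ν n).H →L[ℂ] (ν (n + 1)).H := fun n => (V' n).toContinuousLinearMap
  have hV : ∀ n, Intertwines (V n) := fun n g => ContinuousLinearMap.ext fun ξ => hV' n g ξ
  have hVV : ∀ n, adjoint (V n) ∘L V n = .id ℂ _ := fun n => adjoint_linearIsometry_comp (V' n)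
  -- in the new summand, `J (n + 1)` only places the complement of the range of `V n`
  let J : ∀ n, (ν n).H →L[ℂ] (seqSum ν).H := fun n => Nat.rec (seqIncl ν 0)
    (fun n J => J ∘L adjoint (V n) + seqIncl ν (n + 1) ∘L (.id ℂ _ - V n ∘L adjoint (V n))) n
  have hJs : ∀ n, J (n + 1) = J n ∘L adjoint (V n)
      + seqIncl ν (n + 1) ∘L (.id ℂ _ - V n ∘L adjoint (V n)) := fun n => rfl
  have hJint : ∀ n, Intertwines (μ := ν n) (ν := seqSum ν) (J n) := fun n => by
    induction n with
    | zero => exact intertwines_seqIncl ν 0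
    | succ n ih =>
      rw [hJs]
      exact (ih.comp (hV n).adj).add ((intertwines_seqIncl ν (n + 1)).comp
        (intertwines_id.sub ((hV n).comp (hV n).adj)))
  have hJorth : ∀ n m, n < m → adjoint (seqIncl ν m) ∘L J n = 0 := fun n => by
    induction n with
    | zero => exact fun m hm => adjoint_seqIncl_comp_of_ne ν hm.ne'
    | succ n ih =>
      intro m hm
      rw [hJs, ContinuousLinearMap.comp_add, ← ContinuousLinearMap.comp_assoc, ih m (by omega),
        ← ContinuousLinearMap.comp_assoc, adjoint_seqIncl_comp_of_ne ν hm.ne',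
        ContinuousLinearMap.zero_comp, ContinuousLinearMap.zero_comp, add_zero]
  have hJV : ∀ n x, J (n + 1) (V n x) = J n x := fun n x => by
    have h1 : adjoint (V n) (V n x) = x := DFunLike.congr_fun (hVV n) x
    rw [hJs]
    simp [h1]
  have hJJ : ∀ n x, adjoint (J n) (J n x) = x := fun n => by
    induction n with
    | zero => exact fun x => DFunLike.congr_fun (adjoint_seqIncl_comp_self ν 0) x
    | succ n ih =>
      intro x
      have h1 : ∀ y, adjoint (V n) (V n y) = y := fun y => DFunLike.congr_fun (hVV n) y
      have h2 : ∀ y, adjoint (seqIncl ν (n + 1)) (J n y) = 0 := fun y =>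
        DFunLike.congr_fun (hJorth n (n + 1) n.lt_succ_self) y
      have h3 : ∀ y, adjoint (J n) (seqIncl ν (n + 1) y) = 0 := fun y => by
        have := congrArg adjoint (hJorth n (n + 1) n.lt_succ_self)
        rw [adjoint_comp, adjoint_adjoint, map_zero] at this
        exact DFunLike.congr_fun this y
      have h4 : ∀ y, adjoint (seqIncl ν (n + 1)) (seqIncl ν (n + 1) y) = y := fun y =>
        DFunLike.congr_fun (adjoint_seqIncl_comp_self ν (n + 1)) y
      have hid : adjoint (ContinuousLinearMap.id ℂ (ν (n + 1)).H) = .id ℂ _ := adjoint_id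
      have e : adjoint (J (n + 1)) = V n ∘L adjoint (J n)
          + (.id ℂ _ - V n ∘L adjoint (V n)) ∘L adjoint (seqIncl ν (n + 1)) := by
        rw [hJs, map_add, adjoint_comp, adjoint_comp, map_sub, adjoint_comp, adjoint_adjoint, hid]
      rw [e, hJs]
      simp [h1, h2, h3, h4, ih]
  set E : Submodule ℂ (seqSum ν).H :=
    (Submodule.span ℂ (⋃ n, Set.range (J n))).topologicalClosure with hE
  have hEc : IsClosed (E : Set (seqSum ν).H) := Submodule.isClosed_topologicalClosure _
  have hJE : ∀ n x, J n x ∈ E := fun n x =>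
    Submodule.le_topologicalClosure _ (Submodule.subset_span (Set.mem_iUnion.2 ⟨n, x, rfl⟩))
  have hmin : ∀ F : Submodule ℂ (seqSum ν).H, IsClosed (F : Set (seqSum ν).H) →
      (∀ n x, J n x ∈ F) → E ≤ F := fun F hF hJF =>
    Submodule.topologicalClosure_minimal _ (Submodule.span_le.2 (Set.iUnion_subset fun n => by
      rintro _ ⟨x, rfl⟩; exact hJF n x)) hF
  have hinv : ∀ g, ∀ x ∈ E, (seqSum ν).ρ g x ∈ E := fun g => by
    refine hmin (E.comap ((seqSum ν).op g).toLinearMap) (hEc.preimage ((seqSum ν).op g).continuous)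
      fun n x => ?_
    have h1 : (seqSum ν).op g (J n x) = J n ((ν n).op g x) :=
      (DFunLike.congr_fun (hJint n g) x).symm
    change (seqSum ν).op g (J n x) ∈ E
    rw [h1]
    exact hJE n _
  have hlim : ∀ z ∈ E, Tendsto (fun n => (J n ∘L adjoint (J n)) z) atTop (𝓝 z) := by
    have hJ1 : ∀ n, ‖J n ∘L adjoint (J n)‖ ≤ 1 := fun n =>
      norm_comp_adjoint_le_one (ContinuousLinearMap.ext fun x => hJJ n x)
    refine hmin
      { carrier := {z | Tendsto (fun n => (J n ∘L adjoint (J n)) z) atTop (𝓝 z)}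
        add_mem' := fun {x y} hx hy => by simpa only [Set.mem_ofPred_eq, map_add] using hx.add hy
        zero_mem' := by simp
        smul_mem' := fun c x hx => by simpa only [Set.mem_ofPred_eq, map_smul] using hx.const_smul c }
      (isClosed_setOf_tendsto_apply hJ1) fun n x => ?_
    have hle : ∀ k, ∃ y, J n x = J (n + k) y := fun k => by
      induction k with
      | zero => exact ⟨x, rfl⟩
      | succ k ih =>
        obtain ⟨y, hy⟩ := ih
        exact ⟨V (n + k) y, by rw [hy]; exact (hJV _ _).symm⟩
    refine tendsto_const_nhds.congr' ?_
    filter_upwards [eventually_ge_atTop n] with m hm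
    obtain ⟨k, rfl⟩ := Nat.exists_eq_add_of_le hm
    obtain ⟨y, hy⟩ := hle k
    rw [hy, ContinuousLinearMap.comp_apply, hJJ]
  let J' : ∀ n, (ν n).H →L[ℂ] ((seqSum ν).subrep E hEc hinv).H := fun n =>
    (J n).codRestrict E (hJE n)
  have hadj : ∀ n (z : ((seqSum ν).subrep E hEc hinv).H), adjoint (J' n) z = adjoint (J n) z.1 := by
    intro n z
    refine ext_inner_left ℂ fun w => ?_
    rw [ContinuousLinearMap.adjoint_inner_right, ContinuousLinearMap.adjoint_inner_right]
    rfl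
  refine ⟨(seqSum ν).subrep E hEc hinv, J', fun n g => ?_, fun n => ?_, fun z => ?_⟩
  · refine ContinuousLinearMap.ext fun x => Subtype.ext ?_
    exact DFunLike.congr_fun (hJint n g) x
  · refine ContinuousLinearMap.ext fun x => ?_
    change adjoint (J' n) (J' n x) = x
    rw [hadj]
    exact hJJ n x
  · refine tendsto_subtype_rng.2 ?_
    refine (hlim z.1 z.2).congr fun n => ?_
    change J n (adjoint (J n) z.1) = J n (adjoint (J' n) z)
    rw [hadj]

end URep

namespace CuG

variable [IsTopologicalGroup G] [CompactSpace G] [T2Space G]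

/-- The action preserves suprema of increasing sequences in both variables together. A supremum of
the representations is below their limit `lam`, and `s_lam ⊗ C` is approximated by the elements
`p_n s_lam p_n ⊗ y`, which lie below `ν_n ⊗ a_n`. -/
theorem isLUB_smul {x : ℕ → CuG X} {r : ℕ → CuRep G} (hx : Monotone x) (hr : Monotone r)
    {x₀ : CuG X} {r₀ : CuRep G} (hx₀ : IsLUB (Set.range x) x₀) (hr₀ : IsLUB (Set.range r) r₀) :
    IsLUB (Set.range fun n => r n • x n) (r₀ • x₀) := by
  refine ⟨?_, fun t ht => ?_⟩
  · rintro _ ⟨n, rfl⟩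
    exact smul_le_smul' (hx₀.1 ⟨n, rfl⟩) (hr₀.1 ⟨n, rfl⟩)
  obtain ⟨a, C, rfl, hC⟩ := exists_isApproxSup hx
  choose ν σ hν hνs using fun n => exists_smul_eq.{u} (r n)
  have hsub : ∀ n, (ν n).Sub (ν (n + 1)) := fun n => by
    have := hr n.le_succ
    rwa [hν, hν, CuRep.mk_le_mk] at this
  obtain ⟨lam, J, hJ, hJJ, hlim⟩ := URep.exists_limit ν hsub
  have hr₀lam : r₀ ≤ CuRep.mk lam := hr₀.2 (by
    rintro _ ⟨n, rfl⟩
    rw [hν, CuRep.mk_le_mk]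
    refine ⟨⟨(J n).toLinearMap, fun z => ?_⟩, fun g ξ => DFunLike.congr_fun (hJ n g) ξ⟩
    have h1 : inner ℂ (J n z) (J n z) = (inner ℂ z z : ℂ) := by
      rw [← ContinuousLinearMap.adjoint_inner_right]
      congr 1
      exact DFunLike.congr_fun (hJJ n) z
    change ‖J n z‖ = ‖z‖
    rw [@norm_eq_sqrt_re_inner ℂ _ _ _ _ (J n z), h1, ← @norm_eq_sqrt_re_inner ℂ])
  rw [hx₀.unique (isLUB_of_isApproxSup hC)]
  refine (smul_le_smul' le_rfl hr₀lam).trans ?_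
  obtain ⟨s⟩ := nonempty_strictElt lam
  rw [smul_mk s]
  induction t using CuG.ind with | h t => ?_
  refine mk_le_mk.2 (PosElt.le_of_forall_norm_sub_lt fun ε hε => ?_)
  have hPs : ∀ n, adjoint (J n ∘L adjoint (J n)) = J n ∘L adjoint (J n) := fun n => by
    rw [adjoint_comp, adjoint_adjoint]
  have h1 := (tendsto_norm_compress_sub hPs (fun n => norm_comp_adjoint_le_one (hJJ n)) hlim
    s.val.2 (isSelfAdjoint_of_isPositive s.strict.1)).eventually_lt_const
    (show 0 < ε / (2 * (‖C.val‖ + 2)) by positivity)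
  obtain ⟨n, hn, y, hy, hyp, hyn, hle⟩ := (h1.and (hC.approx (min 1 (ε / (2 * (‖s.val.1‖ + 1))))
    (lt_min one_pos (by positivity)))).exists
  -- `p s p = J (J^* s J) J^*` with `p = J J^*`
  have hτ : adjoint (J n) ∘L s.val.1 ∘L J n ∈ opAlg (ν n) :=
    ⟨(s.val.2.comp_clm (J n)).clm_comp (adjoint (J n)), (hJ n).adj.comp (s.intertwines.comp (hJ n))⟩
  have hτp : (adjoint (J n) ∘L s.val.1 ∘L J n).IsPositive := s.strict.1.adjoint_conj (J n)
  have hq : J n ∘L (adjoint (J n) ∘L s.val.1 ∘L J n) ∘L adjoint (J n) ∈ opAlg lam :=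
    ⟨(hτ.1.comp_clm (adjoint (J n))).clm_comp (J n), (hJ n).comp (hτ.2.comp (hJ n).adj)⟩
  have hqp : (J n ∘L (adjoint (J n) ∘L s.val.1 ∘L J n) ∘L adjoint (J n)).IsPositive :=
    hτp.conj_adjoint (J n)
  have h2 := PosElt.tensorOp_le hq hqp (σ n).mem_opAlg (σ n).strict.1 ((σ n).kLe hτ hτp (hJ n)) hle
  have h3 : PosElt.tensor (σ n) (a n) ≤ t := by
    have := ht ⟨n, rfl⟩
    simp only [hνs] at this
    exact mk_le_mk.1 this
  refine ⟨OpFam.tensor (J n ∘L (adjoint (J n) ∘L s.val.1 ∘L J n) ∘L adjoint (J n)) y,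
    tensor_mem_invK hq.1 hq.2 hy, tensor_pos hqp hyp, ?_, h2.trans h3⟩
  refine (PosElt.norm_tensor_sub_tensor_le _ _ _ _).trans_lt ?_
  have e : J n ∘L (adjoint (J n) ∘L s.val.1 ∘L J n) ∘L adjoint (J n)
      = (J n ∘L adjoint (J n)) ∘L s.val.1 ∘L (J n ∘L adjoint (J n)) := rfl
  rw [← e] at hn
  have h4 : ‖y‖ ≤ ‖C.val‖ + 1 := by
    have h5 := norm_add_le (y - C.val) C.val
    rw [sub_add_cancel] at h5
    linarith [hyn.trans_le (min_le_left _ _)]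
  have h5 := hyn.trans_le (min_le_right _ _)
  have h6 : ‖s.val.1‖ * ‖y - C.val‖ ≤ ε / 2 := by
    calc _ ≤ (‖s.val.1‖ + 1) * (ε / (2 * (‖s.val.1‖ + 1))) := by gcongr; linarith
      _ = ε / 2 := by field_simp
  have h7 : ‖J n ∘L (adjoint (J n) ∘L s.val.1 ∘L J n) ∘L adjoint (J n) - s.val.1‖ * ‖y‖ < ε / 2 := by
    calc _ ≤ ε / (2 * (‖C.val‖ + 2)) * (‖C.val‖ + 1) := by gcongr
      _ < ε / 2 := by
        rw [div_mul_eq_mul_div, div_lt_div_iff₀ (by positivity) (by positivity)]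
        nlinarith [norm_nonneg C.val]
  linarith

end CuG

end

/-! ### Intertwining unitaries near a given partial isometry -/

section

section Perturbation

variable {G : Type v} [Group G] [TopologicalSpace G] {ν lam N : URep G}

/-- An invertible positive intertwiner has an invertible positive square root that intertwines. -/
theorem exists_sqrt_inverse {h : ν.H →L[ℂ] ν.H} (hp : 0 ≤ h) (hu : IsUnit h) (hh : h ∈ commAlg ν) :
    ∃ r q : ν.H →L[ℂ] ν.H, 0 ≤ r ∧ r * r = h ∧ q * r = 1 ∧ r * q = 1 ∧ star q = q ∧
      q ∈ commAlg ν := by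
  have hr0 : 0 ≤ CFC.sqrt h := CFC.sqrt_nonneg h
  have hrr : CFC.sqrt h * CFC.sqrt h = h := CFC.sqrt_mul_sqrt_self h hp
  have hrm : CFC.sqrt h ∈ commAlg ν := by
    rw [CFC.sqrt_eq_real_sqrt h hp]
    exact cfcₙ_real_mem isClosed_commAlg _ hh
  generalize CFC.sqrt h = r at hr0 hrr hrm
  have hru : IsUnit r := ((Commute.refl r).isUnit_mul_iff.1 (hrr ▸ hu)).1
  obtain ⟨w, rfl⟩ := hru
  refine ⟨w, (w⁻¹ : _ˣ), hr0, hrr, w.inv_mul, w.mul_inv, ?_, fun g => ?_⟩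
  · have h1 : star (w : ν.H →L[ℂ] ν.H) = w := (IsSelfAdjoint.of_nonneg hr0).star_eq
    have h2 : star w = w := Units.ext h1
    rw [← Units.coe_star, star_inv, h2]
  · have h1 : Commute (w : ν.H →L[ℂ] ν.H) (ν.op g) := hrm g
    exact h1.units_inv_left

/-- `r + 1` is bounded below by `1` for positive `r`. -/
theorem norm_le_norm_add_apply {H : Type*} [NormedAddCommGroup H] [InnerProductSpace ℂ H]
    [CompleteSpace H] {r : H →L[ℂ] H} (hr : 0 ≤ r) (x : H) : ‖x‖ ≤ ‖r x + x‖ := by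
  have h1 : 0 ≤ RCLike.re (inner ℂ (r x) x) :=
    (ContinuousLinearMap.nonneg_iff_isPositive r |>.1 hr).re_inner_nonneg_left x
  have h2 : ‖x‖ ^ 2 ≤ ‖r x + x‖ ^ 2 := by
    rw [@norm_add_sq ℂ]
    nlinarith [sq_nonneg ‖r x‖]
  exact (sq_le_sq₀ (norm_nonneg _) (norm_nonneg _)).1 h2

/-- Adding a small multiple of the identity to the partial isometry `V W^*` makes it invertible. -/
theorem exists_isUnit_add_smul {H N : Type*} [NormedAddCommGroup H] [InnerProductSpace ℂ H]
    [CompleteSpace H] [NormedAddCommGroup N] [InnerProductSpace ℂ N] [FiniteDimensional ℂ N]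
    [CompleteSpace N] (V W : N →L[ℂ] H) {δ : ℝ} (hδ : 0 < δ) :
    ∃ t : ℝ, 0 < t ∧ t < δ ∧ IsUnit ((t : ℂ) • (1 : H →L[ℂ] H) + V ∘L adjoint W) := by
  have hfin := Module.End.finite_hasEigenvalue ((adjoint W ∘L V : N →L[ℂ] N) : Module.End ℂ N)
  have hfin' : {t : ℝ | Module.End.HasEigenvalue
      ((adjoint W ∘L V : N →L[ℂ] N) : Module.End ℂ N) (-(t : ℂ))}.Finite :=
    hfin.preimage (f := fun t : ℝ => -(t : ℂ)) (fun a _ b _ h => by simpa using h)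
  obtain ⟨t, ht, hte⟩ := ((Set.Ioo_infinite hδ).sdiff hfin').nonempty
  refine ⟨t, ht.1, ht.2, ?_⟩
  have ht0 : -(t : ℂ) ≠ 0 := by simpa using ht.1.ne'
  have := FiniteDimensional.proper ℂ N
  have hc : IsCompactOperator (V ∘L adjoint W) :=
    (isCompactOperator_of_locallyCompactSpace_dom (adjoint W)).clm_comp V
  rcases hc.hasEigenvalue_or_mem_resolventSet ht0 with h | h
  · refine absurd ?_ hte
    obtain ⟨x, hx, hx0⟩ := h.exists_hasEigenvector
    rw [Module.End.mem_eigenspace_iff] at hx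
    have hx' : V (adjoint W x) = -(t : ℂ) • x := hx
    refine Module.End.hasEigenvalue_of_hasEigenvector (x := adjoint W x) ⟨?_, fun h0 => ?_⟩
    · rw [Module.End.mem_eigenspace_iff]
      change adjoint W (V (adjoint W x)) = _
      rw [hx', map_smul]
    · rw [h0, map_zero] at hx'
      exact (smul_ne_zero ht0 hx0) hx'.symm
  · rw [spectrum.mem_resolventSet_iff] at h
    convert h.neg using 1
    rw [Algebra.algebraMap_eq_smul_one]
    ext z
    simp [add_comm]

/-- Two equivariant isometric embeddings `V`, `W` of a finite-dimensional representation into the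
same representation agree up to an arbitrarily small perturbation and an equivariant isometry `u`:
the isometric part of a small invertible perturbation of `V W^*`. -/
theorem URep.exists_isometry_comp_near [FiniteDimensional ℂ N.H] {V W : N.H →L[ℂ] lam.H}
    (hV : Intertwines V) (hW : Intertwines W) (hVV : adjoint V ∘L V = .id ℂ N.H)
    (hWW : adjoint W ∘L W = .id ℂ N.H) {ε : ℝ} (hε : 0 < ε) :
    ∃ u : lam.H →L[ℂ] lam.H, Intertwines (μ := lam) (ν := lam) u ∧
      adjoint u ∘L u = .id ℂ lam.H ∧ ∀ x, ‖u (W x) - V x‖ ≤ ε * ‖x‖ := by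
  obtain ⟨t, ht0, ht1, hT⟩ := exists_isUnit_add_smul V W (δ := min 1 (ε / 4))
    (lt_min one_pos (by positivity))
  set T : lam.H →L[ℂ] lam.H := (t : ℂ) • (1 : lam.H →L[ℂ] lam.H) + V ∘L adjoint W with hTdef
  have hTm : T ∈ commAlg lam :=
    (Intertwines.smul (μ := lam) (ν := lam) (t : ℂ) intertwines_id).add (hV.comp hW.adj)
  obtain ⟨r, q, hr, hrr, hqr, hrq, hqs, hq⟩ := exists_sqrt_inverse (h := star T * T)
    (star_mul_self_nonneg T) (hT.star.mul hT) (mul_mem (star_mem hTm) hTm)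
  have hV1 : ∀ x, adjoint V (V x) = x := fun x => DFunLike.congr_fun hVV x
  have hW1 : ∀ x, adjoint W (W x) = x := fun x => DFunLike.congr_fun hWW x
  have hVn : ∀ x, ‖V x‖ ≤ ‖x‖ := fun x =>
    (V.le_of_opNorm_le (norm_le_one_of_isometry hVV) x).trans_eq (one_mul _)
  have hWn : ∀ x, ‖W x‖ ≤ ‖x‖ := fun x =>
    (W.le_of_opNorm_le (norm_le_one_of_isometry hWW) x).trans_eq (one_mul _)
  have huu : star (T * q) * (T * q) = 1 := by
    calc _ = q * (star T * T) * q := by rw [star_mul, hqs]; simp only [mul_assoc]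
      _ = (q * r) * (r * q) := by rw [← hrr]; simp only [mul_assoc]
      _ = 1 := by rw [hqr, hrq, one_mul]
  refine ⟨T * q, mul_mem hTm hq, huu, fun x => ?_⟩
  have hTs : star T = (t : ℂ) • (1 : lam.H →L[ℂ] lam.H) + W ∘L adjoint V := by
    rw [hTdef, star_add, star_smul, star_one, ContinuousLinearMap.star_eq_adjoint, adjoint_comp,
      adjoint_adjoint]
    simp
  have hTW : T (W x) = (t : ℂ) • W x + V x := by simp [hTdef, hW1]
  have hun : ∀ y, ‖(T * q) y‖ ≤ ‖y‖ := fun y =>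
    ((T * q).le_of_opNorm_le (norm_le_one_of_isometry huu) y).trans_eq (one_mul _)
  have e1 : (T * q) (W x) - V x = (T * q) (W x - r (W x)) + (t : ℂ) • W x := by
    have h1 : (T * q) (r (W x)) = T (W x) := by
      have h2 : (q * r) (W x) = W x := by rw [hqr]; rfl
      exact congrArg T h2
    rw [map_sub, h1, hTW]
    abel
  have ht' : ‖(t : ℂ)‖ = t := by rw [Complex.norm_real, Real.norm_of_nonneg ht0.le]
  -- `(r + 1)(r - 1) W = (T^* T - 1) W` is of size at most `3t`
  have e2 : r (r (W x) - W x) + (r (W x) - W x)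
      = (t : ℂ) • (t : ℂ) • W x + (t : ℂ) • V x + (t : ℂ) • W (adjoint V (W x)) := by
    have h1 : r (r (W x)) = star T (T (W x)) := DFunLike.congr_fun hrr (W x)
    rw [map_sub, h1, hTW, hTs]
    simp [hV1]
    abel
  have hV2 : ‖W (adjoint V (W x))‖ ≤ ‖x‖ := by
    refine (hWn _).trans (((adjoint V).le_of_opNorm_le (c := 1) ?_ _).trans ?_)
    · rw [LinearIsometryEquiv.norm_map]
      exact norm_le_one_of_isometry hVV
    · rw [one_mul]; exact hWn x
  have h3 : ‖r (W x) - W x‖ ≤ 3 * t * ‖x‖ := by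
    refine (norm_le_norm_add_apply hr _).trans ?_
    rw [e2]
    refine (norm_add₃_le).trans ?_
    simp only [norm_smul, ht']
    have ht1' := ht1.trans_le (min_le_left _ _)
    have a1 : t * (t * ‖W x‖) ≤ t * ‖x‖ := by
      gcongr
      nlinarith [hWn x, norm_nonneg (W x)]
    have a2 : t * ‖V x‖ ≤ t * ‖x‖ := by gcongr; exact hVn x
    have a3 : t * ‖W (adjoint V (W x))‖ ≤ t * ‖x‖ := by gcongr
    linarith
  rw [e1]
  calc _ ≤ ‖W x - r (W x)‖ + t * ‖W x‖ := by
        refine (norm_add_le _ _).trans (add_le_add (hun _) ?_)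
        rw [norm_smul, ht']
    _ ≤ 3 * t * ‖x‖ + t * ‖x‖ := by
        rw [norm_sub_rev]
        gcongr
        exact hWn x
    _ ≤ ε * ‖x‖ := by
        have := ht1.trans_le (min_le_right _ _)
        nlinarith [norm_nonneg x]

end Perturbation

end

/-! ### Exhaustion by finite-dimensional subrepresentations -/

section

variable {G : Type v} [Group G] [TopologicalSpace G]

namespace URep

/-- The vectors that lie in a finite-dimensional invariant subspace. -/
def finiteVectors (ν : URep G) : Submodule ℂ ν.H where
  carrier := {x | ∃ E : Submodule ℂ ν.H, FiniteDimensional ℂ E ∧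
    (∀ g, ∀ y ∈ E, ν.ρ g y ∈ E) ∧ x ∈ E}
  zero_mem' := ⟨⊥, inferInstance, fun g y hy => by
    rw [(Submodule.mem_bot ℂ).1 hy, map_zero]; exact Submodule.zero_mem _, Submodule.zero_mem _⟩
  add_mem' := by
    rintro x y ⟨E, hE, hEi, hx⟩ ⟨F, hF, hFi, hy⟩
    refine ⟨E ⊔ F, inferInstance, fun g z hz => ?_,
      Submodule.add_mem_sup hx hy⟩
    obtain ⟨a, ha, b, hb, rfl⟩ := Submodule.mem_sup.1 hz
    rw [map_add]
    exact Submodule.add_mem_sup (hEi g a ha) (hFi g b hb)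
  smul_mem' := by
    rintro c x ⟨E, hE, hEi, hx⟩
    exact ⟨E, hE, hEi, E.smul_mem c hx⟩

/-- Finite vectors are dense: the eigenspaces of an invariant strictly positive compact operator
are finite-dimensional and invariant, and they span a dense subspace. -/
theorem dense_finiteVectors {ν : URep G} (s : StrictElt ν) :
    Dense (ν.finiteVectors : Set ν.H) := by
  have hsym : (s.val.1 : ν.H →ₗ[ℂ] ν.H).IsSymmetric := s.strict.1.isSymmetric
  rw [Submodule.dense_iff_topologicalClosure_eq_top, Submodule.topologicalClosure_eq_top_iff,
    eq_bot_iff,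
    ← ContinuousLinearMap.orthogonalComplement_iSup_eigenspaces_eq_bot s.val.2 hsym]
  refine Submodule.orthogonal_le (iSup_le fun c x hx => ?_)
  by_cases hc : c = 0
  · rw [hc, Module.End.mem_eigenspace_iff, zero_smul] at hx
    rw [s.injective x hx]
    exact Submodule.zero_mem _
  · refine ⟨_, ContinuousLinearMap.finite_dimensional_eigenspace s.val.2 c hc, fun g y hy => ?_, hx⟩
    have hy' : s.val.1 y = c • y := Module.End.mem_eigenspace_iff.1 hy
    refine Module.End.mem_eigenspace_iff.2 ?_
    have h1 : s.val.1 (ν.ρ g y) = ν.ρ g (s.val.1 y) := DFunLike.congr_fun (s.intertwines g) y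
    change s.val.1 (ν.ρ g y) = _
    rw [h1, hy', map_smul]

/-- An increasing sequence of finite-dimensional subrepresentations with dense union. -/
structure Exhaustion (ν : URep G) where
  F : ℕ → Submodule ℂ ν.H
  fin : ∀ n, FiniteDimensional ℂ (F n)
  inv : ∀ n g, ∀ x ∈ F n, ν.ρ g x ∈ F n
  mono : Monotone F
  dense : Dense {x | ∃ n, x ∈ F n}

attribute [instance] Exhaustion.fin

/-- The finite vectors contain a dense sequence, and sums of the finite-dimensional
subrepresentations through its terms exhaust `ν`. -/
theorem nonempty_exhaustion {ν : URep G} (s : StrictElt ν) : Nonempty (Exhaustion ν) := by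
  have := UniformSpace.secondCountable_of_separable ν.H
  have hd : DenseRange ((↑) : ν.finiteVectors → ν.H) := by
    have := dense_finiteVectors s
    rwa [← Subtype.range_coe (s := (ν.finiteVectors : Set ν.H))] at this
  have hD := hd.comp (TopologicalSpace.denseRange_denseSeq ν.finiteVectors)
    continuous_subtype_val
  choose E hE hEi hxE using fun n => (TopologicalSpace.denseSeq ν.finiteVectors n).2
  refine ⟨⟨partialSups E, fun n => ?_, fun n => ?_, (partialSups E).monotone,
    hD.mono ?_⟩⟩
  · induction n with
    | zero => rw [partialSups_zero]; exact hE 0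
    | succ n ih => rw [partialSups_add_one]; have := hE (n + 1); infer_instance
  · induction n with
    | zero => rw [partialSups_zero]; exact hEi 0
    | succ n ih =>
      intro g x hx
      rw [partialSups_add_one] at hx ⊢
      obtain ⟨a, ha, b, hb, rfl⟩ := Submodule.mem_sup.1 hx
      rw [map_add]
      exact Submodule.add_mem_sup (ih g a ha) (hEi _ g b hb)
  · rintro _ ⟨n, rfl⟩
    exact ⟨n, le_partialSups E n (hxE n)⟩

namespace Exhaustion

variable {ν : URep G} (e : Exhaustion ν)

/-- The `n`-th subrepresentation of an exhaustion. -/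
abbrev rep (n : ℕ) : URep G :=
  ν.subrep (e.F n) (Submodule.closed_of_finiteDimensional _) (e.inv n)

theorem sub_rep (n : ℕ) : (e.rep n).Sub ν := sub_subrep _ _ _ _

theorem rep_sub_rep {m n : ℕ} (h : m ≤ n) : (e.rep m).Sub (e.rep n) :=
  ⟨⟨Submodule.inclusion (e.mono h), fun _ => rfl⟩, fun _ _ => rfl⟩

/-- The equivariant isometric embeddings of the `n`-th subrepresentation into `lam`. -/
abbrev Emb (lam : URep G) (n : ℕ) : Type :=
  {W : (e.rep n).H →L[ℂ] lam.H // Intertwines W ∧ adjoint W ∘L W = .id ℂ (e.rep n).H}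

variable {e}

theorem exists_emb {lam : URep G} {n : ℕ} (h : (e.rep n).Sub lam) : Nonempty (e.Emb lam n) := by
  obtain ⟨V, hV⟩ := h
  exact ⟨V.toContinuousLinearMap, fun g => ContinuousLinearMap.ext fun ξ => hV g ξ,
    adjoint_linearIsometry_comp V⟩

/-- An embedding of the `n`-th term extends, up to a small error, to an embedding of the next one.
-/
theorem Emb.exists_next {lam : URep G} {n : ℕ} (h : (e.rep (n + 1)).Sub lam) (V : e.Emb lam n)
    {ε : ℝ} (hε : 0 < ε) : ∃ W : e.Emb lam (n + 1), ∀ x (hx : x ∈ e.F n),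
      ‖W.1 ⟨x, e.mono n.le_succ hx⟩ - V.1 ⟨x, hx⟩‖ ≤ ε * ‖x‖ := by
  obtain ⟨B, hB, hBB⟩ := exists_emb h
  let I : (e.rep n).H →ₗᵢ[ℂ] (e.rep (n + 1)).H :=
    ⟨Submodule.inclusion (e.mono n.le_succ), fun _ => rfl⟩
  have hI : Intertwines (μ := e.rep n) (ν := e.rep (n + 1)) I.toContinuousLinearMap :=
    fun g => ContinuousLinearMap.ext fun ξ => rfl
  have hBI : adjoint (B ∘L I.toContinuousLinearMap) ∘L (B ∘L I.toContinuousLinearMap)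
      = .id ℂ (e.rep n).H := by
    rw [adjoint_comp, ContinuousLinearMap.comp_assoc, ← ContinuousLinearMap.comp_assoc (adjoint B),
      hBB]
    exact adjoint_linearIsometry_comp I
  have : FiniteDimensional ℂ (e.rep n).H := e.fin n
  obtain ⟨u, hu, huu, hn⟩ := exists_isometry_comp_near V.2.1 (hB.comp hI) V.2.2 hBI hε
  refine ⟨⟨u ∘L B, hu.comp hB, ?_⟩, fun x hx => hn ⟨x, hx⟩⟩
  rw [adjoint_comp, ContinuousLinearMap.comp_assoc,
    ← ContinuousLinearMap.comp_assoc (adjoint u), huu]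
  exact hBB

/-- A representation containing every term of an exhaustion of `ν` contains `ν`: the embeddings of
the terms can be chosen to converge. -/
theorem sub_of_forall_sub {lam : URep G} (h : ∀ n, (e.rep n).Sub lam) : ν.Sub lam := by
  choose next hnext using fun n (V : e.Emb lam n) =>
    Emb.exists_next (h (n + 1)) V (ε := (1 / 2) ^ n) (by positivity)
  let W : ∀ n, e.Emb lam n := fun n => Nat.rec (exists_emb (h 0)).some next n
  have hW : ∀ n, W (n + 1) = next n (W n) := fun n => rfl
  have hWn : ∀ n x, ‖(W n).1 x‖ = ‖x‖ := fun n =>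
    (ContinuousLinearMap.norm_map_iff_adjoint_comp_self (W n).1).2 (W n).2.2
  let J : ∀ n, (e.rep n).H →L[ℂ] ν.H := fun n => (e.F n).subtypeₗᵢ.toContinuousLinearMap
  have hJ : ∀ n, Intertwines (μ := e.rep n) (ν := ν) (J n) := fun n g =>
    ContinuousLinearMap.ext fun ξ => rfl
  have hJJ : ∀ n x, adjoint (J n) (J n x) = x := fun n x =>
    DFunLike.congr_fun (adjoint_linearIsometry_comp (e.F n).subtypeₗᵢ) x
  let A : ℕ → ν.H →L[ℂ] lam.H := fun n => (W n).1 ∘L adjoint (J n)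
  have hA : ∀ n, Intertwines (A n) := fun n => (W n).2.1.comp (hJ n).adj
  have hAF : ∀ n x (hx : x ∈ e.F n), A n x = (W n).1 ⟨x, hx⟩ := fun n x hx =>
    congrArg (W n).1 (hJJ n ⟨x, hx⟩)
  have hAn : ∀ n z, ‖A n z‖ ≤ ‖z‖ := fun n z => by
    refine (hWn n _).trans_le (((adjoint (J n)).le_of_opNorm_le (c := 1) ?_ z).trans_eq (one_mul _))
    rw [LinearIsometryEquiv.norm_map]
    exact LinearIsometry.norm_toContinuousLinearMap_le _
  have hcauchyF : ∀ m, ∀ x ∈ e.F m, CauchySeq fun n => A n x := fun m x hx => by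
    rw [← cauchySeq_shift m]
    refine cauchySeq_of_le_geometric (1 / 2) ‖x‖ (by norm_num) fun n => ?_
    have hx' : x ∈ e.F (n + m) := e.mono (by omega) hx
    have h1 : ‖A (n + m + 1) x - A (n + m) x‖ ≤ (1 / 2) ^ (n + m) * ‖x‖ := by
      rw [hAF (n + m) x hx', hAF (n + m + 1) x (e.mono (n + m).le_succ hx')]
      exact hnext (n + m) (W (n + m)) x hx'
    have h2 : A (n + 1 + m) x = A (n + m + 1) x := by
      rw [Nat.add_right_comm]
    rw [dist_comm, dist_eq_norm, h2]
    refine h1.trans ?_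
    rw [mul_comm]
    exact mul_le_mul_of_nonneg_left (pow_le_pow_of_le_one (by norm_num) (by norm_num) (by omega))
      (norm_nonneg _)
  have hcauchy : ∀ z, CauchySeq fun n => A n z := fun z => by
    refine Metric.cauchySeq_iff'.2 fun ε hε => ?_
    obtain ⟨x, hzx, m, hx⟩ := Metric.dense_iff.1 e.dense z (ε / 4) (by positivity)
    obtain ⟨k, hk⟩ := Metric.cauchySeq_iff'.1 (hcauchyF m x hx) (ε / 2) (by positivity)
    refine ⟨k, fun n hn => ?_⟩
    have h1 := hk n hn
    rw [Metric.mem_ball, dist_comm, dist_eq_norm] at hzx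
    rw [dist_eq_norm] at h1 ⊢
    have e1 : A n z - A k z = A n (z - x) - A k (z - x) + (A n x - A k x) := by
      rw [map_sub, map_sub]; abel
    rw [e1]
    have h2 := norm_sub_le (A n (z - x)) (A k (z - x))
    have h3 := norm_add_le (A n (z - x) - A k (z - x)) (A n x - A k x)
    linarith [hAn n (z - x), hAn k (z - x)]
  choose V₀ hV₀ using fun z => cauchySeq_tendsto_of_complete (hcauchy z)
  let V : ν.H →L[ℂ] lam.H := continuousLinearMapOfTendsto A (tendsto_pi_nhds.2 hV₀)
  have hV : ∀ z, Tendsto (fun n => A n z) atTop (𝓝 (V z)) := hV₀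
  have hVn : ∀ z, ‖V z‖ = ‖z‖ := fun z => by
    refine e.dense.induction (P := fun z => ‖V z‖ = ‖z‖) ?_
      (isClosed_eq (by fun_prop) (by fun_prop)) z
    rintro x ⟨m, hx⟩
    refine tendsto_nhds_unique (hV x).norm (tendsto_const_nhds.congr' ?_)
    filter_upwards [eventually_ge_atTop m] with n hn
    rw [hAF n x (e.mono hn hx), hWn]
    rfl
  refine ⟨⟨V.toLinearMap, hVn⟩, fun g z => ?_⟩
  refine tendsto_nhds_unique (hV (ν.ρ g z)) ?_
  refine (((lam.op g).continuous.tendsto _).comp (hV z)).congr fun n => ?_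
  exact (DFunLike.congr_fun (hA n g) z).symm

/-- A representation is the supremum in `Cu(G)` of any exhaustion. -/
theorem isLUB_rep : IsLUB (Set.range fun n => CuRep.mk (e.rep n)) (CuRep.mk ν) := by
  refine ⟨?_, fun t ht => ?_⟩
  · rintro _ ⟨n, rfl⟩
    exact e.sub_rep n
  · induction t using Quotient.ind with | _ lam => ?_
    exact sub_of_forall_sub fun n => ht ⟨n, rfl⟩

end Exhaustion

end URep

/-- A class compactly contained in `[ν]` lies below a finite-dimensional subrepresentation of
`ν`. -/
theorem CuRep.exists_le_finiteDimensional {ν : URep G} (s : StrictElt ν) {r : CuRep G}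
    (h : CompactlyContained r (CuRep.mk ν)) : ∃ (N : URep G) (J : N.H →ₗᵢ[ℂ] ν.H),
      FiniteDimensional ℂ N.H ∧ (∀ g x, J (N.ρ g x) = ν.ρ g (J x)) ∧ r ≤ CuRep.mk N := by
  obtain ⟨e⟩ := nonempty_exhaustion s
  obtain ⟨k, hk⟩ := h _ (fun m n hmn => e.rep_sub_rep hmn) _ e.isLUB_rep le_rfl
  exact ⟨e.rep k, (e.F k).subtypeₗᵢ, e.fin k, fun _ _ => rfl, hk⟩

end

/-! ### The action preserves compact containment -/

section

variable {G : Type v} [Group G] [TopologicalSpace G] {X : GCStar.{u} G}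

/-- On a finite-dimensional representation the identity is a strictly positive invariant compact
operator. -/
def StrictElt.ofFiniteDimensional (N : URep G) [FiniteDimensional ℂ N.H] : StrictElt N where
  val := ⟨.id ℂ N.H, by
    have := FiniteDimensional.proper ℂ N.H
    exact isCompactOperator_of_locallyCompactSpace_dom _⟩
  strict := isStrictlyPos_of_injective (ContinuousLinearMap.isPositive_id) fun _ h => h
  inv g := (congrArg _ (ContinuousLinearMap.id_comp _)).trans (N.op_comp_inv g)

/-- A strictly positive invariant operator is locally invertible: its compression to a
finite-dimensional subrepresentation is invertible, so that a compact intertwiner conjugates it to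
the projection onto that subrepresentation. -/
theorem StrictElt.exists_conj_eq_projection {ν N : URep G} (s : StrictElt ν)
    [FiniteDimensional ℂ N.H] {J : N.H →L[ℂ] ν.H} (hJ : Intertwines J)
    (hJJ : adjoint J ∘L J = .id ℂ N.H) :
    ∃ f ∈ opAlg ν, f ∘L s.val.1 ∘L adjoint f = J ∘L adjoint J := by
  have htp : (adjoint J ∘L s.val.1 ∘L J).IsPositive := s.strict.1.adjoint_conj J
  have htm : adjoint J ∘L s.val.1 ∘L J ∈ commAlg N := hJ.adj.comp (s.intertwines.comp hJ)
  have hinj : Function.Injective (adjoint J ∘L s.val.1 ∘L J : N.H →L[ℂ] N.H) := by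
    refine (injective_iff_map_eq_zero _).2 fun x hx => ?_
    obtain ⟨R, hR⟩ := exists_adjoint_comp s.strict.1
    have h1 : R (J x) = 0 := by
      rw [← inner_self_eq_zero (𝕜 := ℂ), ← ContinuousLinearMap.adjoint_inner_right]
      have h2 : adjoint R (R (J x)) = s.val.1 (J x) := DFunLike.congr_fun hR.symm (J x)
      rw [h2, ← ContinuousLinearMap.adjoint_inner_right]
      exact (congrArg _ hx).trans (inner_zero_right x)
    have h2 : s.val.1 (J x) = adjoint R (R (J x)) := DFunLike.congr_fun hR (J x)
    rw [h1, map_zero] at h2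
    have h3 : adjoint J (J x) = x := DFunLike.congr_fun hJJ x
    rw [← h3, s.injective _ h2, map_zero]
  have hu : IsUnit (adjoint J ∘L s.val.1 ∘L J) := by
    rw [ContinuousLinearMap.isUnit_iff_bijective]
    exact ⟨hinj, (LinearMap.injective_iff_surjective
      (f := ((adjoint J ∘L s.val.1 ∘L J : N.H →L[ℂ] N.H) : N.H →ₗ[ℂ] N.H))).1 hinj⟩
  obtain ⟨r, q, -, hrr, hqr, hrq, hqs, hq⟩ := exists_sqrt_inverse
    ((ContinuousLinearMap.nonneg_iff_isPositive _).2 htp) hu htm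
  have := FiniteDimensional.proper ℂ N.H
  have hqc : IsCompactOperator q := isCompactOperator_of_locallyCompactSpace_dom q
  have hqtq : q ∘L (adjoint J ∘L s.val.1 ∘L J) ∘L q = .id ℂ N.H := by
    rw [← hrr]
    calc _ = (q * r) * (r * q) := by simp only [mul_assoc]; rfl
      _ = 1 := by rw [hqr, hrq, one_mul]
  have hqs' : adjoint q = q := hqs
  refine ⟨J ∘L q ∘L adjoint J, ⟨(hqc.comp_clm (adjoint J)).clm_comp J, hJ.comp (hq.comp hJ.adj)⟩, ?_⟩
  rw [adjoint_comp, adjoint_comp, adjoint_adjoint, hqs']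
  calc _ = J ∘L (q ∘L (adjoint J ∘L s.val.1 ∘L J) ∘L q) ∘L adjoint J := rfl
    _ = _ := by rw [hqtq]; rfl

/-- Local units tensor: if `f s f^*` is a projection `p`, then `s ⊗ a` has a local unit for `p ⊗
c`. -/
theorem localUnit_tensor {ν μ : URep G} {s p f : ν.H →L[ℂ] ν.H} (hf : f ∈ opAlg ν)
    (hfp : f ∘L s ∘L adjoint f = p) (hpp : p ∘L p = p) {a c : OpFam X.carrier μ.H μ.H}
    (h : LocalUnit X μ a c) :
    LocalUnit X (ν.tensor μ) (OpFam.tensor s a) (OpFam.tensor p c) := by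
  obtain ⟨d, hd, hdc⟩ := h
  refine ⟨OpFam.tensor f d, tensor_mem_invK hf.1 hf.2 hd, ?_⟩
  have h1 := tensor_conj f s d a
  have h2 := tensor_comp p p (comp (comp d a) (adj d)) c
  rw [hpp, hdc] at h2
  rw [hfp] at h1
  exact (congrArg (fun z => comp z _) h1).trans h2

namespace CuG

variable [IsTopologicalGroup G] [CompactSpace G] [T2Space G]

theorem compactlyContained_smul {x y : CuG X} {r t : CuRep G} (hxy : CompactlyContained x y)
    (hrt : CompactlyContained r t) : CompactlyContained (r • x) (t • y) := by
  obtain ⟨ν, s, rfl, hs⟩ := exists_smul_eq.{u} t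
  induction y using CuG.ind with | h b => ?_
  obtain ⟨N, J', hN, hJ', hrN⟩ := CuRep.exists_le_finiteDimensional s hrt
  obtain ⟨ε, hε, hx⟩ := exists_le_cut hxy
  let J : N.H →L[ℂ] ν.H := J'.toContinuousLinearMap
  have hJ : Intertwines J := fun g => ContinuousLinearMap.ext fun ξ => hJ' g ξ
  have hJJ : adjoint J ∘L J = .id ℂ N.H := adjoint_linearIsometry_comp J'
  obtain ⟨f, hf, hfs⟩ := s.exists_conj_eq_projection hJ hJJ
  have hJc : IsCompactOperator J := by
    have := (StrictElt.ofFiniteDimensional N).val.2.clm_comp J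
    exact this
  have hp : (J ∘L adjoint J).IsPositive := ContinuousLinearMap.isPositive_self_comp_adjoint J
  have hpm : J ∘L adjoint J ∈ opAlg ν := ⟨hJc.comp_clm (adjoint J), hJ.comp hJ.adj⟩
  have hpp : (J ∘L adjoint J) ∘L (J ∘L adjoint J) = J ∘L adjoint J :=
    calc _ = J ∘L (adjoint J ∘L J) ∘L adjoint J := rfl
      _ = _ := by rw [hJJ]; rfl
  have hle : PosElt.tensor (StrictElt.ofFiniteDimensional N) (b.cut hε.le)
      ≤ PosElt.tensorOp (J ∘L adjoint J) hpm hp (b.cut hε.le) := by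
    refine PosElt.tensorOp_le (StrictElt.ofFiniteDimensional N).mem_opAlg
      (StrictElt.ofFiniteDimensional N).strict.1 hpm hp (fun δ hδ => ⟨adjoint J, ?_, hJ.adj, ?_⟩) le_rfl
    · exact (StrictElt.ofFiniteDimensional N).val.2.comp_clm (adjoint J)
    · have e : adjoint J ∘L (J ∘L adjoint J) ∘L adjoint (adjoint J) = .id ℂ N.H := by
        rw [adjoint_adjoint]
        calc _ = (adjoint J ∘L J) ∘L (adjoint J ∘L J) := rfl
          _ = _ := by rw [hJJ]; rfl
      rw [e]
      exact (norm_eq_zero.2 (sub_self _)).trans_lt hδ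
  rw [hs]
  refine CompactlyContained.mono ?_ le_rfl (compactlyContained_of_localUnit _ _
    (PosElt.tensorOp (J ∘L adjoint J) hpm hp (b.cut hε.le)).mem
    (PosElt.tensorOp (J ∘L adjoint J) hpm hp (b.cut hε.le)).pos
    (localUnit_tensor hf hfs hpp (b.localUnit_cut hε)))
  refine (smul_le_smul' hx hrN).trans ?_
  rw [smul_mk (StrictElt.ofFiniteDimensional N)]
  exact hle

end CuG

end

/-! ### The functors -/

section

variable {G : Type v} [Group G] [TopologicalSpace G] {X Y : GCStar.{u} G}

namespace CuG

theorem map_id (X : GCStar.{u} G) : map (CategoryTheory.CategoryStruct.id X) = id :=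
  funext (ind fun _ => rfl)

theorem map_comp {X Y Z : GCStar.{u} G} (φ : X ⟶ Y) (ψ : Y ⟶ Z) :
    map (CategoryTheory.CategoryStruct.comp φ ψ) = map ψ ∘ map φ :=
  funext (ind fun _ => rfl)

variable [IsTopologicalGroup G] [CompactSpace G] [T2Space G]

theorem isCuGSemimodule (X : GCStar.{u} G) : IsCuGSemimodule G (CuG X) where
  one_smul := one_smul'
  mul_smul := mul_smul'
  add_smul := add_smul'
  smul_add := smul_add'
  zero_smul := zero_smul'
  smul_zero := smul_zero'
  isCu := isCuSemigroup X
  smul_mono _ _ _ _ hxy hrs := smul_le_smul' hxy hrs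
  smul_compact _ _ _ _ hxy hrs := compactlyContained_smul hxy hrs
  sup_smul _ _ hx hr _ _ hx₀ hr₀ := isLUB_smul hx hr hx₀ hr₀

theorem isCuGMorphism_map (φ : X ⟶ Y) : IsCuGMorphism G (map φ) :=
  ⟨isCuMorphism_map φ, map_smul' φ⟩

end CuG

end

end EqCuntz
end

open EqCuntz CategoryTheory
theorem mainTheorem6 {G : Type v} [Group G] [TopologicalSpace G] [IsTopologicalGroup G]
    [CompactSpace G] [T2Space G] :
    (∀ ν : URep G, Nonempty (StrictElt ν)) ∧
    (∀ (A : GCStar.{u} G) (ν ν' : URep G) (s : StrictElt ν) (s' : StrictElt ν') (a a' : PosElt A),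
      CuRep.mk ν = CuRep.mk ν' → CuG.mk a = CuG.mk a' →
        CuG.mk (PosElt.tensor s a) = CuG.mk (PosElt.tensor s' a')) ∧
    (∀ (A : GCStar.{u} G) (ν : URep G) (s : StrictElt ν) (a : PosElt A),
      CuRep.mk ν • CuG.mk a = CuG.mk (PosElt.tensor s a)) ∧
    ∃ (hobj : ∀ A : GCStar.{u} G, IsCuGSemimodule G (CuG A))
      (hmor : ∀ {A B : GCStar.{u} G} (φ : A ⟶ B), IsCuGMorphism G (CuG.map φ)),
      (∃ F : GCStar.{u} G ⥤ CuGCat G, F.toPrefunctor =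
        { obj := fun A => ⟨CuG A, hobj A⟩
          map := fun φ => ⟨CuG.map φ, hmor φ⟩ }) ∧
      (∃ F : GCStar.{u} G ⥤ CuCat, F.toPrefunctor =
        { obj := fun A => ⟨CuG A, (hobj A).isCu⟩
          map := fun φ => ⟨CuG.map φ, (hmor φ).isCu⟩ }) := by
  refine ⟨fun ν => nonempty_strictElt ν, fun A ν ν' s s' a a' h ha => CuG.mk_tensor_eq s s' h ha,
    fun A ν s a => CuG.smul_mk s a, CuG.isCuGSemimodule, fun φ => CuG.isCuGMorphism_map φ,
    ⟨{ obj := fun A => ⟨CuG A, _⟩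
       map := fun φ => ⟨CuG.map φ, _⟩
       map_id := fun A => Subtype.ext (CuG.map_id A)
       map_comp := fun φ ψ => Subtype.ext (CuG.map_comp φ ψ) }, rfl⟩,
    ⟨{ obj := fun A => ⟨CuG A, _⟩
       map := fun φ => ⟨CuG.map φ, _⟩
       map_id := fun A => Subtype.ext (CuG.map_id A)
       map_comp := fun φ ψ => Subtype.ext (CuG.map_comp φ ψ) }, rfl⟩⟩
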